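/- **Setting.** Let $\Omega\subset\mathbb R^n$ be open. Let $C^1_0(\Omega,\mathbb R^n)$ be the space of $C^1$ vector fields on $\Omega$ which, together with their derivative, vanish on $\partial\Omega$ and at infinity. Let $V\subset C^1_0(\Omega,\mathbb R^n)$ be an admissible Hilbert space, i.e. $\|u\|_\infty+\|Du\|_\infty\le C\|u\|_V$ for all $u\in V$ and some constant $C$, regarded as a reproducing kernel Hilbert space with matrix-valued reproducing kernel $K$; put $\mathcal K(\varphi)=\int_\Omega K(\cdot,y)\varphi(y)\,dy$. Let $\mathcal X^2=L^2([0,1],V)$. For $v\in\mathcal X^2$ let $\varphi^v_t$ be the flow $\varphi_t^v(x)=x+\int_0^t v(s,\varphi_s^v(x))\,ds$, let $\varphi^v_{s,t}=\varphi^v_t\circ(\varphi^v_s)^{-1}$ for $s,t\in[0,1]$, let $\varphi.f=f\circ\varphi^{-1}$, and let $|D\varphi|$ be the Jacobian determinant of $\varphi$. Let $X$ be a normed space of images, with a continuous linear map $\iota:X\to L^2(\Omega,\mathbb R)$ with dense range (for example $X=L^2(\Omega,\mathbb R)$ and $\iota=\mathrm{id}$, or a dense space of smoother images with its inclusion); for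 $f\in X$ we also write $f$ for $\iota f$. A functional $\Phi:X\to\mathbb R$ has gradient $G\in L^2(\Omega,\mathbb R)$ at $f$ if it is Fréchet differentiable at $f$ with $D\Phi(f)h=\langle G,h\rangle_{L^2(\Omega)}$ for all $h\in X$. Let $\mathcal D$ be a data discrepancy, $\mathcal T_t$ ($0\le t\le 1$) forward operators defined on $L^2(\Omega,\mathbb R)$, $g$ time-dependent data, and $\mathcal D_{g_t}(F)=\mathcal D(\mathcal T_t(F),g(t,\cdot))$ for $F\in L^2(\Omega,\mathbb R)$. Assume that every $\mathcal D_{g_t}$ is Fréchet differentiable on $L^2(\Omega,\mathbb R)$, with gradient $\nabla\mathcal D_{g_t}$; that $t\mapsto\mathcal D_{g_t}(F)$ is integrable on $[0,1]$ for every $F$; and that every $F_0\in L^2(\Omega,\mathbb R)$ has a neighbourhood $U$ and an integrable function $L$ on $[0,1]$ with $\|\nabla\mathcal D_{g_t}(F)\|_{L^2}\le L(t)$ for all $F\in U$ and $t\in[0,1]$. Let $\mathcal R_1:X\to\mathbb R$ and $\mu_1,\mu_2\in\mathbb R$ (in particular $\mu_1,\mu_2\ge 0$), and put $$J_1(f,v)=\int_0^1\Bigl[\mathcal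 D_{g_t}(\varphi_{0,t}^v.f)+\mu_2\int_0^t\|v(\tau,\cdot)\|_V^2\,d\tau\Bigr]dt+\mu_1\mathcal R_1(f),\qquad (f,v)\in X\times\mathcal X^2 .$$ **Theorem.** The flows exist and are bijections of $\Omega$, for all $F\in L^2(\Omega,\mathbb R)$ and $s,t\in[0,1]$ the functions $\varphi_{0,t}^v.F$ and $|D\varphi_{s,t}^v|\,F(\varphi_{s,t}^v)$ are in $L^2(\Omega,\mathbb R)$, and the integrals defining $J_1$ converge, as do all integrals below. Let $v\in\mathcal X^2$, and let $f\in X$ be (represented on $\Omega$ by) a differentiable function with $\nabla f\in L^2(\Omega,\mathbb R^n)$, such that $\mathcal R_1$ has a gradient $\nabla\mathcal R_1(f)$ at $f$. 1. $J_1(f,\cdot):\mathcal X^2\to\mathbb R$ is Fréchet differentiable at $v$, and its $\mathcal X^2$-gradient is $$\nabla_vJ_1(f,v)(t,\cdot)=\mathcal K\Bigl(-\nabla(\varphi_{0,t}^v.f)\int_t^1|D\varphi_{t,\tau}^v|\;\nabla\mathcal D_{g_\tau}(\varphi_{0,\tau}^v.f)(\varphi_{t,\tau}^v)\,d\tau\Bigr)+2\mu_2(1-t)\,v(t,\cdot)$$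 for almost every $t\in[0,1]$, where the time integral is taken in $L^2(\Omega,\mathbb R)$; the first term is a well-defined element of $V$ for every $t\in[0,1]$. 2. $J_1(\cdot,v):X\to\mathbb R$ has at $f$ the gradient $$\nabla_fJ_1(f,v)=\int_0^1|D\varphi_{0,t}^v|\;\nabla\mathcal D_{g_t}(\varphi_{0,t}^v.f)(\varphi_{0,t}^v)\,dt+\mu_1\nabla\mathcal R_1(f).$$ 3. The first-order optimality conditions for minimising $J_1$ over $X\times\mathcal X^2$ are that both gradients vanish: if $(f,v)$ is a local (in particular, a global) minimiser of $J_1$, then $\nabla_vJ_1(f,v)=0$ in $\mathcal X^2$ and $\nabla_fJ_1(f,v)=0$. -/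

import Mathlib

open MeasureTheory Set Filter Topology

noncomputable section

namespace LDDMM

/-- The ambient Euclidean space `ℝⁿ`. -/
abbrev Space (n : ℕ) : Type := EuclideanSpace ℝ (Fin n)

/-- The Hilbert space `L²(Ω, ℝ)` of images on `Ω ⊆ ℝⁿ`. -/
abbrev ImageL2 {n : ℕ} (Ω : Set (Space n)) : Type :=
  Lp ℝ 2 ((volume : Measure (Space n)).restrict Ω)

/-- The Hilbert space `L²([0,1], V)` of time-dependent velocity fields. -/
abbrev VelocityL2 (V : Type*) [NormedAddCommGroup V] : Type _ :=
  Lp V 2 ((volume : Measure ℝ).restrict (Icc 0 1))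

/-- `u ∈ C¹₀(Ω, ℝⁿ)`: continuously differentiable vector fields on the open set `Ω` such that `u`
and `Du` vanish on the boundary of `Ω` and at infinity. A field on `Ω` is identified with its
extension by zero to `ℝⁿ`, which is again `C¹`. -/
structure IsC10 {n : ℕ} (Ω : Set (Space n)) (u : Space n → Space n) : Prop where
  contDiff : ContDiff ℝ 1 u
  eq_zero : ∀ x, x ∉ Ω → u x = 0
  fderiv_eq_zero : ∀ x, x ∉ Ω → fderiv ℝ u x = 0
  tendsto_zero : Tendsto u (cocompact (Space n)) (𝓝 0)
  tendsto_fderiv_zero : Tendsto (fderiv ℝ u) (cocompact (Space n)) (𝓝 0)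

section Fields

variable {n : ℕ} {V : Type*} [NormedAddCommGroup V] [InnerProductSpace ℝ V]
  [RKHS ℝ V (Space n) (Space n)]

/-- A Hilbert space `V` of vector fields is admissible on `Ω` if it is continuously embedded in
`C¹₀(Ω, ℝⁿ)` with the norm `‖u‖_∞ + ‖Du‖_∞`. -/
structure IsAdmissible (Ω : Set (Space n)) (V : Type*) [NormedAddCommGroup V]
    [InnerProductSpace ℝ V] [RKHS ℝ V (Space n) (Space n)] : Prop where
  isC10 : ∀ u : V, IsC10 Ω (⇑u)
  norm_le : ∃ C : ℝ, ∀ (u : V) (x y : Space n), ‖u x‖ + ‖fderiv ℝ (⇑u) y‖ ≤ C * ‖u‖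

/-- `γ` solves `γ' (t) = v (t, γ (t))`, `γ (0) = x` on `[0,1]`, in integrated form (the field is only
square integrable in time). -/
structure IsFlowLine (v : VelocityL2 V) (x : Space n) (γ : ℝ → Space n) : Prop where
  continuousOn : ContinuousOn γ (Icc 0 1)
  integrable : IntegrableOn (fun s => (v s : V) (γ s)) (Icc 0 1)
  eq_integral : ∀ t ∈ Icc (0 : ℝ) 1, γ t = x + ∫ s in (0 : ℝ)..t, (v s : V) (γ s)

/-- The flow `φ_t^v` of the velocity field `v`: `t ↦ flow v t x` is the (unique on `[0,1]`) solution
starting at `x`. -/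
def flow (v : VelocityL2 V) (t : ℝ) (x : Space n) : Space n :=
  Classical.epsilon (IsFlowLine v x) t

/-- `φ_{s,t}^v = φ_t^v ∘ (φ_s^v)⁻¹`. -/
def transition (v : VelocityL2 V) (s t : ℝ) : Space n → Space n :=
  flow v t ∘ Function.invFun (flow v s)

/-- The geometric group action `ψ . u = u ∘ ψ⁻¹` on functions. -/
def geomAct (ψ : Space n → Space n) (u : Space n → ℝ) : Space n → ℝ :=
  u ∘ Function.invFun ψ

/-- The function `|Dψ| (u ∘ ψ)`, with `|Dψ|` the determinant of the Jacobian. -/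
def jacComp (ψ : Space n → Space n) (u : Space n → ℝ) : Space n → ℝ :=
  fun x => (fderiv ℝ ψ x).det * u (ψ x)

/-- The class in `L²(Ω, ℝ)` of a square integrable function. -/
def toL2 (Ω : Set (Space n)) (u : Space n → ℝ) : ImageL2 Ω :=
  open Classical in if h : MemLp u 2 (volume.restrict Ω) then h.toLp u else 0

/-- The deformed image `φ_{0,t}^v . F`, as an element of `L²(Ω, ℝ)`. -/
def deformed {Ω : Set (Space n)} (v : VelocityL2 V) (t : ℝ) (F : ImageL2 Ω) : ImageL2 Ω :=
  toL2 Ω (geomAct (transition v 0 t) F)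

/-- The integral operator `φ ↦ ∫_Ω K(·, y) φ(y) dy` of the reproducing kernel `K` of `V`. -/
def kernelOp (Ω : Set (Space n)) (V : Type*) [NormedAddCommGroup V] [InnerProductSpace ℝ V]
    [CompleteSpace V] [RKHS ℝ V (Space n) (Space n)] (φ : Space n → Space n) (x : Space n) :
    Space n :=
  ∫ y in Ω, RKHS.kernel V x y (φ y)

end Fields

/-- The data term `D_{g_t}(F) = D(A_t(F), g(t))`. -/
def dataTerm {n : ℕ} {Ω : Set (Space n)} {Y : Type*} (D : Y → Y → ℝ) (A : ℝ → ImageL2 Ω → Y)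
    (g : ℝ → Y) (t : ℝ) (F : ImageL2 Ω) : ℝ :=
  D (A t F) (g t)

/-- The data terms `M t : L²(Ω) → ℝ`, `t ∈ [0,1]`, are differentiable, integrable in time for every
image, and their gradients are, locally uniformly in the image, dominated by an integrable function
of time. -/
structure IsDifferentiableDataTerm {n : ℕ} {Ω : Set (Space n)} (M : ℝ → ImageL2 Ω → ℝ) :
    Prop where
  differentiable : ∀ t ∈ Icc (0 : ℝ) 1, Differentiable ℝ (M t)
  integrable : ∀ F, IntegrableOn (fun t => M t F) (Icc 0 1)
  dominated : ∀ F₀, ∃ r > 0, ∃ L : ℝ → ℝ, IntegrableOn L (Icc 0 1) ∧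
    ∀ t ∈ Icc (0 : ℝ) 1, ∀ F ∈ Metric.ball F₀ r, ‖gradient (M t) F‖ ≤ L t

/-- Let `ι : X → L²(Ω)` realise the elements of a normed space `X` as images. The functional
`Φ : X → ℝ` is (Fréchet) differentiable at `f` with `L²`-gradient `G`, that is
`DΦ(f) h = ⟨G, h⟩_{L²(Ω)}`. For `X = L²(Ω)` this is the usual gradient. -/
def HasL2GradientAt {n : ℕ} {Ω : Set (Space n)} {X : Type*} [NormedAddCommGroup X]
    [NormedSpace ℝ X] (ι : X →L[ℝ] ImageL2 Ω) (Φ : X → ℝ) (G : ImageL2 Ω) (f : X) : Prop :=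
  HasFDerivAt Φ ((innerSL ℝ G).comp ι) f

section Functional

variable {n : ℕ} {Ω : Set (Space n)} {V : Type*} [NormedAddCommGroup V] [InnerProductSpace ℝ V]
  [RKHS ℝ V (Space n) (Space n)]

/-- The objective
`J₁(f, v) = ∫₀¹ [D_{g_t}(φ_{0,t}^v . f) + μ₂ ∫₀ᵗ ‖v(τ,·)‖²_V dτ] dt + μ₁ R₁(f)`,
where `M t` stands for `D_{g_t}`. -/
def objective {X : Type*} [NormedAddCommGroup X] [NormedSpace ℝ X] (ι : X →L[ℝ] ImageL2 Ω)
    (M : ℝ → ImageL2 Ω → ℝ) (R₁ : X → ℝ) (μ₁ μ₂ : ℝ) (f : X) (v : VelocityL2 V) : ℝ :=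
  (∫ t in (0 : ℝ)..1,
      (M t (deformed v t (ι f)) + μ₂ * ∫ τ in (0 : ℝ)..t, ‖(v τ : V)‖ ^ 2))
    + μ₁ * R₁ f

/-- `|Dφ_{t,τ}^v| ∇D_{g_τ}(φ_{0,τ}^v . F)(φ_{t,τ}^v)` as an element of `L²(Ω)`. -/
def pulledGradient (M : ℝ → ImageL2 Ω → ℝ) (v : VelocityL2 V) (F : ImageL2 Ω) (t τ : ℝ) :
    ImageL2 Ω :=
  toL2 Ω (jacComp (transition v t τ) (gradient (M τ) (deformed v τ F) : ImageL2 Ω))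

/-- The vector field
`-∇(φ_{0,t}^v . f) ∫_t^1 |Dφ_{t,τ}^v| ∇D_{g_τ}(φ_{0,τ}^v . f)(φ_{t,τ}^v) dτ` on `Ω`. Here `f` is a
function, `F` its class in `L²(Ω)`, and the time integral is the Bochner integral in `L²(Ω)`. -/
def forceField (M : ℝ → ImageL2 Ω → ℝ) (v : VelocityL2 V) (F : ImageL2 Ω) (f : Space n → ℝ)
    (t : ℝ) (y : Space n) : Space n :=
  -((∫ τ in t..1, pulledGradient M v F t τ : ImageL2 Ω) y •
    gradient (geomAct (transition v 0 t) f) y)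

/-- The flow of every velocity field exists and consists of bijections of `Ω`, deformed and
pulled back images are square integrable, and the objective is given by convergent integrals. -/
structure IsWellDefined (Ω : Set (Space n)) (V : Type*) [NormedAddCommGroup V]
    [InnerProductSpace ℝ V] [RKHS ℝ V (Space n) (Space n)] (M : ℝ → ImageL2 Ω → ℝ) : Prop where
  flow_isFlowLine : ∀ (v : VelocityL2 V) (x : Space n), IsFlowLine v x (fun t => flow v t x)
  flow_bijective : ∀ (v : VelocityL2 V), ∀ t ∈ Icc (0 : ℝ) 1,
    Function.Bijective (flow v t) ∧ BijOn (flow v t) Ω Ω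
  memLp_geomAct : ∀ (v : VelocityL2 V), ∀ t ∈ Icc (0 : ℝ) 1, ∀ F : ImageL2 Ω,
    MemLp (geomAct (transition v 0 t) F) 2 (volume.restrict Ω)
  memLp_jacComp : ∀ (v : VelocityL2 V), ∀ s ∈ Icc (0 : ℝ) 1, ∀ t ∈ Icc (0 : ℝ) 1,
    ∀ F : ImageL2 Ω, MemLp (jacComp (transition v s t) F) 2 (volume.restrict Ω)
  integrable_data : ∀ (v : VelocityL2 V) (F : ImageL2 Ω),
    IntegrableOn (fun t => M t (deformed v t F)) (Icc 0 1)
  integrable_pulledGradient : ∀ (v : VelocityL2 V) (F : ImageL2 Ω), ∀ t ∈ Icc (0 : ℝ) 1,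
    IntegrableOn (pulledGradient M v F t) (Icc t 1)

end Functional

end LDDMM

end

/-! Everything rests on uniform control of the flow. Admissibility makes `x ↦ v(r, x)` Lipschitz
with constant `C ‖v(r)‖_V`, which is square integrable in `r`. After extension of `v` by zero to all
times, a Picard iteration in an exponentially weighted sup norm yields global trajectories, and the
same weight yields a Grönwall inequality. Uniqueness gives the law `φ_{t,u} ∘ φ_{s,t} = φ_{s,u}`,
hence bijectivity, and points outside `Ω` stay fixed. Differentiability of `φ_{s,t}^v(x)` in `x` and
in `v` follows from one estimate, `norm_traj_add_sub_sub_le`. Its remainder contains the time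
integral of the modulus of continuity of `Dv(r)`, which is small uniformly in `x` because `Dv(r)` is
uniformly continuous. The variation of constants formula writes the derivative in `v` as an integral
over the time `q` at which the velocity is perturbed.

The deformed image is `φ_{0,t}.F = F ∘ φ_{t,0}`. Composition with the flow (`pull`) is bounded on
`L²(Ω)` by change of variables, depends continuously on the flow for each fixed image by density of
compactly supported continuous functions, and has adjoint `G ↦ |Dφ| (G ∘ φ)`.

The delicate point is Fréchet differentiability of `v ↦ F ∘ φ_{t,0}^v` into `L²(Ω)` when the
template is merely differentiable with square integrable gradient. Along a segment `v + e w` the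
pointwise chain rule holds. Testing with `h ∈ L²(Ω)`, Fubini's theorem and the fundamental theorem
of calculus in `e` express the increment weakly as an average of candidate derivatives
(`inner_pull_add_sub`). Testing with the remainder itself turns this into a norm bound, so
differentiability reduces to continuity of the candidate derivative in `v`, which follows from
continuity of `pull` applied to `∇f`.

The data term is differentiated under the time integral. The curve `t ↦ φ_{0,t}.f` is compact in
`L²(Ω)`, so the local integrable bounds on the gradients become a single one. The derivative in the
direction `w` is an integral over the triangle `q ≤ τ`. Exchanging the order and moving `pull` to
the other side by its adjoint leaves, for each `q`, a continuous linear functional of `w(q) ∈ V`.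
Its Riesz representative is `forcePotential`, and the reproducing property identifies it with the
kernel integral of the force field. The kinetic term equals the quadratic form `∫ (1 - t) ‖v(t)‖²
dt`. The optimality conditions are Fermat's rule in each variable, with density of the range of `ι`
removing the test images. -/

noncomputable section

namespace LDDMM

/-! ### Carathéodory differential equations: Grönwall, existence, uniqueness. -/

section Caratheodory

/-- The absolute values treat both time directions at once, as is needed for flows `φ_{s,t}` with `t
< s`. -/
lemma abs_integral_exp_abs_sub {c : ℝ} (hc : 0 < c) (s t : ℝ) :
    |∫ r in s..t, Real.exp (c * |r - s|)| = (Real.exp (c * |t - s|) - 1) / c := by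
  have key : ∀ T : ℝ, 0 ≤ T → ∫ r in (0 : ℝ)..T, Real.exp (c * |r|) = (Real.exp (c * T) - 1) / c := by
    intro T hT
    have : ∫ r in (0 : ℝ)..T, Real.exp (c * |r|) = ∫ r in (0 : ℝ)..T, Real.exp (c * r) := by
      refine intervalIntegral.integral_congr fun r hr => ?_
      rw [uIcc_of_le hT] at hr
      simp only [abs_of_nonneg hr.1]
    rw [this, intervalIntegral.integral_comp_mul_left (fun x => Real.exp x) hc.ne', integral_exp]
    simp [div_eq_inv_mul]
  rw [intervalIntegral.integral_comp_sub_right (fun r => Real.exp (c * |r|)) s, sub_self]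
  have hnn : ∀ T : ℝ, 0 ≤ T → 0 ≤ (Real.exp (c * T) - 1) / c := fun T hT =>
    div_nonneg (sub_nonneg.2 (Real.one_le_exp (by positivity))) hc.le
  rcases le_total 0 (t - s) with h | h
  · rw [key _ h, abs_of_nonneg (hnn _ h), abs_of_nonneg h]
  · have h2 : ∫ r in (0 : ℝ)..(t - s), Real.exp (c * |r|)
        = -∫ r in (0 : ℝ)..(-(t - s)), Real.exp (c * |r|) := by
      have := intervalIntegral.integral_comp_neg (a := 0) (b := -(t - s))
        (fun r => Real.exp (c * |r|))
      simp only [abs_neg, neg_neg, neg_zero] at this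
      rw [this, intervalIntegral.integral_symm]
    rw [h2, key _ (neg_nonneg.2 h), abs_neg, abs_of_nonneg (hnn _ (neg_nonneg.2 h)),
      abs_of_nonpos h]

/-- A nonnegative integrable function `l` with `2 ∫ l² ≤ lam`. -/
structure IsRate (l : ℝ → ℝ) (lam : ℝ) : Prop where
  nonneg : ∀ r, 0 ≤ l r
  integrable : Integrable l
  integrable_sq : Integrable fun r => l r ^ 2
  integral_sq_le : 2 * ∫ r, l r ^ 2 ≤ lam
  pos : 0 < lam

variable {l : ℝ → ℝ} {lam : ℝ}

lemma IsRate.intervalIntegrable_mul (h : IsRate l lam) {g : ℝ → ℝ} {s t : ℝ}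
    (hg : ContinuousOn g (uIcc s t)) : IntervalIntegrable (fun r => l r * g r) volume s t :=
  h.integrable.intervalIntegrable.mul_continuousOn hg

lemma abs_intervalIntegral_le_integral {g : ℝ → ℝ} (hg : Integrable g) (h0 : ∀ r, 0 ≤ g r)
    (s t : ℝ) : |∫ r in s..t, g r| ≤ ∫ r, g r := by
  rw [intervalIntegral.abs_integral_eq_abs_integral_uIoc,
    abs_of_nonneg (integral_nonneg fun r => h0 r)]
  exact setIntegral_le_integral hg (Eventually.of_forall h0)

/-- Young's inequality with weights `E / lam` and `lam / E`, where `E = exp (lam |t - s|)`: the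
condition `2 ∫ l² ≤ lam` bounds the first part by `E / 4`, and integrating the squared exponential
bounds the second by `E / 4`. The resulting factor `1 / 2` drives both Grönwall's inequality and the
Picard contraction. -/
lemma IsRate.abs_integral_mul_exp_le (h : IsRate l lam) (s t : ℝ) :
    |∫ r in s..t, l r * Real.exp (lam * |r - s|)| ≤ Real.exp (lam * |t - s|) / 2 := by
  have hlam := h.pos
  set E := Real.exp (lam * |t - s|) with hE
  have hEpos : 0 < E := Real.exp_pos _
  have hI1 : IntervalIntegrable (fun r => E / lam / 2 * l r ^ 2) volume s t :=
    (h.integrable_sq.intervalIntegrable).const_mul _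
  have hI2 : IntervalIntegrable (fun r => lam / E / 2 * Real.exp ((2 * lam) * |r - s|))
      volume s t := by
    apply Continuous.intervalIntegrable
    fun_prop
  have h1 : |∫ r in s..t, l r * Real.exp (lam * |r - s|)| ≤
      |∫ r in s..t, (E / lam / 2 * l r ^ 2 + lam / E / 2 * Real.exp ((2 * lam) * |r - s|))| := by
    rw [← Real.norm_eq_abs]
    refine intervalIntegral.norm_integral_le_abs_of_norm_le (Eventually.of_forall fun r => ?_)
      (hI1.add hI2)
    rw [Real.norm_eq_abs, abs_of_nonneg (mul_nonneg (h.nonneg r) (Real.exp_pos _).le)]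
    have : Real.exp ((2 * lam) * |r - s|) = Real.exp (lam * |r - s|) ^ 2 := by
      rw [← Real.exp_nat_mul]; congr 1; push_cast; ring
    rw [this]
    set e := Real.exp (lam * |r - s|)
    have h3 : E / lam / 2 * l r ^ 2 + lam / E / 2 * e ^ 2 - l r * e
        = (E * l r - lam * e) ^ 2 / (2 * lam * E) := by
      field_simp
      ring
    have : 0 ≤ (E * l r - lam * e) ^ 2 / (2 * lam * E) := by positivity
    linarith
  rw [intervalIntegral.integral_add hI1 hI2, intervalIntegral.integral_const_mul,
    intervalIntegral.integral_const_mul] at h1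
  have h2 := abs_add_le (E / lam / 2 * ∫ r in s..t, l r ^ 2)
    (lam / E / 2 * ∫ r in s..t, Real.exp ((2 * lam) * |r - s|))
  rw [abs_mul, abs_mul, abs_integral_exp_abs_sub (by positivity : 0 < 2 * lam),
    abs_of_pos (by positivity : 0 < E / lam / 2), abs_of_pos (by positivity : 0 < lam / E / 2)] at h2
  have h4 : E / lam / 2 * |∫ r in s..t, l r ^ 2| ≤ E / lam / 2 * (lam / 2) := by
    gcongr
    have := abs_intervalIntegral_le_integral h.integrable_sq (fun r => sq_nonneg (l r)) s t
    have := h.integral_sq_le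
    linarith
  have h5 : Real.exp (2 * lam * |t - s|) = E ^ 2 := by
    rw [hE, ← Real.exp_nat_mul]; congr 1; push_cast; ring
  rw [h5] at h2
  have h6 : lam / E / 2 * ((E ^ 2 - 1) / (2 * lam)) ≤ lam / E / 2 * (E ^ 2 / (2 * lam)) := by
    gcongr
    linarith
  have h7 : E / lam / 2 * (lam / 2) = E / 4 := by field_simp; norm_num
  have h8 : lam / E / 2 * (E ^ 2 / (2 * lam)) = E / 4 := by field_simp; norm_num
  linarith

/-- At the point where `exp (-lam |t - s|) u t` attains its maximum `m`, the integral inequality and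
the factor `1 / 2` of the weighted estimate give `m ≤ a + m / 2`. -/
lemma IsRate.gronwall (h : IsRate l lam) {u : ℝ → ℝ} {s T a : ℝ} (ha : 0 ≤ a)
    (hu : ContinuousOn u (uIcc s T)) (hu0 : ∀ t ∈ uIcc s T, 0 ≤ u t)
    (hle : ∀ t ∈ uIcc s T, u t ≤ a + |∫ r in s..t, l r * u r|) :
    u T ≤ 2 * a * Real.exp (lam * |T - s|) := by
  obtain ⟨tm, htm, hmax⟩ := isCompact_uIcc.exists_isMaxOn (s := uIcc s T) nonempty_uIcc
    (f := fun t => Real.exp (-(lam * |t - s|)) * u t) (by fun_prop)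
  set m := Real.exp (-(lam * |tm - s|)) * u tm with hm
  have hm0 : 0 ≤ m := mul_nonneg (Real.exp_pos _).le (hu0 _ htm)
  have hb : ∀ r ∈ uIcc s T, u r ≤ m * Real.exp (lam * |r - s|) := by
    intro r hr
    have h1 : Real.exp (-(lam * |r - s|)) * u r ≤ m := hmax hr
    calc u r = (Real.exp (-(lam * |r - s|)) * u r) * Real.exp (lam * |r - s|) := by
          rw [Real.exp_neg]; field_simp
      _ ≤ _ := by gcongr
  have hsub : uIcc s tm ⊆ uIcc s T := uIcc_subset_uIcc_left htm
  have h1 : |∫ r in s..tm, l r * u r| ≤ m * (Real.exp (lam * |tm - s|) / 2) := by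
    have h2 : |∫ r in s..tm, l r * u r| ≤
        |∫ r in s..tm, m * (l r * Real.exp (lam * |r - s|))| := by
      rw [← Real.norm_eq_abs]
      refine intervalIntegral.norm_integral_le_abs_of_norm_le
        ((ae_restrict_mem measurableSet_uIoc).mono fun r hr => ?_) ?_
      · have hr' := hsub (uIoc_subset_uIcc hr)
        rw [Real.norm_eq_abs, abs_of_nonneg (mul_nonneg (h.nonneg r) (hu0 r hr'))]
        calc l r * u r ≤ l r * (m * Real.exp (lam * |r - s|)) :=
              mul_le_mul_of_nonneg_left (hb r hr') (h.nonneg r)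
          _ = _ := by ring
      · exact (h.intervalIntegrable_mul (by fun_prop)).const_mul _
    rw [intervalIntegral.integral_const_mul, abs_mul, abs_of_nonneg hm0] at h2
    exact h2.trans (mul_le_mul_of_nonneg_left (h.abs_integral_mul_exp_le s tm) hm0)
  have h3 := hle tm htm
  have hexp : Real.exp (-(lam * |tm - s|)) * Real.exp (lam * |tm - s|) = 1 := by
    rw [← Real.exp_add]; simp
  have hle1 : Real.exp (-(lam * |tm - s|)) ≤ 1 := by
    apply Real.exp_le_one_iff.2
    have := h.pos
    have : 0 ≤ lam * |tm - s| := by positivity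
    linarith
  have h4 : m ≤ a + m / 2 := by
    calc m ≤ Real.exp (-(lam * |tm - s|)) * (a + m * (Real.exp (lam * |tm - s|) / 2)) := by
          rw [hm]
          exact mul_le_mul_of_nonneg_left (by linarith) (Real.exp_pos _).le
      _ = Real.exp (-(lam * |tm - s|)) * a
          + m * (Real.exp (-(lam * |tm - s|)) * Real.exp (lam * |tm - s|)) / 2 := by ring
      _ ≤ 1 * a + m / 2 := by rw [hexp, mul_one]; gcongr
      _ = _ := by ring
  calc u T ≤ m * Real.exp (lam * |T - s|) := hb T right_mem_uIcc
    _ ≤ _ := by gcongr; linarith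

variable {E : Type*} [NormedAddCommGroup E] [NormedSpace ℝ E]

/-- Grönwall's inequality for a curve whose velocity `d` is bounded by `l ‖ρ‖ + e`. -/
lemma IsRate.norm_le_of_velocity_le (h : IsRate l lam) {ρ d : ℝ → E} {e : ℝ → ℝ} {s T : ℝ}
    {ρ₀ : E} {ε : ℝ} (hρ : ContinuousOn ρ (uIcc s T))
    (heq : ∀ t ∈ uIcc s T, ρ t = ρ₀ + ∫ r in s..t, d r)
    (hd : ∀ᵐ r, r ∈ uIoc s T → ‖d r‖ ≤ l r * ‖ρ r‖ + e r)
    (he0 : ∀ r, 0 ≤ e r) (he : Integrable e) (hε : ∫ r, e r ≤ ε) :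
    ‖ρ T‖ ≤ 2 * (‖ρ₀‖ + ε) * Real.exp (lam * |T - s|) := by
  have hε0 : 0 ≤ ε := (integral_nonneg he0).trans hε
  refine h.gronwall (u := fun t => ‖ρ t‖) (by positivity) hρ.norm (fun t _ => norm_nonneg _) ?_
  intro t ht
  have hsub : uIcc s t ⊆ uIcc s T := uIcc_subset_uIcc_left ht
  have hI1 : IntervalIntegrable (fun r => l r * ‖ρ r‖) volume s t :=
    h.intervalIntegrable_mul (hρ.mono hsub).norm
  have h1 : ‖∫ r in s..t, d r‖ ≤ |∫ r in s..t, (l r * ‖ρ r‖ + e r)| := by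
    refine intervalIntegral.norm_integral_le_abs_of_norm_le ?_ (hI1.add he.intervalIntegrable)
    rw [ae_restrict_iff' measurableSet_uIoc]
    filter_upwards [hd] with r hr hrt
    exact hr (uIoc_subset_uIoc_of_uIcc_subset_uIcc hsub hrt)
  rw [intervalIntegral.integral_add hI1 he.intervalIntegrable] at h1
  have h2 := abs_add_le (∫ r in s..t, l r * ‖ρ r‖) (∫ r in s..t, e r)
  have h3 := abs_intervalIntegral_le_integral he he0 s t
  have h4 := norm_add_le ρ₀ (∫ r in s..t, d r)
  rw [← heq t ht] at h4
  linarith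

/-- A time-dependent vector field, Lipschitz in space with a square integrable constant. -/
structure IsCaratheodory (b : ℝ → E → E) (l : ℝ → ℝ) : Prop where
  meas : ∀ γ : ℝ → E, Continuous γ → AEStronglyMeasurable fun r => b r (γ r)
  lip : ∀ r x y, ‖b r x - b r y‖ ≤ l r * ‖x - y‖
  zero : ∀ r, ‖b r 0‖ ≤ l r

lemma IsCaratheodory.norm_le {b : ℝ → E → E} (hb : IsCaratheodory b l) (r : ℝ) (x : E) :
    ‖b r x‖ ≤ l r * (‖x‖ + 1) := by
  have h1 := hb.lip r x 0
  have h2 := hb.zero r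
  have h3 := norm_add_le (b r x - b r 0) (b r 0)
  rw [sub_add_cancel] at h3
  rw [sub_zero] at h1
  linarith

lemma IsCaratheodory.intervalIntegrable {b : ℝ → E → E} (hb : IsCaratheodory b l)
    (h : IsRate l lam) {γ : ℝ → E} (hγ : Continuous γ) (s t : ℝ) :
    IntervalIntegrable (fun r => b r (γ r)) volume s t := by
  refine (h.intervalIntegrable_mul (g := fun r => ‖γ r‖ + 1)
    (by fun_prop)).mono_fun (hb.meas γ hγ).restrict (Eventually.of_forall fun r => ?_)
  refine (hb.norm_le r (γ r)).trans (le_of_eq ?_)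
  exact (Real.norm_of_nonneg (mul_nonneg (h.nonneg r) (by positivity))).symm

/-- The integral equation of the ordinary differential equation `γ' = b(·, γ)`, `γ(s) = x`. -/
def IsSolution (b : ℝ → E → E) (s : ℝ) (x : E) (γ : ℝ → E) : Prop :=
  Continuous γ ∧ ∀ t, γ t = x + ∫ r in s..t, b r (γ r)

-- Curves are coded as `x + w η` with the weight `w t = exp (lam |t - s|)` and `η` bounded. In this
-- coding the Picard operator contracts by `1 / 2` on the whole line, so Banach's theorem gives a
-- global solution without gluing.
open BoundedContinuousFunction in
lemma IsCaratheodory.exists_isSolution [CompleteSpace E] {b : ℝ → E → E}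
    (hb : IsCaratheodory b l) (h : IsRate l lam) (s : ℝ) (x : E) :
    ∃ γ, IsSolution b s x γ := by
  have hlam := h.pos
  let w : ℝ → ℝ := fun t => Real.exp (lam * |t - s|)
  have hw : Continuous w := by fun_prop
  have hw0 : ∀ t, 0 < w t := fun t => Real.exp_pos _
  have hw1 : ∀ t, 1 ≤ w t := fun t => Real.one_le_exp (by positivity)
  let c : (ℝ →ᵇ E) → ℝ → E := fun η t => x + w t • η t
  have hc : ∀ η, Continuous (c η) := fun η => by
    have := η.continuous
    fun_prop
  let I : (ℝ →ᵇ E) → ℝ → E := fun η t => ∫ r in s..t, b r (c η r)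
  have hI : ∀ η, Continuous (I η) := fun η =>
    intervalIntegral.continuous_primitive (fun a b => hb.intervalIntegrable h (hc η) a b) s
  have hbound : ∀ η t, ‖(w t)⁻¹ • I η t‖ ≤ (‖x‖ + ‖η‖ + 1) / 2 := by
    intro η t
    have h1 : ‖I η t‖ ≤ |∫ r in s..t, (‖x‖ + ‖η‖ + 1) * (l r * w r)| := by
      refine intervalIntegral.norm_integral_le_abs_of_norm_le (Eventually.of_forall fun r => ?_)
        ((h.intervalIntegrable_mul (by fun_prop)).const_mul _)
      have h2 : ‖c η r‖ + 1 ≤ (‖x‖ + ‖η‖ + 1) * w r := by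
        have h3 := norm_add_le x (w r • η r)
        rw [norm_smul, Real.norm_eq_abs, abs_of_pos (hw0 r)] at h3
        have h4 : w r * ‖η r‖ ≤ w r * ‖η‖ :=
          mul_le_mul_of_nonneg_left (η.norm_coe_le_norm r) (hw0 r).le
        have h5 : ‖x‖ ≤ ‖x‖ * w r := le_mul_of_one_le_right (norm_nonneg _) (hw1 r)
        have := hw1 r
        change ‖x + w r • η r‖ + 1 ≤ _
        nlinarith
      calc ‖b r (c η r)‖ ≤ l r * (‖c η r‖ + 1) := hb.norm_le r _
        _ ≤ l r * ((‖x‖ + ‖η‖ + 1) * w r) := mul_le_mul_of_nonneg_left h2 (h.nonneg r)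
        _ = _ := by ring
    rw [intervalIntegral.integral_const_mul, abs_mul,
      abs_of_nonneg (by positivity : 0 ≤ ‖x‖ + ‖η‖ + 1)] at h1
    have h2 : |∫ r in s..t, l r * w r| ≤ w t / 2 := h.abs_integral_mul_exp_le s t
    rw [norm_smul, norm_inv, Real.norm_eq_abs, abs_of_pos (hw0 t), inv_mul_le_iff₀ (hw0 t)]
    calc ‖I η t‖ ≤ (‖x‖ + ‖η‖ + 1) * (w t / 2) := h1.trans (by gcongr)
      _ = _ := by ring
  have hcont : ∀ η, Continuous fun t => (w t)⁻¹ • I η t := fun η =>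
    (hw.inv₀ fun t => (hw0 t).ne').smul (hI η)
  let S : (ℝ →ᵇ E) → (ℝ →ᵇ E) := fun η =>
    ofNormedAddCommGroup (fun t => (w t)⁻¹ • I η t) (hcont η) _ (hbound η)
  have hS : ContractingWith (1 / 2 : NNReal) S := by
    refine ⟨by norm_num, LipschitzWith.of_dist_le_mul fun η η' => ?_⟩
    rw [dist_le (by positivity)]
    intro t
    change dist ((w t)⁻¹ • I η t) ((w t)⁻¹ • I η' t) ≤ _
    rw [dist_eq_norm, ← smul_sub, norm_smul, norm_inv, Real.norm_eq_abs, abs_of_pos (hw0 t),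
      inv_mul_le_iff₀ (hw0 t)]
    have h0 : I η t - I η' t = ∫ r in s..t, (b r (c η r) - b r (c η' r)) :=
      (intervalIntegral.integral_sub (hb.intervalIntegrable h (hc η) _ _)
        (hb.intervalIntegrable h (hc η') _ _)).symm
    have h1 : ‖I η t - I η' t‖ ≤ |∫ r in s..t, dist η η' * (l r * w r)| := by
      rw [h0]
      refine intervalIntegral.norm_integral_le_abs_of_norm_le (Eventually.of_forall fun r => ?_)
        ((h.intervalIntegrable_mul (by fun_prop)).const_mul _)
      have h3 : ‖c η r - c η' r‖ ≤ w r * dist η η' := by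
        have : c η r - c η' r = w r • (η r - η' r) := by simp only [c, smul_sub]; abel
        rw [this, norm_smul, Real.norm_eq_abs, abs_of_pos (hw0 r), ← dist_eq_norm]
        exact mul_le_mul_of_nonneg_left (dist_coe_le_dist r) (hw0 r).le
      calc _ ≤ l r * ‖c η r - c η' r‖ := hb.lip r _ _
        _ ≤ l r * (w r * dist η η') := mul_le_mul_of_nonneg_left h3 (h.nonneg r)
        _ = _ := by ring
    rw [intervalIntegral.integral_const_mul, abs_mul, abs_of_nonneg dist_nonneg] at h1
    have h2 : |∫ r in s..t, l r * w r| ≤ w t / 2 := h.abs_integral_mul_exp_le s t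
    calc _ ≤ dist η η' * (w t / 2) := h1.trans (by gcongr)
      _ = _ := by push_cast; ring
  set η := ContractingWith.fixedPoint S hS with hη
  have hfix : S η = η := hS.fixedPoint_isFixedPt
  refine ⟨c η, hc η, fun t => ?_⟩
  have h1 : (w t)⁻¹ • I η t = η t := by
    conv_rhs => rw [← hfix]
    rfl
  change x + w t • η t = x + I η t
  rw [← h1, smul_inv_smul₀ (hw0 t).ne']

/-- Grönwall's inequality with zero initial value and zero forcing. The local form on `uIcc s T` is
needed because a flow line is only known on `[0,1]`. -/
lemma IsCaratheodory.eqOn {b : ℝ → E → E} (hb : IsCaratheodory b l) (h : IsRate l lam)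
    {s T : ℝ} {x : E} {γ γ' : ℝ → E} (hγ : ContinuousOn γ (uIcc s T))
    (hγ' : ContinuousOn γ' (uIcc s T))
    (hi : IntervalIntegrable (fun r => b r (γ r)) volume s T)
    (hi' : IntervalIntegrable (fun r => b r (γ' r)) volume s T)
    (he : ∀ t ∈ uIcc s T, γ t = x + ∫ r in s..t, b r (γ r))
    (he' : ∀ t ∈ uIcc s T, γ' t = x + ∫ r in s..t, b r (γ' r)) : γ T = γ' T := by
  have := h.norm_le_of_velocity_le (ρ := fun t => γ t - γ' t) (ρ₀ := 0) (s := s) (T := T)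
    (d := fun r => b r (γ r) - b r (γ' r)) (e := fun _ => 0) (ε := 0) (hγ.sub hγ')
    (fun t ht => by
      have hsub : uIcc s t ⊆ uIcc s T := uIcc_subset_uIcc_left ht
      rw [intervalIntegral.integral_sub (hi.mono_set hsub) (hi'.mono_set hsub), he t ht, he' t ht]
      abel)
    (Eventually.of_forall fun r _ => by simpa using hb.lip r (γ r) (γ' r))
    (fun _ => le_rfl) (integrable_zero _ _ _) (by simp)
  simpa [sub_eq_zero] using this

lemma IsSolution.unique {b : ℝ → E → E} (hb : IsCaratheodory b l) (h : IsRate l lam) {s : ℝ}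
    {x : E} {γ γ' : ℝ → E} (hγ : IsSolution b s x γ) (hγ' : IsSolution b s x γ') : γ = γ' := by
  funext T
  exact hb.eqOn h hγ.1.continuousOn hγ'.1.continuousOn (hb.intervalIntegrable h hγ.1 _ _)
    (hb.intervalIntegrable h hγ'.1 _ _) (fun t _ => hγ.2 t) (fun t _ => hγ'.2 t)

end Caratheodory

/-! ### Interchange of integrals over a triangle. -/

section Triangle

variable {E : Type*} [NormedAddCommGroup E] [NormedSpace ℝ E]

lemma integral_integral_triangle_of_le {Z : ℝ → ℝ → E} {a b : ℝ} (hab : a ≤ b)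
    (hZ : IntegrableOn (Function.uncurry Z) (Ioc a b ×ˢ Ioc a b)) :
    ∫ p in a..b, ∫ q in a..p, Z p q = ∫ q in a..b, ∫ p in q..b, Z p q := by
  have hS : MeasurableSet {z : ℝ × ℝ | z.2 ≤ z.1} := measurableSet_le measurable_snd measurable_fst
  have hF : IntegrableOn (Function.uncurry fun p q => (Iic p).indicator (Z p) q)
      (uIoc a b ×ˢ uIoc a b) := by
    rw [uIoc_of_le hab]
    refine (hZ.indicator hS).congr (Eventually.of_forall fun z => ?_)
    rcases z with ⟨p, q⟩
    by_cases h : q ≤ p <;> simp [indicator, h]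
  have h1 : ∫ p in a..b, ∫ q in a..p, Z p q
      = ∫ p in a..b, ∫ q in a..b, (Iic p).indicator (Z p) q := by
    refine intervalIntegral.integral_congr_ae (Eventually.of_forall fun p hp => ?_)
    rw [uIoc_of_le hab] at hp
    rw [intervalIntegral.integral_of_le hp.1.le, intervalIntegral.integral_of_le hab,
      setIntegral_indicator measurableSet_Iic, Ioc_inter_Iic, min_eq_right hp.2]
  have h2 : ∫ q in a..b, ∫ p in q..b, Z p q
      = ∫ q in a..b, ∫ p in a..b, (Iic p).indicator (Z p) q := by
    refine intervalIntegral.integral_congr_ae (Eventually.of_forall fun q hq => ?_)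
    rw [uIoc_of_le hab] at hq
    have h3 : ∀ p, (Iic p).indicator (Z p) q = (Ici q).indicator (fun p => Z p q) p := by
      intro p
      by_cases h : q ≤ p <;> simp [indicator, h]
    simp_rw [h3]
    rw [intervalIntegral.integral_of_le hq.2, intervalIntegral.integral_of_le hab,
      setIntegral_indicator measurableSet_Ici]
    have h4 : Ioc a b ∩ Ici q = Icc q b := by
      ext p
      constructor
      · rintro ⟨h, h'⟩
        exact ⟨h', h.2⟩
      · rintro ⟨h, h'⟩
        exact ⟨⟨hq.1.trans_le h, h'⟩, h⟩
    rw [h4, integral_Icc_eq_integral_Ioc]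
  rw [h1, h2, intervalIntegral_intervalIntegral_swap hF]

lemma integral_integral_triangle {Z : ℝ → ℝ → E} {s t : ℝ}
    (hZ : IntegrableOn (Function.uncurry Z) (uIoc s t ×ˢ uIoc s t)) :
    ∫ p in s..t, ∫ q in s..p, Z p q = ∫ q in s..t, ∫ p in q..t, Z p q := by
  rcases le_total s t with h | h
  · rw [uIoc_of_le h] at hZ
    exact integral_integral_triangle_of_le h hZ
  · rw [uIoc_of_ge h] at hZ
    have hZ' : IntegrableOn (Function.uncurry fun x y => Z y x) (Ioc t s ×ˢ Ioc t s) := by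
      have : (volume : Measure (ℝ × ℝ)).restrict (Ioc t s ×ˢ Ioc t s)
          = (volume.restrict (Ioc t s)).prod (volume.restrict (Ioc t s)) := by
        rw [Measure.prod_restrict]; rfl
      unfold IntegrableOn at hZ ⊢
      rw [this] at hZ ⊢
      exact hZ.swap
    have key := integral_integral_triangle_of_le h hZ'
    rw [intervalIntegral.integral_symm t s, intervalIntegral.integral_symm t s, neg_inj]
    have h1 : ∀ p, ∫ q in s..p, Z p q = -∫ q in p..s, Z p q := fun p =>
      intervalIntegral.integral_symm p s
    have h2 : ∀ q, ∫ p in q..t, Z p q = -∫ p in t..q, Z p q := fun q =>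
      intervalIntegral.integral_symm t q
    simp_rw [h1, h2, intervalIntegral.integral_neg]
    rw [key]

end Triangle

/-! ### Admissible fields and the modulus of continuity of their derivatives. -/

section Field

variable {n : ℕ} {Ω : Set (Space n)} {V : Type*} [NormedAddCommGroup V] [InnerProductSpace ℝ V]
  [RKHS ℝ V (Space n) (Space n)] {C : ℝ}

/-- The consequences of admissibility used for flows, with an explicit embedding constant. -/
structure IsAdmissibleWith (Ω : Set (Space n)) (V : Type*) [NormedAddCommGroup V]
    [InnerProductSpace ℝ V] [RKHS ℝ V (Space n) (Space n)] (C : ℝ) : Prop where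
  pos : 0 < C
  contDiff : ∀ u : V, ContDiff ℝ 1 (⇑u)
  uniformContinuous : ∀ u : V, UniformContinuous (fderiv ℝ (⇑u))
  eq_zero : ∀ (u : V) (x), x ∉ Ω → u x = 0
  norm_le : ∀ (u : V) (x : Space n), ‖u x‖ ≤ C * ‖u‖
  norm_fderiv_le : ∀ (u : V) (x : Space n), ‖fderiv ℝ (⇑u) x‖ ≤ C * ‖u‖

lemma IsAdmissible.exists_with (h : IsAdmissible Ω V) : ∃ C, IsAdmissibleWith Ω V C := by
  obtain ⟨C, hC⟩ := h.norm_le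
  -- Raising the constant to at least `1` makes it positive.
  have hb : ∀ (u : V) (x y : Space n), ‖u x‖ + ‖fderiv ℝ (⇑u) y‖ ≤ max C 1 * ‖u‖ := fun u x y =>
    (hC u x y).trans (mul_le_mul_of_nonneg_right (le_max_left _ _) (norm_nonneg _))
  refine ⟨max C 1, lt_of_lt_of_le one_pos (le_max_right _ _), fun u => (h.isC10 u).contDiff,
    fun u => ?_, fun u => (h.isC10 u).eq_zero, fun u x => ?_, fun u x => ?_⟩
  · exact ((h.isC10 u).contDiff.continuous_fderiv one_ne_zero).uniformContinuous_of_tendsto_cocompact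
      (h.isC10 u).tendsto_fderiv_zero
  · exact (le_add_of_nonneg_right (norm_nonneg _)).trans (hb u x x)
  · exact (le_add_of_nonneg_left (norm_nonneg _)).trans (hb u x x)

variable (hV : IsAdmissibleWith Ω V C)

namespace IsAdmissibleWith

include hV

lemma differentiable (u : V) : Differentiable ℝ (⇑u) := (hV.contDiff u).differentiable one_ne_zero

lemma hasFDerivAt (u : V) (x : Space n) : HasFDerivAt (⇑u) (fderiv ℝ (⇑u) x) x :=
  (hV.differentiable u x).hasFDerivAt

lemma fderiv_sub (u w : V) (x : Space n) :
    fderiv ℝ (⇑(u - w)) x = fderiv ℝ (⇑u) x - fderiv ℝ (⇑w) x := by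
  rw [RKHS.coe_sub]
  exact ((hV.hasFDerivAt u x).sub (hV.hasFDerivAt w x)).fderiv

lemma lipschitz (u : V) (x y : Space n) : ‖u x - u y‖ ≤ C * ‖u‖ * ‖x - y‖ :=
  convex_univ.norm_image_sub_le_of_norm_hasFDerivWithin_le
    (fun z _ => (hV.hasFDerivAt u z).hasFDerivWithinAt) (fun z _ => hV.norm_fderiv_le u z)
    (mem_univ _) (mem_univ _)

lemma continuous_eval : Continuous fun p : V × Space n => p.1 p.2 := by
  rw [continuous_iff_continuousAt]
  rintro ⟨u, x⟩
  rw [ContinuousAt, tendsto_iff_norm_sub_tendsto_zero]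
  have h1 : Tendsto (fun p : V × Space n => C * ‖p.1 - u‖ + ‖u p.2 - u x‖) (𝓝 (u, x)) (𝓝 0) := by
    have hu := (hV.contDiff u).continuous
    have : Continuous fun p : V × Space n => C * ‖p.1 - u‖ + ‖u p.2 - u x‖ := by fun_prop
    simpa using this.tendsto (u, x)
  refine squeeze_zero (fun _ => norm_nonneg _) (fun p => ?_) h1
  calc ‖p.1 p.2 - u x‖ = ‖(p.1 - u) p.2 + (u p.2 - u x)‖ := by simp
    _ ≤ _ := (norm_add_le _ _).trans (add_le_add_left (hV.norm_le _ _) _)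

lemma continuous_fderiv_eval : Continuous fun p : V × Space n => fderiv ℝ (⇑p.1) p.2 := by
  rw [continuous_iff_continuousAt]
  rintro ⟨u, x⟩
  rw [ContinuousAt, tendsto_iff_norm_sub_tendsto_zero]
  have h1 : Tendsto (fun p : V × Space n => C * ‖p.1 - u‖ + ‖fderiv ℝ (⇑u) p.2 - fderiv ℝ (⇑u) x‖)
      (𝓝 (u, x)) (𝓝 0) := by
    have hu := (hV.uniformContinuous u).continuous
    have : Continuous fun p : V × Space n =>
      C * ‖p.1 - u‖ + ‖fderiv ℝ (⇑u) p.2 - fderiv ℝ (⇑u) x‖ := by fun_prop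
    simpa using this.tendsto (u, x)
  refine squeeze_zero (fun _ => norm_nonneg _) (fun p => ?_) h1
  calc ‖fderiv ℝ (⇑p.1) p.2 - fderiv ℝ (⇑u) x‖
      = ‖fderiv ℝ (⇑(p.1 - u)) p.2 + (fderiv ℝ (⇑u) p.2 - fderiv ℝ (⇑u) x)‖ := by
        rw [hV.fderiv_sub]; simp
    _ ≤ _ := (norm_add_le _ _).trans (add_le_add_left (hV.norm_fderiv_le _ _) _)

end IsAdmissibleWith

/-- The modulus of continuity of the derivative of `u`. -/
def modulus (u : V) (δ : ℝ) : ℝ :=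
  ⨆ p : {p : Space n × Space n // ‖p.1 - p.2‖ ≤ δ},
    ‖fderiv ℝ (⇑u) p.1.1 - fderiv ℝ (⇑u) p.1.2‖

lemma modulus_nonneg (u : V) (δ : ℝ) : 0 ≤ modulus u δ :=
  Real.iSup_nonneg fun _ => norm_nonneg _

namespace IsAdmissibleWith

include hV

lemma norm_fderiv_sub_le (u : V) (x y : Space n) :
    ‖fderiv ℝ (⇑u) x - fderiv ℝ (⇑u) y‖ ≤ 2 * C * ‖u‖ := by
  have h1 := hV.norm_fderiv_le u x
  have h2 := hV.norm_fderiv_le u y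
  have := norm_sub_le (fderiv ℝ (⇑u) x) (fderiv ℝ (⇑u) y)
  linarith

lemma modulus_le (u : V) (δ : ℝ) : modulus u δ ≤ 2 * C * ‖u‖ := by
  have := hV.pos
  exact Real.iSup_le (fun p => hV.norm_fderiv_sub_le u _ _) (by positivity)

lemma le_modulus (u : V) {δ : ℝ} {x y : Space n} (h : ‖x - y‖ ≤ δ) :
    ‖fderiv ℝ (⇑u) x - fderiv ℝ (⇑u) y‖ ≤ modulus u δ :=
  le_ciSup (f := fun p : {p : Space n × Space n // ‖p.1 - p.2‖ ≤ δ} =>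
    ‖fderiv ℝ (⇑u) p.1.1 - fderiv ℝ (⇑u) p.1.2‖)
    ⟨2 * C * ‖u‖, by rintro _ ⟨p, rfl⟩; exact hV.norm_fderiv_sub_le u _ _⟩ ⟨(x, y), h⟩

lemma modulus_le_add (u w : V) (δ : ℝ) : modulus u δ ≤ modulus w δ + 2 * C * ‖u - w‖ := by
  have := hV.pos
  refine Real.iSup_le (fun p => ?_) (add_nonneg (modulus_nonneg w δ) (by positivity))
  have h1 := hV.norm_fderiv_sub_le (u - w) p.1.1 p.1.2
  have h2 := hV.le_modulus w p.2
  rw [hV.fderiv_sub, hV.fderiv_sub] at h1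
  have h3 := norm_add_le
    (fderiv ℝ (⇑u) p.1.1 - fderiv ℝ (⇑w) p.1.1 - (fderiv ℝ (⇑u) p.1.2 - fderiv ℝ (⇑w) p.1.2))
    (fderiv ℝ (⇑w) p.1.1 - fderiv ℝ (⇑w) p.1.2)
  have h4 : fderiv ℝ (⇑u) p.1.1 - fderiv ℝ (⇑w) p.1.1
      - (fderiv ℝ (⇑u) p.1.2 - fderiv ℝ (⇑w) p.1.2)
      + (fderiv ℝ (⇑w) p.1.1 - fderiv ℝ (⇑w) p.1.2)
      = fderiv ℝ (⇑u) p.1.1 - fderiv ℝ (⇑u) p.1.2 := by abel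
  rw [h4] at h3
  linarith

/-- The modulus is Lipschitz in the field with constant `2 C`. Continuity makes `r ↦ modulus (v r)
δ` measurable, so that it can be integrated in time. -/
lemma continuous_modulus (δ : ℝ) : Continuous fun u : V => modulus u δ := by
  refine continuous_iff_continuousAt.2 fun u => ?_
  rw [ContinuousAt, tendsto_iff_norm_sub_tendsto_zero]
  have h1 : Tendsto (fun w : V => 2 * C * ‖w - u‖) (𝓝 u) (𝓝 0) := by
    have : Continuous fun w : V => 2 * C * ‖w - u‖ := by fun_prop
    simpa using this.tendsto u
  refine squeeze_zero (fun _ => norm_nonneg _) (fun w => ?_) h1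
  rw [Real.norm_eq_abs, abs_le]
  have h2 := hV.modulus_le_add u w δ
  have h3 := hV.modulus_le_add w u δ
  rw [norm_sub_rev] at h2
  constructor <;> linarith

lemma tendsto_modulus (u : V) : Tendsto (modulus u) (𝓝 0) (𝓝 0) := by
  rw [Metric.tendsto_nhds_nhds]
  intro ε hε
  obtain ⟨δ, hδ, h⟩ := Metric.uniformContinuous_iff.1 (hV.uniformContinuous u) (ε / 2) (half_pos hε)
  refine ⟨δ, hδ, fun {d} hd => ?_⟩
  rw [Real.dist_eq, sub_zero] at hd ⊢
  rw [abs_of_nonneg (modulus_nonneg u d)]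
  refine lt_of_le_of_lt (Real.iSup_le (fun p => ?_) (half_pos hε).le) (half_lt_self hε)
  rw [← dist_eq_norm]
  exact (h (by rw [dist_eq_norm]; exact p.2.trans_lt ((le_abs_self d).trans_lt hd))).le

/-- Mean value inequality on the closed ball of radius `δ`. The bound depends on `x` and `y` only
through `‖y - x‖`, which keeps all later remainders uniform in space. -/
lemma norm_sub_sub_fderiv_le (u : V) {δ : ℝ} {x y : Space n} (h : ‖y - x‖ ≤ δ) :
    ‖u y - u x - fderiv ℝ (⇑u) x (y - x)‖ ≤ modulus u δ * ‖y - x‖ := by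
  refine (convex_closedBall x δ).norm_image_sub_le_of_norm_hasFDerivWithin_le'
    (fun z _ => (hV.hasFDerivAt u z).hasFDerivWithinAt) (fun z hz => ?_)
    (Metric.mem_closedBall_self ((norm_nonneg _).trans h)) (by simpa [dist_eq_norm] using h)
  exact hV.le_modulus u (by simpa [dist_eq_norm] using hz)

end IsAdmissibleWith

end Field

/-! ### Velocity fields extended by zero to all times. -/

section Velocity

variable {V : Type*} [NormedAddCommGroup V]

/-- A velocity field on `[0,1]`, extended by zero to all times. -/
def extend (v : VelocityL2 V) (r : ℝ) : V := (Icc (0 : ℝ) 1).indicator v r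

lemma extend_of_mem (v : VelocityL2 V) {r : ℝ} (hr : r ∈ Icc (0 : ℝ) 1) : extend v r = v r :=
  indicator_of_mem hr _

lemma stronglyMeasurable_extend (v : VelocityL2 V) : StronglyMeasurable (extend v) :=
  (Lp.stronglyMeasurable v).indicator measurableSet_Icc

lemma memLp_extend (v : VelocityL2 V) : MemLp (extend v) 2 :=
  (memLp_indicator_iff_restrict measurableSet_Icc).2 (Lp.memLp v)

lemma extend_ae_eq {v : VelocityL2 V} {w : ℝ → V}
    (h : ∀ᵐ r ∂(volume.restrict (Icc (0 : ℝ) 1)), v r = w r) :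
    ∀ᵐ r, extend v r = (Icc (0 : ℝ) 1).indicator w r := by
  rw [ae_restrict_iff' measurableSet_Icc] at h
  filter_upwards [h] with r hr
  by_cases hm : r ∈ Icc (0 : ℝ) 1
  · simp [extend, hm, hr hm]
  · simp [extend, hm]

lemma extend_add (v w : VelocityL2 V) : ∀ᵐ r, extend (v + w) r = extend v r + extend w r := by
  filter_upwards [extend_ae_eq (Lp.coeFn_add v w)] with r hr
  rw [hr, indicator_add']
  rfl

lemma extend_sub (v w : VelocityL2 V) : ∀ᵐ r, extend (v - w) r = extend v r - extend w r := by
  filter_upwards [extend_ae_eq (Lp.coeFn_sub v w)] with r hr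
  rw [hr, indicator_sub']
  rfl

lemma extend_smul [NormedSpace ℝ V] (c : ℝ) (v : VelocityL2 V) :
    ∀ᵐ r, extend (c • v) r = c • extend v r := by
  filter_upwards [extend_ae_eq (Lp.coeFn_smul c v)] with r hr
  rw [hr, extend, ← indicator_const_smul_apply]
  rfl

lemma integrable_extend_sq (v : VelocityL2 V) : Integrable fun r => ‖extend v r‖ ^ 2 :=
  (memLp_extend v).integrable_norm_pow two_ne_zero

lemma integral_extend_sq (v : VelocityL2 V) : ∫ r, ‖extend v r‖ ^ 2 = ‖v‖ ^ 2 := by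
  have h1 : ‖v‖ = (eLpNorm (extend v) 2 volume).toReal := by
    rw [Lp.norm_def]
    congr 1
    exact (eLpNorm_indicator_eq_eLpNorm_restrict measurableSet_Icc).symm
  rw [h1, (memLp_extend v).eLpNorm_eq_integral_rpow_norm two_ne_zero ENNReal.ofNat_ne_top,
    ENNReal.toReal_ofReal (by positivity)]
  simp only [ENNReal.toReal_ofNat, Real.rpow_ofNat]
  rw [← Real.rpow_natCast, ← Real.rpow_mul (integral_nonneg fun r => by positivity)]
  norm_num

lemma integrable_extend (v : VelocityL2 V) : Integrable (extend v) := by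
  refine (integrable_indicator_iff measurableSet_Icc).2 ?_
  exact (Lp.memLp v).integrable one_le_two

lemma integrable_norm_extend (v : VelocityL2 V) : Integrable fun r => ‖extend v r‖ :=
  (integrable_extend v).norm

/-- Cauchy–Schwarz on an interval of length one, obtained from `a ≤ (a² / c + c) / 2` with `c =
‖v‖`, or with `c` arbitrarily small when `‖v‖ = 0`. -/
lemma integral_norm_extend_le (v : VelocityL2 V) : ∫ r, ‖extend v r‖ ≤ ‖v‖ := by
  have h0 : ∀ c : ℝ, 0 < c → ∫ r, ‖extend v r‖ ≤ (c⁻¹ * ‖v‖ ^ 2 + c) / 2 := by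
    intro c hc
    have h1 : ∫ r, ‖extend v r‖ ≤
        ∫ r, ((c⁻¹ / 2) * ‖extend v r‖ ^ 2 + (Icc (0 : ℝ) 1).indicator (fun _ => c / 2) r) := by
      have hi : Integrable ((Icc (0 : ℝ) 1).indicator fun _ => c / 2) :=
        (integrable_indicator_iff measurableSet_Icc).2 (integrable_const _)
      refine integral_mono (integrable_norm_extend v)
        (((integrable_extend_sq v).const_mul _).add hi) fun r => ?_
      by_cases hr : r ∈ Icc (0 : ℝ) 1
      · simp only [indicator_of_mem hr]
        have : c⁻¹ / 2 * ‖extend v r‖ ^ 2 + c / 2 - ‖extend v r‖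
            = (‖extend v r‖ - c) ^ 2 / (2 * c) := by field_simp; ring
        have : 0 ≤ (‖extend v r‖ - c) ^ 2 / (2 * c) := by positivity
        linarith
      · simp [extend, hr]
    rw [integral_add ((integrable_extend_sq v).const_mul _)
      ((integrable_indicator_iff measurableSet_Icc).2 (integrable_const _)), integral_const_mul,
      integral_extend_sq, integral_indicator measurableSet_Icc] at h1
    simp at h1
    linarith
  rcases (norm_nonneg v).eq_or_lt with h | h
  · refine le_of_forall_pos_le_add fun ε hε => ?_
    have := h0 ε hε
    rw [← h] at this ⊢
    simp at this
    linarith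
  · have := h0 _ h
    field_simp at this
    linarith

end Velocity

/-! ### Trajectories, the linearised equation and their stability. -/

section Flow

variable {n : ℕ} {Ω : Set (Space n)} {V : Type*} [NormedAddCommGroup V] [InnerProductSpace ℝ V]
  [RKHS ℝ V (Space n) (Space n)] {C : ℝ}

/-- The exponential rate in the Grönwall estimates for the flow of `v`. -/
def growth (C : ℝ) (v : VelocityL2 V) : ℝ := 2 * (C ^ 2 * ‖v‖ ^ 2) + 1

/-- The constant in the Grönwall estimates for the flow of `v` on `[0,1]`. -/
def stab (C : ℝ) (v : VelocityL2 V) : ℝ := 2 * Real.exp (growth C v)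

lemma stab_pos (C : ℝ) (v : VelocityL2 V) : 0 < stab C v := by unfold stab; positivity

lemma continuous_stab (C : ℝ) : Continuous (stab C : VelocityL2 V → ℝ) := by
  unfold stab growth; fun_prop

/-- The trajectory of `v` (extended by zero to all times) which is in `x` at time `s`. -/
def traj (v : VelocityL2 V) (s : ℝ) (x : Space n) : ℝ → Space n :=
  Classical.epsilon (IsSolution (fun r x => (extend v r : V) x) s x)

/-- The right-hand side of the linearised equation along a trajectory. -/
def linField (v : VelocityL2 V) (s : ℝ) (x : Space n) (r : ℝ) (A : Space n →L[ℝ] Space n) :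
    Space n →L[ℝ] Space n :=
  (fderiv ℝ (⇑(extend v r : V)) (traj v s x r)).comp A

/-- The solution of the linearised equation along a trajectory. -/
def lin (v : VelocityL2 V) (s : ℝ) (x : Space n) : ℝ → (Space n →L[ℝ] Space n) :=
  Classical.epsilon (IsSolution (linField v s x) s (ContinuousLinearMap.id ℝ (Space n)))

/-- The integrated modulus of continuity of `Dv`. -/
def totalModulus (v : VelocityL2 V) (δ : ℝ) : ℝ := ∫ r, modulus (extend v r : V) δ

lemma totalModulus_nonneg (v : VelocityL2 V) (δ : ℝ) : 0 ≤ totalModulus v δ :=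
  integral_nonneg fun _ => modulus_nonneg _ _

variable (hV : IsAdmissibleWith Ω V C)

namespace IsAdmissibleWith

include hV

lemma isRate (v : VelocityL2 V) : IsRate (fun r => C * ‖extend v r‖) (growth C v) where
  nonneg r := mul_nonneg hV.pos.le (norm_nonneg _)
  integrable := (integrable_norm_extend v).const_mul C
  integrable_sq := by simpa only [mul_pow] using (integrable_extend_sq v).const_mul (C ^ 2)
  integral_sq_le := by
    simp only [mul_pow]
    rw [integral_const_mul, integral_extend_sq, growth]
    linarith
  pos := by unfold growth; positivity

lemma aestronglyMeasurable_eval (v : VelocityL2 V) {γ : ℝ → Space n} (hγ : Continuous γ) :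
    StronglyMeasurable fun r => (extend v r : V) (γ r) :=
  hV.continuous_eval.comp_stronglyMeasurable
    ((stronglyMeasurable_extend v).prodMk hγ.stronglyMeasurable)

lemma aestronglyMeasurable_fderiv (v : VelocityL2 V) {γ : ℝ → Space n} (hγ : Continuous γ) :
    StronglyMeasurable fun r => fderiv ℝ (⇑(extend v r : V)) (γ r) :=
  hV.continuous_fderiv_eval.comp_stronglyMeasurable
    ((stronglyMeasurable_extend v).prodMk hγ.stronglyMeasurable)

lemma isCaratheodory (v : VelocityL2 V) :
    IsCaratheodory (fun r x => (extend v r : V) x) (fun r => C * ‖extend v r‖) where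
  meas _ hγ := (hV.aestronglyMeasurable_eval v hγ).aestronglyMeasurable
  lip _ x y := hV.lipschitz _ x y
  zero _ := hV.norm_le _ _

lemma isSolution_traj (v : VelocityL2 V) (s : ℝ) (x : Space n) :
    IsSolution (fun r x => (extend v r : V) x) s x (traj v s x) :=
  Classical.epsilon_spec ((hV.isCaratheodory v).exists_isSolution (hV.isRate v) s x)

lemma continuous_traj (v : VelocityL2 V) (s : ℝ) (x : Space n) : Continuous (traj v s x) :=
  (hV.isSolution_traj v s x).1

lemma traj_eq (v : VelocityL2 V) (s : ℝ) (x : Space n) (t : ℝ) :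
    traj v s x t = x + ∫ r in s..t, (extend v r : V) (traj v s x r) :=
  (hV.isSolution_traj v s x).2 t

lemma intervalIntegrable_eval (v : VelocityL2 V) {γ : ℝ → Space n} (hγ : Continuous γ) (s t : ℝ) :
    IntervalIntegrable (fun r => (extend v r : V) (γ r)) volume s t :=
  (hV.isCaratheodory v).intervalIntegrable (hV.isRate v) hγ s t

lemma isCaratheodory_linField (v : VelocityL2 V) (s : ℝ) (x : Space n) :
    IsCaratheodory (linField v s x) (fun r => C * ‖extend v r‖) where
  meas γ hγ := by
    have h1 : Continuous fun p : (Space n →L[ℝ] Space n) × (Space n →L[ℝ] Space n) =>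
      p.1.comp p.2 := by fun_prop
    exact (h1.comp_stronglyMeasurable ((hV.aestronglyMeasurable_fderiv v
      (hV.continuous_traj v s x)).prodMk hγ.stronglyMeasurable)).aestronglyMeasurable
  lip r A B := by
    rw [linField, linField, ← ContinuousLinearMap.comp_sub]
    exact (ContinuousLinearMap.opNorm_comp_le _ _).trans
      (mul_le_mul_of_nonneg_right (hV.norm_fderiv_le _ _) (norm_nonneg _))
  zero r := by
    have := hV.pos
    rw [linField, ContinuousLinearMap.comp_zero, norm_zero]
    positivity

lemma isSolution_lin (v : VelocityL2 V) (s : ℝ) (x : Space n) :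
    IsSolution (linField v s x) s (ContinuousLinearMap.id ℝ (Space n)) (lin v s x) :=
  Classical.epsilon_spec ((hV.isCaratheodory_linField v s x).exists_isSolution (hV.isRate v) s _)

lemma continuous_lin (v : VelocityL2 V) (s : ℝ) (x : Space n) : Continuous (lin v s x) :=
  (hV.isSolution_lin v s x).1

lemma lin_eq (v : VelocityL2 V) (s : ℝ) (x : Space n) (t : ℝ) :
    lin v s x t = ContinuousLinearMap.id ℝ (Space n) + ∫ r in s..t,
      (fderiv ℝ (⇑(extend v r : V)) (traj v s x r)).comp (lin v s x r) :=
  (hV.isSolution_lin v s x).2 t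

lemma traj_self (v : VelocityL2 V) (s : ℝ) (x : Space n) : traj v s x s = x := by
  rw [hV.traj_eq]; simp

/-- The same curve solves the equation started at any of its points, so uniqueness applies. This is
the source of the group law. -/
lemma traj_traj (v : VelocityL2 V) (s t : ℝ) (x : Space n) :
    traj v t (traj v s x t) = traj v s x := by
  refine (hV.isSolution_traj v t _).unique (hV.isCaratheodory v) (hV.isRate v)
    ⟨hV.continuous_traj v s x, fun u => ?_⟩
  rw [hV.traj_eq v s x u, hV.traj_eq v s x t, add_assoc,
    intervalIntegral.integral_add_adjacent_intervals]
  · exact hV.intervalIntegrable_eval v (hV.continuous_traj v s x) _ _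
  · exact hV.intervalIntegrable_eval v (hV.continuous_traj v s x) _ _

lemma growth_exp_le (v : VelocityL2 V) {a s T : ℝ} (ha : 0 ≤ a) (h : |T - s| ≤ 1) :
    2 * a * Real.exp (growth C v * |T - s|) ≤ stab C v * a := by
  have : 0 < growth C v := (hV.isRate v).pos
  have h2 : Real.exp (growth C v * |T - s|) ≤ Real.exp (growth C v) :=
    Real.exp_le_exp.2 (by nlinarith)
  calc 2 * a * Real.exp (growth C v * |T - s|) ≤ 2 * a * Real.exp (growth C v) := by gcongr
    _ = _ := by unfold stab; ring

/-- Grönwall's inequality with the rate of the velocity field `v`. -/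
lemma norm_le_of_velocity_le {E : Type*} [NormedAddCommGroup E] [NormedSpace ℝ E]
    (v : VelocityL2 V) {ρ d : ℝ → E} {e : ℝ → ℝ} {s T : ℝ} {ρ₀ : E} {ε : ℝ}
    (hsT : |T - s| ≤ 1) (hρ : ContinuousOn ρ (uIcc s T))
    (heq : ∀ t ∈ uIcc s T, ρ t = ρ₀ + ∫ r in s..t, d r)
    (hd : ∀ᵐ r, r ∈ uIoc s T → ‖d r‖ ≤ C * ‖extend v r‖ * ‖ρ r‖ + e r)
    (he0 : ∀ r, 0 ≤ e r) (he : Integrable e) (hε : ∫ r, e r ≤ ε) :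
    ‖ρ T‖ ≤ stab C v * (‖ρ₀‖ + ε) := by
  have hε0 : 0 ≤ ε := (integral_nonneg he0).trans hε
  exact ((hV.isRate v).norm_le_of_velocity_le hρ heq hd he0 he hε).trans
    (hV.growth_exp_le v (by positivity) hsT)

/-- Lipschitz dependence of trajectories on the initial value and the velocity field. -/
lemma norm_traj_sub_le (v v' : VelocityL2 V) (x x' : Space n) {s t : ℝ} (hst : |t - s| ≤ 1) :
    ‖traj v' s x' t - traj v s x t‖ ≤ stab C v * (‖x' - x‖ + C * ‖v' - v‖) := by
  refine hV.norm_le_of_velocity_le v (ρ := fun t => traj v' s x' t - traj v s x t)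
    (d := fun r => (extend v' r : V) (traj v' s x' r) - (extend v r : V) (traj v s x r))
    (e := fun r => C * ‖extend (v' - v) r‖) hst
    ((hV.continuous_traj v' s x').sub (hV.continuous_traj v s x)).continuousOn ?_ ?_
    (fun r => mul_nonneg hV.pos.le (norm_nonneg _)) ((integrable_norm_extend _).const_mul C) ?_
  · intro t _
    rw [intervalIntegral.integral_sub
      (hV.intervalIntegrable_eval v' (hV.continuous_traj v' s x') _ _)
      (hV.intervalIntegrable_eval v (hV.continuous_traj v s x) _ _), hV.traj_eq v' s x' t,
      hV.traj_eq v s x t]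
    abel
  · filter_upwards [extend_sub v' v] with r hr _
    rw [hr]
    have h1 := hV.lipschitz (extend v r) (traj v' s x' r) (traj v s x r)
    have h2 := hV.norm_le (extend v' r - extend v r) (traj v' s x' r)
    have h3 := norm_add_le ((extend v r : V) (traj v' s x' r) - (extend v r : V) (traj v s x r))
      ((extend v' r - extend v r : V) (traj v' s x' r))
    have h4 : ((extend v r : V) (traj v' s x' r) - (extend v r : V) (traj v s x r))
      + ((extend v' r - extend v r : V) (traj v' s x' r))
      = (extend v' r : V) (traj v' s x' r) - (extend v r : V) (traj v s x r) := by
        rw [RKHS.coe_sub, Pi.sub_apply]; abel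
    rw [h4] at h3
    linarith
  · rw [integral_const_mul]
    exact mul_le_mul_of_nonneg_left (integral_norm_extend_le _) hV.pos.le

lemma norm_lin_le (v : VelocityL2 V) (x : Space n) {s t : ℝ} (hst : |t - s| ≤ 1) :
    ‖lin v s x t‖ ≤ stab C v := by
  have h := hV.norm_le_of_velocity_le v (ρ := lin v s x)
    (d := fun r => linField v s x r (lin v s x r)) (e := fun _ => 0) (ε := 0) hst
    (hV.continuous_lin v s x).continuousOn (fun t _ => (hV.isSolution_lin v s x).2 t)
    (Eventually.of_forall fun r _ => ?_) (fun _ => le_rfl) (integrable_zero _ _ _) (by simp)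
  · refine h.trans (mul_le_of_le_one_right (stab_pos C v).le ?_)
    rw [add_zero]
    exact ContinuousLinearMap.norm_id_le
  · rw [add_zero]
    exact (ContinuousLinearMap.opNorm_comp_le _ _).trans
      (mul_le_mul_of_nonneg_right (hV.norm_fderiv_le _ _) (norm_nonneg _))

lemma integrable_modulus (v : VelocityL2 V) (δ : ℝ) :
    Integrable fun r => modulus (extend v r : V) δ := by
  refine ((integrable_norm_extend v).const_mul (2 * C)).mono'
    ((hV.continuous_modulus δ).comp_stronglyMeasurable
      (stronglyMeasurable_extend v)).aestronglyMeasurable (Eventually.of_forall fun r => ?_)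
  rw [Real.norm_of_nonneg (modulus_nonneg _ _)]
  exact hV.modulus_le _ _

/-- Dominated convergence with majorant `2 C ‖v(r)‖`. This smallness, uniform in space, replaces any
pointwise-in-time regularity of `v` in the differentiability proofs. -/
lemma tendsto_totalModulus (v : VelocityL2 V) : Tendsto (totalModulus v) (𝓝 0) (𝓝 0) := by
  have h := tendsto_integral_filter_of_dominated_convergence (μ := volume) (l := 𝓝 (0 : ℝ))
    (F := fun δ r => modulus (extend v r : V) δ) (f := fun _ => 0)
    (fun r => 2 * C * ‖extend v r‖)
    (Eventually.of_forall fun δ => (hV.integrable_modulus v δ).aestronglyMeasurable)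
    (Eventually.of_forall fun δ => Eventually.of_forall fun r => by
      rw [Real.norm_of_nonneg (modulus_nonneg _ _)]
      exact hV.modulus_le _ _)
    ((integrable_norm_extend v).const_mul (2 * C))
    (Eventually.of_forall fun r => hV.tendsto_modulus _)
  rw [integral_zero] at h
  exact h

/-- Dependence of the linearised flow on the initial value and the velocity field. -/
lemma norm_lin_sub_le (v v' : VelocityL2 V) (x x' : Space n) {s t : ℝ} (hst : |t - s| ≤ 1) :
    ‖lin v' s x' t - lin v s x t‖ ≤ stab C v * (stab C v' * (C * ‖v' - v‖ +
      totalModulus v (stab C v * (‖x' - x‖ + C * ‖v' - v‖)))) := by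
  set δ := stab C v * (‖x' - x‖ + C * ‖v' - v‖) with hδ
  have hi := fun (v : VelocityL2 V) x => (hV.isCaratheodory_linField v s x).intervalIntegrable
    (hV.isRate v) (hV.continuous_lin v s x)
  have h := hV.norm_le_of_velocity_le v (ρ := fun t => lin v' s x' t - lin v s x t)
    (d := fun r => linField v' s x' r (lin v' s x' r) - linField v s x r (lin v s x r))
    (ρ₀ := 0) (ε := stab C v' * (C * ‖v' - v‖ + totalModulus v δ))
    (e := fun r => stab C v' * (C * ‖extend (v' - v) r‖ + modulus (extend v r : V) δ)) hst
    ((hV.continuous_lin v' s x').sub (hV.continuous_lin v s x)).continuousOn ?_ ?_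
    (fun r => mul_nonneg (stab_pos _ _).le (add_nonneg (mul_nonneg hV.pos.le (norm_nonneg _))
      (modulus_nonneg _ _)))
    ((((integrable_norm_extend _).const_mul C).add (hV.integrable_modulus v δ)).const_mul _) ?_
  · simpa using h
  · intro t _
    rw [intervalIntegral.integral_sub (hi v' x' _ _) (hi v x _ _), (hV.isSolution_lin v' s x').2 t,
      (hV.isSolution_lin v s x).2 t]
    abel
  · filter_upwards [extend_sub v' v] with r hr hrt
    have hrs : |r - s| ≤ 1 := (abs_sub_left_of_mem_uIcc (uIoc_subset_uIcc hrt)).trans hst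
    rw [hr]
    set γ := traj v s x r
    set γ' := traj v' s x' r
    set A := lin v s x r
    set A' := lin v' s x' r
    -- The first summand is linear in the unknown difference and is absorbed by Grönwall. The second
    -- is forcing: the change of field, plus the change of base point measured by the modulus.
    have h1 : linField v' s x' r A' - linField v s x r A =
        (fderiv ℝ (⇑(extend v r : V)) γ).comp (A' - A)
        + (fderiv ℝ (⇑(extend v' r - extend v r : V)) γ'
          + (fderiv ℝ (⇑(extend v r : V)) γ' - fderiv ℝ (⇑(extend v r : V)) γ)).comp A' := by
      rw [hV.fderiv_sub]
      simp only [linField, ContinuousLinearMap.comp_sub, ContinuousLinearMap.sub_comp,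
        ContinuousLinearMap.add_comp]
      abel
    have h2 : ‖(fderiv ℝ (⇑(extend v r : V)) γ).comp (A' - A)‖ ≤ C * ‖extend v r‖ * ‖A' - A‖ :=
      (ContinuousLinearMap.opNorm_comp_le _ _).trans
        (mul_le_mul_of_nonneg_right (hV.norm_fderiv_le _ _) (norm_nonneg _))
    have h3 : ‖(fderiv ℝ (⇑(extend v' r - extend v r : V)) γ'
          + (fderiv ℝ (⇑(extend v r : V)) γ' - fderiv ℝ (⇑(extend v r : V)) γ)).comp A'‖
        ≤ (C * ‖extend v' r - extend v r‖ + modulus (extend v r : V) δ) * stab C v' := by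
      refine (ContinuousLinearMap.opNorm_comp_le _ _).trans
        (mul_le_mul ((norm_add_le _ _).trans (add_le_add (hV.norm_fderiv_le _ _)
          (hV.le_modulus _ (hV.norm_traj_sub_le v v' x x' hrs))))
          (hV.norm_lin_le v' x' hrs) (norm_nonneg _)
          (add_nonneg (mul_nonneg hV.pos.le (norm_nonneg _)) (modulus_nonneg _ _)))
    rw [h1]
    exact (norm_add_le _ _).trans (by linarith)
  · rw [integral_const_mul, integral_add ((integrable_norm_extend _).const_mul C)
      (hV.integrable_modulus v δ), integral_const_mul]
    have := integral_norm_extend_le (v' - v)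
    have := hV.pos
    have := stab_pos C v'
    unfold totalModulus
    gcongr

/-- Linearisation of the flow in the initial value and the velocity field. -/
lemma norm_traj_add_sub_sub_le (v w : VelocityL2 V) (x z : Space n) {ζ : ℝ → Space n} {s t : ℝ}
    (hst : |t - s| ≤ 1) (hζ : ContinuousOn ζ (uIcc s t))
    (hζeq : ∀ u ∈ uIcc s t, ζ u = z + ∫ r in s..u, (fderiv ℝ (⇑(extend v r : V)) (traj v s x r) (ζ r)
      + (extend w r : V) (traj v s x r))) :
    ‖traj (v + w) s (x + z) t - traj v s x t - ζ t‖ ≤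
      stab C v * ((totalModulus v (stab C v * (‖z‖ + C * ‖w‖)) + C * ‖w‖)
        * (stab C v * (‖z‖ + C * ‖w‖))) := by
  set δ := stab C v * (‖z‖ + C * ‖w‖) with hδ
  have hC := hV.pos
  have hδ0 : 0 ≤ δ := mul_nonneg (stab_pos _ _).le (by positivity)
  set γ := traj v s x
  set γ' := traj (v + w) s (x + z)
  have hγ : Continuous γ := hV.continuous_traj _ _ _
  have hγ' : Continuous γ' := hV.continuous_traj _ _ _
  have hdist : ∀ r, |r - s| ≤ 1 → ‖γ' r - γ r‖ ≤ δ := fun r hr => by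
    simpa using hV.norm_traj_sub_le v (v + w) x (x + z) hr
  have hi : ∀ u ∈ uIcc s t, IntervalIntegrable (fun r => fderiv ℝ (⇑(extend v r : V)) (γ r) (ζ r)
      + (extend w r : V) (γ r)) volume s u := fun u hu => by
    have hsub : uIoc s u ⊆ uIcc s t :=
      uIoc_subset_uIcc.trans (uIcc_subset_uIcc_left hu)
    refine IntervalIntegrable.add ?_ (hV.intervalIntegrable_eval w hγ _ _)
    have hm : AEStronglyMeasurable ζ (volume.restrict (uIoc s u)) :=
      (hζ.mono hsub).aestronglyMeasurable measurableSet_uIoc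
    refine ((hV.isRate v).intervalIntegrable_mul (g := fun r => ‖ζ r‖)
      (hζ.mono (uIcc_subset_uIcc_left hu)).norm).mono_fun ?_ (Eventually.of_forall fun r => ?_)
    · have h1 : Continuous fun p : (Space n →L[ℝ] Space n) × Space n => p.1 p.2 := by fun_prop
      exact h1.comp_aestronglyMeasurable
        ((hV.aestronglyMeasurable_fderiv v hγ).aestronglyMeasurable.prodMk hm)
    · refine (ContinuousLinearMap.le_opNorm _ _).trans ?_
      refine (mul_le_mul_of_nonneg_right (hV.norm_fderiv_le _ _) (norm_nonneg _)).trans ?_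
      exact le_abs_self _
  have h := hV.norm_le_of_velocity_le v (ρ := fun t => γ' t - γ t - ζ t)
    (d := fun r => (extend (v + w) r : V) (γ' r) - (extend v r : V) (γ r) -
      (fderiv ℝ (⇑(extend v r : V)) (γ r) (ζ r) + (extend w r : V) (γ r)))
    (ρ₀ := 0) (ε := (totalModulus v δ + C * ‖w‖) * δ)
    (e := fun r => (modulus (extend v r : V) δ + C * ‖extend w r‖) * δ) hst
    ((hγ'.sub hγ).continuousOn.sub hζ) ?_ ?_
    (fun r => mul_nonneg (add_nonneg (modulus_nonneg _ _)
      (mul_nonneg hV.pos.le (norm_nonneg _))) hδ0)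
    (((hV.integrable_modulus v δ).add ((integrable_norm_extend _).const_mul C)).mul_const _) ?_
  · simpa using h
  · intro u hu
    rw [intervalIntegral.integral_sub ((hV.intervalIntegrable_eval _ hγ' _ _).sub
      (hV.intervalIntegrable_eval _ hγ _ _)) (hi u hu), intervalIntegral.integral_sub
      (hV.intervalIntegrable_eval _ hγ' _ _) (hV.intervalIntegrable_eval _ hγ _ _),
      hζeq u hu, show γ' u = _ from hV.traj_eq (v + w) s (x + z) u,
      show γ u = _ from hV.traj_eq v s x u]
    abel
  · filter_upwards [extend_add v w] with r hr hrt
    have hrs : |r - s| ≤ 1 := (abs_sub_left_of_mem_uIcc (uIoc_subset_uIcc hrt)).trans hst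
    rw [hr]
    -- The residual velocity has three parts: the linearised field acting on the residual, absorbed
    -- by Grönwall; the Taylor remainder of `v`; and the variation of `w` between the two
    -- trajectories. The last two are small relative to `δ`.
    have h1 : (extend v r + extend w r : V) (γ' r) - (extend v r : V) (γ r) -
        (fderiv ℝ (⇑(extend v r : V)) (γ r) (ζ r) + (extend w r : V) (γ r))
        = fderiv ℝ (⇑(extend v r : V)) (γ r) (γ' r - γ r - ζ r)
          + ((extend v r : V) (γ' r) - (extend v r : V) (γ r)
            - fderiv ℝ (⇑(extend v r : V)) (γ r) (γ' r - γ r))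
          + ((extend w r : V) (γ' r) - (extend w r : V) (γ r)) := by
      rw [RKHS.coe_add, Pi.add_apply, map_sub _ _ (ζ r)]
      abel
    have h2 : ‖fderiv ℝ (⇑(extend v r : V)) (γ r) (γ' r - γ r - ζ r)‖
        ≤ C * ‖extend v r‖ * ‖γ' r - γ r - ζ r‖ :=
      (ContinuousLinearMap.le_opNorm _ _).trans
        (mul_le_mul_of_nonneg_right (hV.norm_fderiv_le _ _) (norm_nonneg _))
    have h3 := (hV.norm_sub_sub_fderiv_le (extend v r) (hdist r hrs)).trans
      (mul_le_mul_of_nonneg_left (hdist r hrs) (modulus_nonneg _ _))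
    have h4 := (hV.lipschitz (extend w r) (γ' r) (γ r)).trans
      (mul_le_mul_of_nonneg_left (hdist r hrs) (mul_nonneg hV.pos.le (norm_nonneg _)))
    rw [h1]
    refine (norm_add₃_le).trans ?_
    linarith
  · rw [integral_mul_const, integral_add (hV.integrable_modulus v δ)
      ((integrable_norm_extend _).const_mul C), integral_const_mul]
    have := integral_norm_extend_le w
    unfold totalModulus
    gcongr

end IsAdmissibleWith

end Flow

/-- The projection of `ℝ` onto `[0,1]`. -/
def clamp (r : ℝ) : ℝ := projIcc (0 : ℝ) 1 zero_le_one r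

lemma clamp_mem (r : ℝ) : clamp r ∈ Icc (0 : ℝ) 1 := (projIcc (0 : ℝ) 1 zero_le_one r).2

lemma clamp_of_mem {r : ℝ} (hr : r ∈ Icc (0 : ℝ) 1) : clamp r = r := by
  rw [clamp, projIcc_of_mem _ hr]

@[fun_prop]
lemma continuous_clamp : Continuous clamp := continuous_subtype_val.comp continuous_projIcc

lemma abs_clamp_sub_le (r s : ℝ) : |clamp r - clamp s| ≤ 1 := by
  have h1 := clamp_mem r
  have h2 := clamp_mem s
  rw [abs_le]
  constructor <;> linarith [h1.1, h1.2, h2.1, h2.2]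

/-! ### Flow maps and Jacobians: group law, joint continuity, invariance of `Ω`. -/

section FlowMap

variable {n : ℕ} {Ω : Set (Space n)} {V : Type*} [NormedAddCommGroup V] [InnerProductSpace ℝ V]
  [RKHS ℝ V (Space n) (Space n)] {C : ℝ}

/-- The flow map `φ_{s,t}^v`, for times clamped to `[0,1]`. -/
def phi (v : VelocityL2 V) (s t : ℝ) (x : Space n) : Space n := traj v (clamp s) x (clamp t)

/-- The Jacobian of the flow map. -/
def jac (v : VelocityL2 V) (s t : ℝ) (x : Space n) : Space n →L[ℝ] Space n :=
  lin v (clamp s) x (clamp t)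

/-- A bound for the uniform distance of `φ_{s',t'}^{v'}` and `φ_{s,t}^v`. -/
def phiDist (C : ℝ) (v : VelocityL2 V) (s t : ℝ) (p : VelocityL2 V × ℝ × ℝ) : ℝ :=
  stab C v * (C * ‖p.1 - v‖) + stab C v * |∫ r in (clamp p.2.1)..(clamp s), C * ‖extend v r‖|
    + |∫ r in (clamp t)..(clamp p.2.2), C * ‖extend v r‖|

lemma continuous_phiDist (v : VelocityL2 V) (s t : ℝ) :
    Continuous (phiDist C v s t) := by
  have hm : Continuous fun b => ∫ r in (0 : ℝ)..b, C * ‖extend v r‖ :=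
    intervalIntegral.continuous_primitive
      (fun _ _ => ((integrable_norm_extend v).const_mul C).intervalIntegrable) 0
  have h : ∀ a b : ℝ, ∫ r in a..b, C * ‖extend v r‖
      = (∫ r in (0 : ℝ)..b, C * ‖extend v r‖) - ∫ r in (0 : ℝ)..a, C * ‖extend v r‖ := fun a b =>
    (intervalIntegral.integral_interval_sub_left
      ((integrable_norm_extend v).const_mul C).intervalIntegrable
      ((integrable_norm_extend v).const_mul C).intervalIntegrable).symm
  have he : phiDist C v s t = fun p => stab C v * (C * ‖p.1 - v‖)
      + stab C v * |(∫ r in (0 : ℝ)..(clamp s), C * ‖extend v r‖)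
        - ∫ r in (0 : ℝ)..(clamp p.2.1), C * ‖extend v r‖|
      + |(∫ r in (0 : ℝ)..(clamp p.2.2), C * ‖extend v r‖)
        - ∫ r in (0 : ℝ)..(clamp t), C * ‖extend v r‖| := by
    funext p
    rw [phiDist, h (clamp p.2.1) (clamp s), h (clamp t) (clamp p.2.2)]
  rw [he]
  have h1 : Continuous fun p : VelocityL2 V × ℝ × ℝ =>
    ∫ r in (0 : ℝ)..(clamp p.2.1), C * ‖extend v r‖ := hm.comp (by fun_prop)
  have h2 : Continuous fun p : VelocityL2 V × ℝ × ℝ =>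
    ∫ r in (0 : ℝ)..(clamp p.2.2), C * ‖extend v r‖ := hm.comp (by fun_prop)
  fun_prop

lemma tendsto_phiDist (v : VelocityL2 V) (s t : ℝ) :
    Tendsto (phiDist C v s t) (𝓝 (v, s, t)) (𝓝 0) := by
  have h := (continuous_phiDist (C := C) v s t).tendsto (v, s, t)
  have h0 : phiDist C v s t (v, s, t) = 0 := by simp [phiDist]
  rwa [h0] at h

variable (hV : IsAdmissibleWith Ω V C)

namespace IsAdmissibleWith

include hV

lemma phi_self (v : VelocityL2 V) (s : ℝ) (x : Space n) : phi v s s x = x := hV.traj_self _ _ _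

lemma phi_phi (v : VelocityL2 V) (s t u : ℝ) (x : Space n) :
    phi v t u (phi v s t x) = phi v s u x := by
  unfold phi
  rw [hV.traj_traj]

lemma phi_phi_self (v : VelocityL2 V) (s t : ℝ) (x : Space n) : phi v t s (phi v s t x) = x := by
  rw [hV.phi_phi, hV.phi_self]

lemma norm_phi_sub_le (v v' : VelocityL2 V) (x x' : Space n) (s t : ℝ) :
    ‖phi v' s t x' - phi v s t x‖ ≤ stab C v * (‖x' - x‖ + C * ‖v' - v‖) :=
  hV.norm_traj_sub_le v v' x x' (abs_clamp_sub_le t s)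

lemma norm_jac_le (v : VelocityL2 V) (s t : ℝ) (x : Space n) : ‖jac v s t x‖ ≤ stab C v :=
  hV.norm_lin_le v x (abs_clamp_sub_le t s)

lemma norm_jac_sub_le (v v' : VelocityL2 V) (x x' : Space n) (s t : ℝ) :
    ‖jac v' s t x' - jac v s t x‖ ≤ stab C v * (stab C v' * (C * ‖v' - v‖ +
      totalModulus v (stab C v * (‖x' - x‖ + C * ‖v' - v‖)))) :=
  hV.norm_lin_sub_le v v' x x' (abs_clamp_sub_le t s)

/-- The linearisation estimate with unperturbed field (`w = 0`) and `ζ` the linearised solution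
applied to the displacement `z`. -/
lemma hasFDerivAt_phi (v : VelocityL2 V) (s t : ℝ) (x : Space n) :
    HasFDerivAt (phi v s t) (jac v s t x) x := by
  rw [hasFDerivAt_iff_isLittleO_nhds_zero, Asymptotics.isLittleO_iff]
  intro c hc
  set κ := stab C v with hκ
  have hκ0 : 0 < κ := stab_pos C v
  have h1 : Tendsto (fun z : Space n => totalModulus v (κ * ‖z‖)) (𝓝 0) (𝓝 0) := by
    refine (hV.tendsto_totalModulus v).comp ?_
    have : Continuous fun z : Space n => κ * ‖z‖ := by fun_prop
    simpa using this.tendsto 0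
  filter_upwards [h1.eventually (gt_mem_nhds (by positivity : 0 < c / (κ * κ)))] with z hz
  have h := hV.norm_traj_add_sub_sub_le v 0 x z (s := clamp s) (t := clamp t)
    (ζ := fun r => lin v (clamp s) x r z) (abs_clamp_sub_le t s)
    (by have := hV.continuous_lin v (clamp s) x; fun_prop) ?_
  · rw [add_zero, norm_zero, mul_zero, add_zero, add_zero] at h
    refine h.trans ?_
    calc κ * (totalModulus v (κ * ‖z‖) * (κ * ‖z‖)) ≤ κ * (c / (κ * κ) * (κ * ‖z‖)) := by gcongr
      _ = c * ‖z‖ := by field_simp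
  · intro u _
    have h2 : ∫ r in (clamp s)..u, (fderiv ℝ (⇑(extend v r : V)) (traj v (clamp s) x r)
        (lin v (clamp s) x r z) + (extend (0 : VelocityL2 V) r : V) (traj v (clamp s) x r))
        = ∫ r in (clamp s)..u, (linField v (clamp s) x r (lin v (clamp s) x r)) z := by
      refine intervalIntegral.integral_congr_ae ?_
      -- The representative of the zero class vanishes only almost everywhere, whence the detour
      -- through scalar multiplication.
      have h0 := extend_smul (0 : ℝ) (0 : VelocityL2 V)
      rw [zero_smul] at h0
      filter_upwards [h0] with r hr _
      rw [hr, zero_smul, RKHS.coe_zero, Pi.zero_apply, add_zero]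
      rfl
    rw [h2, ← ContinuousLinearMap.intervalIntegral_apply
      ((hV.isCaratheodory_linField v _ x).intervalIntegrable (hV.isRate v)
        (hV.continuous_lin v _ x) _ _)]
    rw [(hV.isSolution_lin v (clamp s) x).2 u]
    simp

lemma fderiv_phi (v : VelocityL2 V) (s t : ℝ) (x : Space n) :
    fderiv ℝ (phi v s t) x = jac v s t x := (hV.hasFDerivAt_phi v s t x).fderiv

/-- Chain rule for the group law; in particular each Jacobian is invertible, with inverse the
Jacobian of the reversed flow. -/
lemma jac_comp_jac (v : VelocityL2 V) (s t u : ℝ) (x : Space n) :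
    (jac v t u (phi v s t x)).comp (jac v s t x) = jac v s u x := by
  have h1 := (hV.hasFDerivAt_phi v t u (phi v s t x)).comp x (hV.hasFDerivAt_phi v s t x)
  have h2 : phi v t u ∘ phi v s t = phi v s u := funext fun y => hV.phi_phi v s t u y
  rw [h2] at h1
  exact h1.unique (hV.hasFDerivAt_phi v s u x)

lemma jac_self (v : VelocityL2 V) (s : ℝ) (x : Space n) :
    jac v s s x = ContinuousLinearMap.id ℝ (Space n) := by
  rw [jac, hV.lin_eq]; simp

lemma norm_eval_le_integral (v : VelocityL2 V) (γ : ℝ → Space n) (a b : ℝ) :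
    ‖∫ r in a..b, (extend v r : V) (γ r)‖ ≤ |∫ r in a..b, C * ‖extend v r‖| :=
  intervalIntegral.norm_integral_le_abs_of_norm_le (Eventually.of_forall fun _ => hV.norm_le _ _)
    ((integrable_norm_extend v).const_mul C).intervalIntegrable

lemma traj_sub_traj (v : VelocityL2 V) (s : ℝ) (x : Space n) (a b : ℝ) :
    traj v s x b - traj v s x a = ∫ r in a..b, (extend v r : V) (traj v s x r) := by
  rw [hV.traj_eq v s x b, hV.traj_eq v s x a, add_sub_add_left_eq_sub,
    intervalIntegral.integral_interval_sub_left]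
  · exact hV.intervalIntegrable_eval v (hV.continuous_traj v s x) _ _
  · exact hV.intervalIntegrable_eval v (hV.continuous_traj v s x) _ _

lemma norm_phi_sub_phi_le (v : VelocityL2 V) (s : ℝ) (x : Space n) (a b : ℝ) :
    ‖phi v s b x - phi v s a x‖ ≤ |∫ r in (clamp a)..(clamp b), C * ‖extend v r‖| := by
  unfold phi
  rw [hV.traj_sub_traj]
  exact hV.norm_eval_le_integral v _ _ _

lemma norm_phi_sub_self_le (v : VelocityL2 V) (s t : ℝ) (x : Space n) :
    ‖phi v s t x - x‖ ≤ C * ‖v‖ := by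
  have h := hV.norm_phi_sub_phi_le v s x s t
  rw [hV.phi_self] at h
  refine h.trans ((abs_intervalIntegral_le_integral ((integrable_norm_extend v).const_mul C)
    (fun r => mul_nonneg hV.pos.le (norm_nonneg _)) _ _).trans ?_)
  rw [integral_const_mul]
  exact mul_le_mul_of_nonneg_left (integral_norm_extend_le v) hV.pos.le

/-- Three changes, one at a time: the field, the initial time, the final time. The group law turns
the change of initial time into a displacement of the starting point, whose effect the Lipschitz
bound controls. -/
lemma norm_phi_sub_le_phiDist (v : VelocityL2 V) (s t : ℝ) (p : VelocityL2 V × ℝ × ℝ)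
    (x : Space n) : ‖phi p.1 p.2.1 p.2.2 x - phi v s t x‖ ≤ phiDist C v s t p := by
  obtain ⟨v', s', t'⟩ := p
  have h1 := hV.norm_phi_sub_le v v' x x s' t'
  have h2 := hV.norm_phi_sub_le v v x (phi v s' s x) s t'
  have h3 := hV.norm_phi_sub_phi_le v s' x s' s
  have h4 := hV.norm_phi_sub_phi_le v s x t t'
  rw [hV.phi_phi] at h2
  rw [hV.phi_self] at h3
  simp only [sub_self, norm_zero, mul_zero, add_zero, zero_add] at h1 h2
  have h5 := h2.trans (mul_le_mul_of_nonneg_left h3 (stab_pos C v).le)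
  calc ‖phi v' s' t' x - phi v s t x‖
      = ‖(phi v' s' t' x - phi v s' t' x) + (phi v s' t' x - phi v s t' x)
        + (phi v s t' x - phi v s t x)‖ := by congr 1; abel
    _ ≤ _ := norm_add₃_le.trans (add_le_add (add_le_add h1 h5) h4)

lemma continuous_phi : Continuous fun p : (VelocityL2 V × ℝ × ℝ) × Space n =>
    phi p.1.1 p.1.2.1 p.1.2.2 p.2 := by
  rw [continuous_iff_continuousAt]
  rintro ⟨⟨v, s, t⟩, x⟩
  rw [ContinuousAt, tendsto_iff_norm_sub_tendsto_zero]
  have h1 : Tendsto (fun p : (VelocityL2 V × ℝ × ℝ) × Space n =>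
      stab C p.1.1 * ‖p.2 - x‖ + phiDist C v s t p.1) (𝓝 ((v, s, t), x)) (𝓝 0) := by
    have h2 := continuous_phiDist (C := C) v s t
    have h3 := continuous_stab C (V := V)
    have h4 : Continuous fun p : (VelocityL2 V × ℝ × ℝ) × Space n =>
      stab C p.1.1 * ‖p.2 - x‖ + phiDist C v s t p.1 := by fun_prop
    simpa [phiDist] using h4.tendsto ((v, s, t), x)
  refine squeeze_zero (fun _ => norm_nonneg _) (fun p => ?_) h1
  have h5 := hV.norm_phi_sub_le p.1.1 p.1.1 x p.2 p.1.2.1 p.1.2.2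
  simp only [sub_self, norm_zero, mul_zero, add_zero] at h5
  have h6 := hV.norm_phi_sub_le_phiDist v s t p.1 x
  calc _ = ‖(phi p.1.1 p.1.2.1 p.1.2.2 p.2 - phi p.1.1 p.1.2.1 p.1.2.2 x)
        + (phi p.1.1 p.1.2.1 p.1.2.2 x - phi v s t x)‖ := by congr 1; abel
    _ ≤ _ := (norm_add_le _ _).trans (add_le_add h5 h6)

lemma norm_jac_sub_id_le (v : VelocityL2 V) (s t : ℝ) (x : Space n) :
    ‖jac v s t x - ContinuousLinearMap.id ℝ (Space n)‖ ≤
      stab C v * |∫ r in (clamp s)..(clamp t), C * ‖extend v r‖| := by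
  rw [jac, hV.lin_eq, add_sub_cancel_left]
  have h : |∫ r in (clamp s)..(clamp t), stab C v * (C * ‖extend v r‖)|
      = stab C v * |∫ r in (clamp s)..(clamp t), C * ‖extend v r‖| := by
    rw [intervalIntegral.integral_const_mul, abs_mul, abs_of_pos (stab_pos C v)]
  rw [← h]
  refine intervalIntegral.norm_integral_le_abs_of_norm_le
    ((ae_restrict_mem measurableSet_uIoc).mono fun r hr => ?_)
    (((integrable_norm_extend v).const_mul C).const_mul _).intervalIntegrable
  have hrs : |r - clamp s| ≤ 1 :=
    (abs_sub_left_of_mem_uIcc (uIoc_subset_uIcc hr)).trans (abs_clamp_sub_le t s)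
  refine (ContinuousLinearMap.opNorm_comp_le _ _).trans ?_
  rw [mul_comm]
  exact mul_le_mul (hV.norm_lin_le v x hrs) (hV.norm_fderiv_le _ _) (norm_nonneg _)
    (stab_pos C v).le

/-- No convergence of the times `s'`, `t'` is required, since the stability estimate is uniform in
them. -/
lemma tendsto_jac_sub {α : Type*} {F : Filter α} {v : VelocityL2 V} {x : Space n}
    {v' : α → VelocityL2 V} {x' : α → Space n} (s' t' : α → ℝ) (hv : Tendsto v' F (𝓝 v))
    (hx : Tendsto x' F (𝓝 x)) :
    Tendsto (fun a => jac (v' a) (s' a) (t' a) (x' a) - jac v (s' a) (t' a) x) F (𝓝 0) := by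
  rw [tendsto_zero_iff_norm_tendsto_zero]
  refine squeeze_zero (fun _ => norm_nonneg _)
    (fun a => hV.norm_jac_sub_le v (v' a) x (x' a) (s' a) (t' a)) ?_
  have hv0 : Tendsto (fun a => C * ‖v' a - v‖) F (𝓝 0) := by
    simpa using ((tendsto_sub_nhds_zero_iff.2 hv).norm).const_mul C
  have hx0 : Tendsto (fun a => ‖x' a - x‖) F (𝓝 0) := by
    simpa using ((tendsto_sub_nhds_zero_iff.2 hx).norm)
  have h1 : Tendsto (fun a => stab C v * (‖x' a - x‖ + C * ‖v' a - v‖)) F (𝓝 0) := by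
    simpa using (hx0.add hv0).const_mul (stab C v)
  have h2 := (hV.tendsto_totalModulus v).comp h1
  have h3 := ((continuous_stab C (V := V)).tendsto v).comp hv
  simpa using ((h3.mul (hv0.add h2)).const_mul (stab C v))

/-- The initial time is the hard variable, since `lin` starts anew with it. The cocycle identity
`Dφ_{s',t'} = Dφ_{s,t'}(φ_{s',s}) ∘ Dφ_{s',s}` reduces to a fixed initial time, with the last factor
tending to the identity. -/
lemma continuous_jac : Continuous fun p : (VelocityL2 V × ℝ × ℝ) × Space n =>
    jac p.1.1 p.1.2.1 p.1.2.2 p.2 := by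
  rw [continuous_iff_continuousAt]
  rintro ⟨⟨v, s, t⟩, x⟩
  let F := 𝓝 (((v, s, t), x) : (VelocityL2 V × ℝ × ℝ) × Space n)
  have hphi := hV.continuous_phi
  have h1 : Tendsto (fun p : (VelocityL2 V × ℝ × ℝ) × Space n =>
      jac p.1.1 p.1.2.1 p.1.2.2 p.2 - jac v p.1.2.1 p.1.2.2 x) F (𝓝 0) :=
    hV.tendsto_jac_sub _ _ ((by fun_prop : Continuous fun p : (VelocityL2 V × ℝ × ℝ) × Space n =>
      p.1.1).tendsto _) (continuous_snd.tendsto _)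
  have h2 : Tendsto (fun p : (VelocityL2 V × ℝ × ℝ) × Space n =>
      jac v s p.1.2.2 (phi v p.1.2.1 s x) - jac v s p.1.2.2 x) F (𝓝 0) := by
    refine hV.tendsto_jac_sub _ _ tendsto_const_nhds ?_
    have h3 : Continuous fun p : (VelocityL2 V × ℝ × ℝ) × Space n => phi v p.1.2.1 s x :=
      hphi.comp (f := fun p : (VelocityL2 V × ℝ × ℝ) × Space n => ((v, p.1.2.1, s), x))
        (by fun_prop)
    have := h3.tendsto ((v, s, t), x)
    rwa [hV.phi_self] at this
  have h4 : Tendsto (fun p : (VelocityL2 V × ℝ × ℝ) × Space n => jac v s p.1.2.2 x) F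
      (𝓝 (jac v s t x)) := by
    have h5 := hV.continuous_lin v (clamp s) x
    have h6 : Continuous fun p : (VelocityL2 V × ℝ × ℝ) × Space n =>
      lin v (clamp s) x (clamp p.1.2.2) := h5.comp (by fun_prop)
    exact h6.tendsto _
  have h7 : Tendsto (fun p : (VelocityL2 V × ℝ × ℝ) × Space n => jac v p.1.2.1 s x) F
      (𝓝 (ContinuousLinearMap.id ℝ (Space n))) := by
    rw [← tendsto_sub_nhds_zero_iff, tendsto_zero_iff_norm_tendsto_zero]
    refine squeeze_zero (fun _ => norm_nonneg _) (fun p => hV.norm_jac_sub_id_le v _ _ x) ?_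
    have h8 : Continuous fun p : (VelocityL2 V × ℝ × ℝ) × Space n =>
        phiDist C v s t (v, p.1.2.1, t) := (continuous_phiDist v s t).comp (by fun_prop)
    simpa [phiDist] using h8.tendsto ((v, s, t), x)
  have h9 : Tendsto (fun p : (VelocityL2 V × ℝ × ℝ) × Space n => jac v p.1.2.1 p.1.2.2 x) F
      (𝓝 (jac v s t x)) := by
    have h10 : Tendsto (fun p : (VelocityL2 V × ℝ × ℝ) × Space n =>
        jac v s p.1.2.2 (phi v p.1.2.1 s x)) F (𝓝 (jac v s t x)) := by
      simpa using h2.add h4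
    have hc : Continuous fun p : (Space n →L[ℝ] Space n) × (Space n →L[ℝ] Space n) =>
      p.1.comp p.2 := by fun_prop
    have h11 := (hc.tendsto (jac v s t x, ContinuousLinearMap.id ℝ (Space n))).comp
      (h10.prodMk_nhds h7)
    refine (h11.congr fun p => ?_)
    exact hV.jac_comp_jac v _ _ _ x
  have := h1.add h9
  simpa [ContinuousAt, F] using this

/-- The fields vanish outside `Ω`, so the constant curve is the unique solution there. -/
lemma phi_of_notMem (v : VelocityL2 V) (s t : ℝ) {x : Space n} (hx : x ∉ Ω) :
    phi v s t x = x := by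
  have h : IsSolution (fun r x => (extend v r : V) x) (clamp s) x (fun _ => x) :=
    ⟨continuous_const, fun t => by simp [hV.eq_zero _ x hx]⟩
  have := (hV.isSolution_traj v (clamp s) x).unique (hV.isCaratheodory v) (hV.isRate v) h
  rw [phi, this]

lemma phi_mem_iff (v : VelocityL2 V) (s t : ℝ) {x : Space n} : phi v s t x ∈ Ω ↔ x ∈ Ω := by
  refine ⟨fun h => ?_, fun h => ?_⟩
  · by_contra hx
    rw [hV.phi_of_notMem v s t hx] at h
    exact hx h
  · by_contra hx
    have h1 := hV.phi_of_notMem v t s hx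
    rw [hV.phi_phi_self] at h1
    rw [← h1] at hx
    exact hx h

lemma bijective_phi (v : VelocityL2 V) (s t : ℝ) : Function.Bijective (phi v s t) :=
  ⟨Function.LeftInverse.injective (g := phi v t s) fun x => hV.phi_phi_self v s t x,
    Function.RightInverse.surjective (g := phi v t s) fun x => hV.phi_phi_self v t s x⟩

lemma invFun_phi (v : VelocityL2 V) (s t : ℝ) : Function.invFun (phi v s t) = phi v t s :=
  Function.invFun_eq_of_injective_of_rightInverse (hV.bijective_phi v s t).1
    fun x => hV.phi_phi_self v t s x

lemma bijOn_phi (v : VelocityL2 V) (s t : ℝ) : BijOn (phi v s t) Ω Ω :=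
  ⟨fun _ hx => (hV.phi_mem_iff v s t).2 hx, (hV.bijective_phi v s t).1.injOn,
    fun x hx => ⟨phi v t s x, (hV.phi_mem_iff v t s).2 hx, hV.phi_phi_self v t s x⟩⟩

lemma isFlowLine_traj (v : VelocityL2 V) (x : Space n) : IsFlowLine v x (traj v 0 x) := by
  have hcongr : ∀ r ∈ Icc (0 : ℝ) 1, (extend v r : V) (traj v 0 x r) = (v r : V) (traj v 0 x r) :=
    fun r hr => by rw [extend_of_mem v hr]
  refine ⟨(hV.continuous_traj v 0 x).continuousOn, ?_, fun t ht => ?_⟩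
  · have h := hV.intervalIntegrable_eval v (hV.continuous_traj v 0 x) 0 1
    rw [intervalIntegrable_iff_integrableOn_Icc_of_le zero_le_one] at h
    exact h.congr_fun hcongr measurableSet_Icc
  · rw [hV.traj_eq v 0 x t]
    congr 1
    refine intervalIntegral.integral_congr fun r hr => ?_
    rw [uIcc_of_le ht.1] at hr
    exact hcongr r ⟨hr.1, hr.2.trans ht.2⟩

lemma isFlowLine_flow (v : VelocityL2 V) (x : Space n) : IsFlowLine v x (fun t => flow v t x) :=
  Classical.epsilon_spec (p := IsFlowLine v x) ⟨_, hV.isFlowLine_traj v x⟩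

/-- `flow` is an arbitrary choice of solution on `[0,1]`; uniqueness on that interval identifies it
with the global trajectory. -/
lemma flow_eq_phi (v : VelocityL2 V) {t : ℝ} (ht : t ∈ Icc (0 : ℝ) 1) : flow v t = phi v 0 t := by
  funext x
  have h := hV.isFlowLine_flow v x
  have hsub : uIcc 0 t ⊆ Icc (0 : ℝ) 1 := by
    rw [uIcc_of_le ht.1]; exact Icc_subset_Icc_right ht.2
  have hcongr : ∀ r ∈ Icc (0 : ℝ) 1, (extend v r : V) (flow v r x) = (v r : V) (flow v r x) :=
    fun r hr => by rw [extend_of_mem v hr]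
  rw [phi, clamp_of_mem ht, clamp_of_mem (left_mem_Icc.2 zero_le_one)]
  refine (hV.isCaratheodory v).eqOn (hV.isRate v) (s := 0) (x := x)
    (γ := fun t => flow v t x) (h.continuousOn.mono hsub)
    (hV.continuous_traj v 0 x).continuousOn ?_
    (hV.intervalIntegrable_eval v (hV.continuous_traj v 0 x) 0 t) (fun u hu => ?_)
    (fun u _ => hV.traj_eq v 0 x u)
  · rw [intervalIntegrable_iff_integrableOn_Icc_of_le ht.1]
    exact (h.integrable.congr_fun (fun r hr => (hcongr r hr).symm) measurableSet_Icc).mono_set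
      (Icc_subset_Icc_right ht.2)
  · rw [h.eq_integral u (hsub hu)]
    congr 1
    refine intervalIntegral.integral_congr fun r hr => (hcongr r ?_).symm
    exact hsub (uIcc_subset_uIcc_left hu hr)

lemma transition_eq_phi (v : VelocityL2 V) {s t : ℝ} (hs : s ∈ Icc (0 : ℝ) 1)
    (ht : t ∈ Icc (0 : ℝ) 1) : transition v s t = phi v s t := by
  funext x
  rw [transition, hV.flow_eq_phi v hs, hV.flow_eq_phi v ht, hV.invFun_phi, Function.comp_apply,
    hV.phi_phi]

/-- The determinant is nonzero by the cocycle identity, equals `1` at `t = s`, and is continuous in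
`t`; the intermediate value theorem excludes a change of sign. This is why no absolute value appears
in `jacComp`. -/
lemma det_jac_pos (v : VelocityL2 V) (s t : ℝ) (x : Space n) : 0 < (jac v s t x).det := by
  have hne : ∀ t, (jac v s t x).det ≠ 0 := by
    intro t h
    have h1 := congrArg ContinuousLinearMap.det (hV.jac_comp_jac v s t s x)
    rw [hV.jac_self] at h1
    have h2 : ((jac v t s (phi v s t x)).comp (jac v s t x)).det
        = (jac v t s (phi v s t x)).det * (jac v s t x).det := LinearMap.det_comp _ _
    have h3 : (ContinuousLinearMap.id ℝ (Space n)).det = 1 := LinearMap.det_id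
    rw [h2, h, mul_zero, h3] at h1
    exact one_ne_zero h1.symm
  by_contra hneg
  have hc : Continuous fun t => (jac v s t x).det := by
    have := (hV.continuous_lin v (clamp s) x).comp continuous_clamp
    exact ContinuousLinearMap.continuous_det.comp this
  obtain ⟨r, hr⟩ := mem_range_of_exists_le_of_exists_ge hc ⟨t, not_lt.1 hneg⟩
    ⟨s, by
      rw [hV.jac_self]
      have h3 : (ContinuousLinearMap.id ℝ (Space n)).det = 1 := LinearMap.det_id
      rw [h3]
      exact zero_le_one⟩
  exact hne r hr

end IsAdmissibleWith

lemma exists_abs_det_le (n : ℕ) (M : ℝ) :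
    ∃ K : ℝ, 0 < K ∧ ∀ A : Space n →L[ℝ] Space n, ‖A‖ ≤ M → |A.det| ≤ K := by
  obtain ⟨K, hK⟩ := (isCompact_closedBall (0 : Space n →L[ℝ] Space n) M).exists_bound_of_continuousOn
    (f := fun A => A.det) ContinuousLinearMap.continuous_det.continuousOn
  refine ⟨max K 1, lt_of_lt_of_le one_pos (le_max_right _ _), fun A hA => ?_⟩
  exact (hK A (by simpa using hA)).trans (le_max_left _ _)

end FlowMap

/-! ### Derivative of the flow with respect to the velocity field. -/

section Variation

variable {n : ℕ} {Ω : Set (Space n)} {V : Type*} [NormedAddCommGroup V] [InnerProductSpace ℝ V]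
  [RKHS ℝ V (Space n) (Space n)] {C : ℝ}

/-- The perturbation at time `t` of the trajectory through `x` at time `s`, caused by a velocity
`u` at time `q`. -/
def transport (v : VelocityL2 V) (s t q : ℝ) (x : Space n) (u : V) : Space n :=
  jac v q t (phi v s q x) (u (phi v s q x))

/-- The derivative of the flow map `φ_{s,t}^v` with respect to `v` in the direction `w`. -/
def variation (v w : VelocityL2 V) (s t : ℝ) (x : Space n) : Space n :=
  ∫ q in s..t, transport v s t q x (extend w q)

/-- A bound for the dependence of `transport` on the velocity field. -/
def transportDist (C : ℝ) (v v' : VelocityL2 V) : ℝ :=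
  stab C v * (stab C v' * (C * ‖v' - v‖ + totalModulus v
    (stab C v * (stab C v * (C * ‖v' - v‖) + C * ‖v' - v‖)))) * C
  + stab C v * (C * (stab C v * (C * ‖v' - v‖)))

lemma variation_smul (v w : VelocityL2 V) (s t : ℝ) (x : Space n) (c : ℝ) :
    variation v (c • w) s t x = c • variation v w s t x := by
  rw [variation, variation, ← intervalIntegral.integral_smul]
  refine intervalIntegral.integral_congr_ae ?_
  filter_upwards [extend_smul c w] with q hq _
  rw [hq, transport, transport, RKHS.coe_smul, Pi.smul_apply, map_smul]

variable (hV : IsAdmissibleWith Ω V C)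

namespace IsAdmissibleWith

include hV

lemma norm_transport_le (v : VelocityL2 V) (s t q : ℝ) (x : Space n) (u : V) :
    ‖transport v s t q x u‖ ≤ stab C v * (C * ‖u‖) :=
  (ContinuousLinearMap.le_opNorm _ _).trans
    (mul_le_mul (hV.norm_jac_le _ _ _ _) (hV.norm_le _ _) (norm_nonneg _) (stab_pos C v).le)

lemma continuous_phi_comp {α : Type*} [TopologicalSpace α] {v : α → VelocityL2 V} {s t : α → ℝ}
    {x : α → Space n} (hv : Continuous v) (hs : Continuous s) (ht : Continuous t)
    (hx : Continuous x) : Continuous fun a => phi (v a) (s a) (t a) (x a) := by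
  have h : Continuous fun a => ((v a, s a, t a), x a) := by fun_prop
  have h' := Continuous.comp hV.continuous_phi h
  exact h'

lemma continuous_jac_comp {α : Type*} [TopologicalSpace α] {v : α → VelocityL2 V} {s t : α → ℝ}
    {x : α → Space n} (hv : Continuous v) (hs : Continuous s) (ht : Continuous t)
    (hx : Continuous x) : Continuous fun a => jac (v a) (s a) (t a) (x a) := by
  have h : Continuous fun a => ((v a, s a, t a), x a) := by fun_prop
  have h' := Continuous.comp hV.continuous_jac h
  exact h'

lemma continuous_transport {α : Type*} [TopologicalSpace α] {v : α → VelocityL2 V} {s q : α → ℝ}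
    {x : α → Space n} {u : α → V} (t : ℝ) (hv : Continuous v) (hs : Continuous s)
    (hq : Continuous q) (hx : Continuous x) (hu : Continuous u) :
    Continuous fun a => transport (v a) (s a) t (q a) (x a) (u a) := by
  have hphi := hV.continuous_phi_comp hv hs hq hx
  have hjac := hV.continuous_jac_comp hv hq continuous_const hphi (t := fun _ => t)
  have h : Continuous fun a => (u a, phi (v a) (s a) (q a) (x a)) := by fun_prop
  have hev := Continuous.comp hV.continuous_eval h
  exact hjac.clm_apply hev

lemma norm_transport_sub_le (v v' : VelocityL2 V) (s t q : ℝ) (x : Space n) (u : V) :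
    ‖transport v' s t q x u - transport v s t q x u‖ ≤ transportDist C v v' * ‖u‖ := by
  have hC := hV.pos
  set y := phi v s q x
  set y' := phi v' s q x
  have h0 : ‖y' - y‖ ≤ stab C v * (C * ‖v' - v‖) := by
    simpa using hV.norm_phi_sub_le v v' x x s q
  have hmono : totalModulus v (stab C v * (‖y' - y‖ + C * ‖v' - v‖)) ≤ totalModulus v
      (stab C v * (stab C v * (C * ‖v' - v‖) + C * ‖v' - v‖)) := by
    refine integral_mono (hV.integrable_modulus v _) (hV.integrable_modulus v _) fun r => ?_
    refine Real.iSup_le (fun p => hV.le_modulus _ (p.2.trans ?_)) (modulus_nonneg _ _)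
    have := stab_pos C v
    gcongr
  have h1 : ‖jac v' q t y' - jac v q t y‖ ≤ stab C v * (stab C v' * (C * ‖v' - v‖ + totalModulus v
      (stab C v * (stab C v * (C * ‖v' - v‖) + C * ‖v' - v‖)))) := by
    refine (hV.norm_jac_sub_le v v' y y' q t).trans ?_
    have := stab_pos C v
    have := stab_pos C v'
    gcongr
  have h2 : transport v' s t q x u - transport v s t q x u
      = (jac v' q t y' - jac v q t y) (u y') + jac v q t y (u y' - u y) := by
    simp only [transport, sub_apply, map_sub]
    abel
  have h3 : ‖(jac v' q t y' - jac v q t y) (u y')‖ ≤ stab C v * (stab C v' * (C * ‖v' - v‖ +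
      totalModulus v (stab C v * (stab C v * (C * ‖v' - v‖) + C * ‖v' - v‖)))) * (C * ‖u‖) :=
    (ContinuousLinearMap.le_opNorm _ _).trans
      (mul_le_mul h1 (hV.norm_le _ _) (norm_nonneg _) ((norm_nonneg _).trans h1))
  have h4 : ‖jac v q t y (u y' - u y)‖
      ≤ stab C v * (C * ‖u‖ * (stab C v * (C * ‖v' - v‖))) :=
    (ContinuousLinearMap.le_opNorm _ _).trans
      (mul_le_mul (hV.norm_jac_le _ _ _ _) ((hV.lipschitz _ _ _).trans
        (mul_le_mul_of_nonneg_left h0 (by positivity))) (norm_nonneg _) (stab_pos C v).le)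
  rw [h2]
  refine (norm_add_le _ _).trans ((add_le_add h3 h4).trans (le_of_eq ?_))
  unfold transportDist
  ring

lemma tendsto_transportDist (v : VelocityL2 V) :
    Tendsto (transportDist C v) (𝓝 v) (𝓝 0) := by
  have hv0 : Tendsto (fun v' => C * ‖v' - v‖) (𝓝 v) (𝓝 0) := by
    have : Continuous fun v' : VelocityL2 V => C * ‖v' - v‖ := by fun_prop
    simpa using this.tendsto v
  have h1 : Tendsto (fun v' => stab C v * (stab C v * (C * ‖v' - v‖) + C * ‖v' - v‖)) (𝓝 v)
      (𝓝 0) := by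
    simpa using ((hv0.const_mul (stab C v)).add hv0).const_mul (stab C v)
  have h2 := (hV.tendsto_totalModulus v).comp h1
  have h3 := (continuous_stab C (V := V)).tendsto v
  have h4 := (((h3.mul (hv0.add h2)).const_mul (stab C v)).mul_const C).add
    (((hv0.const_mul (stab C v)).const_mul C).const_mul (stab C v))
  simp only [add_zero, mul_zero, zero_mul] at h4
  exact h4

lemma stronglyMeasurable_transport (v w : VelocityL2 V) (s t : ℝ) (x : Space n) :
    StronglyMeasurable fun q => transport v s t q x (extend w q) := by
  have h : Continuous fun p : ℝ × V => transport v s t p.1 x p.2 :=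
    hV.continuous_transport t continuous_const continuous_const continuous_fst continuous_const
      continuous_snd
  have h2 : StronglyMeasurable fun q : ℝ => (q, extend w q) :=
    stronglyMeasurable_id.prodMk (stronglyMeasurable_extend w)
  have h3 := h.comp_stronglyMeasurable h2
  exact h3

lemma integrable_transport (v w : VelocityL2 V) (s t : ℝ) (x : Space n) :
    Integrable fun q => transport v s t q x (extend w q) :=
  (((integrable_norm_extend w).const_mul C).const_mul (stab C v)).mono'
    (hV.stronglyMeasurable_transport v w s t x).aestronglyMeasurable
    (Eventually.of_forall fun _ => hV.norm_transport_le _ _ _ _ _ _)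

/-- Variation of constants: `ζ(u) = Dφ_{s,u} ∫_s^u a(q) dq`, where `a(q)` is the perturbation `w(q)`
carried back to time `s`, solves the inhomogeneous linearised equation. The linearisation estimate
then applies with `z = 0`. -/
lemma norm_phi_add_sub_sub_variation_le (v w : VelocityL2 V) {s t : ℝ} (hs : s ∈ Icc (0 : ℝ) 1)
    (ht : t ∈ Icc (0 : ℝ) 1) (x : Space n) :
    ‖phi (v + w) s t x - phi v s t x - variation v w s t x‖ ≤
      stab C v * ((totalModulus v (stab C v * (C * ‖w‖)) + C * ‖w‖)
        * (stab C v * (C * ‖w‖))) := by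
  have hmem : ∀ r ∈ uIcc s t, r ∈ Icc (0 : ℝ) 1 := fun r hr => uIcc_subset_Icc hs ht hr
  set γ := traj v s x with hγ
  have hphi : ∀ r ∈ uIcc s t, phi v s r x = γ r := fun r hr => by
    rw [phi, clamp_of_mem hs, clamp_of_mem (hmem r hr)]
  have hjac : ∀ r ∈ uIcc s t, jac v s r x = lin v s x r := fun r hr => by
    rw [jac, clamp_of_mem hs, clamp_of_mem (hmem r hr)]
  set a : ℝ → Space n := fun q => transport v s s q x (extend w q) with ha
  have hai : Integrable a := hV.integrable_transport v w s s x
  let D : ℝ → (Space n →L[ℝ] Space n) := fun r => linField v s x r (lin v s x r)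
  have hDi : ∀ b c, IntervalIntegrable D volume b c := fun b c =>
    (hV.isCaratheodory_linField v s x).intervalIntegrable (hV.isRate v)
      (hV.continuous_lin v s x) b c
  have hlin : ∀ b c, lin v s x c - lin v s x b = ∫ r in b..c, D r := fun b c => by
    rw [(hV.isSolution_lin v s x).2 c, (hV.isSolution_lin v s x).2 b, add_sub_add_left_eq_sub,
      intervalIntegral.integral_interval_sub_left (hDi _ _) (hDi _ _)]
  have haw : ∀ q ∈ uIcc s t, lin v s x q (a q) = (extend w q : V) (γ q) := fun q hq => by
    have h := hV.jac_comp_jac v q s q (phi v s q x)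
    rw [hV.phi_phi_self, hV.jac_self, hjac q hq] at h
    have h' := congrArg (fun L => L ((extend w q : V) (phi v s q x))) h
    simpa [ha, transport, hphi q hq] using h'
  let ζ : ℝ → Space n := fun u => lin v s x u (∫ q in s..u, a q)
  have hζc : Continuous ζ := by
    have h1 := hV.continuous_lin v s x
    have h2 : Continuous fun u => ∫ q in s..u, a q :=
      intervalIntegral.continuous_primitive (fun _ _ => hai.intervalIntegrable) s
    exact h1.clm_apply h2
  have hζ : ∀ u ∈ uIcc s t, ζ u = 0 + ∫ r in s..u, (fderiv ℝ (⇑(extend v r : V)) (γ r) (ζ r)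
      + (extend w r : V) (γ r)) := by
    intro u hu
    have hsub : uIcc s u ⊆ uIcc s t := uIcc_subset_uIcc_left hu
    -- The integral equation for `ζ` is checked without differentiating: write `Dv(ζ)` as a double
    -- integral over a triangle, exchange the order, and evaluate the inner integral by the integral
    -- equation of `lin`.
    have h1 : ∀ r, fderiv ℝ (⇑(extend v r : V)) (γ r) (ζ r) = ∫ q in s..r, D r (a q) := fun r => by
      rw [ContinuousLinearMap.intervalIntegral_comp_comm _ hai.intervalIntegrable]
      rfl
    have h2 : ∀ q ∈ uIcc s u, ∫ r in q..u, D r (a q)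
        = lin v s x u (a q) - (extend w q : V) (γ q) := fun q hq => by
      rw [← ContinuousLinearMap.intervalIntegral_apply (hDi _ _), ← hlin q u,
        sub_apply, haw q (hsub hq)]
    have hw := hV.intervalIntegrable_eval w (hV.continuous_traj v s x) s u
    have hla : IntervalIntegrable (fun q => lin v s x u (a q)) volume s u :=
      ((lin v s x u).integrable_comp hai).intervalIntegrable
    have hprod : IntegrableOn (Function.uncurry fun r q => D r (a q)) (uIoc s u ×ˢ uIoc s u) := by
      have hp : (volume : Measure (ℝ × ℝ)).restrict (uIoc s u ×ˢ uIoc s u)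
          = (volume.restrict (uIoc s u)).prod (volume.restrict (uIoc s u)) := by
        rw [Measure.prod_restrict]; rfl
      rw [IntegrableOn, hp]
      exact Integrable.op_fst_snd (op := fun (L : Space n →L[ℝ] Space n) (z : Space n) => L z)
        (by fun_prop) ⟨1, fun L z => by rw [one_mul]; exact L.le_opNorm z⟩
        (intervalIntegrable_iff.1 (hDi s u)) hai.integrableOn
    have h3 : IntervalIntegrable (fun r => fderiv ℝ (⇑(extend v r : V)) (γ r) (ζ r))
        volume s u := by
      have hb := (hDi s u)
      have : IntervalIntegrable (fun r => ‖D r‖ * ‖∫ q in s..r, a q‖) volume s u := by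
        refine hb.norm.mul_continuousOn (Continuous.continuousOn ?_)
        exact (intervalIntegral.continuous_primitive (fun _ _ => hai.intervalIntegrable) s).norm
      refine this.mono_fun ?_ (Eventually.of_forall fun r => ?_)
      · have hc : Continuous fun p : (Space n →L[ℝ] Space n) × Space n => p.1 p.2 := by fun_prop
        exact (hc.comp_stronglyMeasurable ((hV.aestronglyMeasurable_fderiv v
          (hV.continuous_traj v s x)).prodMk hζc.stronglyMeasurable)).aestronglyMeasurable
      · change ‖D r (∫ q in s..r, a q)‖ ≤ ‖‖D r‖ * ‖∫ q in s..r, a q‖‖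
        rw [norm_mul, norm_norm, norm_norm]
        exact (D r).le_opNorm _
    rw [zero_add, intervalIntegral.integral_add h3 hw]
    simp_rw [h1]
    rw [integral_integral_triangle hprod, intervalIntegral.integral_congr h2,
      intervalIntegral.integral_sub hla hw,
      ContinuousLinearMap.intervalIntegral_comp_comm _ hai.intervalIntegrable]
    simp [ζ]
  have hst : |t - s| ≤ 1 := by rw [abs_le]; constructor <;> linarith [hs.1, hs.2, ht.1, ht.2]
  have key := hV.norm_traj_add_sub_sub_le v w x 0 hst hζc.continuousOn hζ
  -- Carrying `w(q)` back to time `s` and then forward to `t` is the same as carrying it directly to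
  -- `t`.
  have hvar : variation v w s t x = ζ t := by
    change _ = lin v s x t (∫ q in s..t, a q)
    rw [← ContinuousLinearMap.intervalIntegral_comp_comm _ hai.intervalIntegrable, variation]
    refine intervalIntegral.integral_congr fun q hq => ?_
    have h := hV.jac_comp_jac v q s t (phi v s q x)
    rw [hV.phi_phi_self, hjac t right_mem_uIcc] at h
    have h' := congrArg (fun L => L ((extend w q : V) (phi v s q x))) h
    exact h'.symm
  rw [norm_zero, zero_add, add_zero] at key
  have e1 : ∀ v : VelocityL2 V, phi v s t x = traj v s x t := fun v => by
    rw [phi, clamp_of_mem hs, clamp_of_mem ht]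
  rw [e1, e1, hvar]
  exact key

lemma norm_variation_le (v w : VelocityL2 V) (s t : ℝ) (x : Space n) :
    ‖variation v w s t x‖ ≤ stab C v * (C * ‖w‖) := by
  have hi := ((integrable_norm_extend w).const_mul C).const_mul (stab C v)
  refine (intervalIntegral.norm_integral_le_abs_of_norm_le
    (Eventually.of_forall fun q => hV.norm_transport_le v s t q x (extend w q))
    hi.intervalIntegrable).trans ((abs_intervalIntegral_le_integral hi (fun r =>
      mul_nonneg (stab_pos C v).le (mul_nonneg hV.pos.le (norm_nonneg _))) _ _).trans ?_)
  rw [integral_const_mul, integral_const_mul]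
  have := stab_pos C v
  have := hV.pos
  have := integral_norm_extend_le w
  gcongr

/-- The flow map is differentiable along lines of velocity fields. -/
lemma hasDerivAt_phi (v w : VelocityL2 V) {s t : ℝ} (hs : s ∈ Icc (0 : ℝ) 1)
    (ht : t ∈ Icc (0 : ℝ) 1) (x : Space n) (e : ℝ) :
    HasDerivAt (fun e : ℝ => phi (v + e • w) s t x) (variation (v + e • w) w s t x) e := by
  rw [hasDerivAt_iff_isLittleO_nhds_zero, Asymptotics.isLittleO_iff]
  intro c hc
  set v₁ := v + e • w
  set κ := stab C v₁
  have h1 : Tendsto (fun h : ℝ => κ * ((totalModulus v₁ (κ * (C * (|h| * ‖w‖))) + C * (|h| * ‖w‖))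
      * (κ * (C * ‖w‖)))) (𝓝 0) (𝓝 0) := by
    have h2 : Tendsto (fun h : ℝ => C * (|h| * ‖w‖)) (𝓝 0) (𝓝 0) := by
      have : Continuous fun h : ℝ => C * (|h| * ‖w‖) := by fun_prop
      simpa using this.tendsto 0
    have h3 := (hV.tendsto_totalModulus v₁).comp (by simpa using h2.const_mul κ :
      Tendsto (fun h : ℝ => κ * (C * (|h| * ‖w‖))) (𝓝 0) (𝓝 0))
    simpa using ((h3.add h2).mul_const (κ * (C * ‖w‖))).const_mul κ
  filter_upwards [h1.eventually (gt_mem_nhds hc)] with h hh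
  have key := hV.norm_phi_add_sub_sub_variation_le v₁ (h • w) hs ht x
  rw [variation_smul, norm_smul, Real.norm_eq_abs] at key
  have e1 : v + (e + h) • w = v₁ + h • w := by rw [add_smul, ← add_assoc]
  rw [e1]
  refine key.trans ?_
  calc κ * ((totalModulus v₁ (κ * (C * (|h| * ‖w‖))) + C * (|h| * ‖w‖)) * (κ * (C * (|h| * ‖w‖))))
      = κ * ((totalModulus v₁ (κ * (C * (|h| * ‖w‖))) + C * (|h| * ‖w‖)) * (κ * (C * ‖w‖)))
        * |h| := by ring
    _ ≤ c * |h| := by gcongr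
    _ = _ := by rw [Real.norm_eq_abs]

end IsAdmissibleWith

end Variation

/-! ### Composition with the flow on `L²(Ω)`, and its adjoint. -/

section Composition

variable {n : ℕ} {Ω : Set (Space n)} {V : Type*} [NormedAddCommGroup V] [InnerProductSpace ℝ V]
  [RKHS ℝ V (Space n) (Space n)] {C : ℝ} {E : Type*} [NormedAddCommGroup E]

variable (hV : IsAdmissibleWith Ω V C) (hΩ : MeasurableSet Ω)

namespace IsAdmissibleWith

include hV

lemma continuous_phi_right (v : VelocityL2 V) (s t : ℝ) : Continuous (phi v s t) :=
  hV.continuous_phi_comp continuous_const continuous_const continuous_const continuous_id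

lemma continuous_jac_right (v : VelocityL2 V) (s t : ℝ) : Continuous (jac v s t) :=
  hV.continuous_jac_comp continuous_const continuous_const continuous_const continuous_id

lemma image_phi (v : VelocityL2 V) (s t : ℝ) (S : Set (Space n)) :
    phi v s t '' S = phi v t s ⁻¹' S :=
  congrFun (Set.image_eq_preimage_of_inverse (fun x => hV.phi_phi_self v s t x)
    (fun x => hV.phi_phi_self v t s x)) S

lemma geomAct_transition (v : VelocityL2 V) {t : ℝ} (ht : t ∈ Icc (0 : ℝ) 1)
    (u : Space n → ℝ) : geomAct (transition v 0 t) u = u ∘ phi v t 0 := by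
  rw [geomAct, hV.transition_eq_phi v (left_mem_Icc.2 zero_le_one) ht, hV.invFun_phi]

/-- The compositions converge uniformly, because `g` is uniformly continuous and the flows converge
uniformly. They vanish off a common ball, since a flow moves points by at most `C ‖v'‖`; uniform
convergence on a set of finite measure is enough. -/
lemma tendsto_eLpNorm_comp_phi_sub {g : Space n → E} (hg : Continuous g) (hgc : HasCompactSupport g)
    (v : VelocityL2 V) (s t : ℝ) :
    Tendsto (fun p : VelocityL2 V × ℝ × ℝ =>
      eLpNorm (g ∘ phi p.1 p.2.1 p.2.2 - g ∘ phi v s t) 2 (volume.restrict Ω))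
      (𝓝 (v, s, t)) (𝓝 0) := by
  obtain ⟨ρ, hρ⟩ := hgc.isBounded.subset_closedBall (0 : Space n)
  set B := Metric.closedBall (0 : Space n) (ρ + C * (‖v‖ + 1)) with hB
  have hBm : volume B ≠ ⊤ := measure_closedBall_lt_top.ne
  have hnhds : ∀ᶠ p : VelocityL2 V × ℝ × ℝ in 𝓝 (v, s, t), ‖p.1‖ ≤ ‖v‖ + 1 := by
    have : Continuous fun p : VelocityL2 V × ℝ × ℝ => ‖p.1‖ := by fun_prop
    exact (this.tendsto (v, s, t)).eventually (ge_mem_nhds (by simp))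
  have hout : ∀ v' : VelocityL2 V, ‖v'‖ ≤ ‖v‖ + 1 → ∀ s t, ∀ x ∉ B, g (phi v' s t x) = 0 := by
    intro v' hv' s t x hx
    by_contra hne
    have h1 := hρ (subset_tsupport _ hne)
    rw [mem_closedBall_zero_iff] at h1
    have h2 := hV.norm_phi_sub_self_le v' s t x
    have h3 : C * ‖v'‖ ≤ C * (‖v‖ + 1) := mul_le_mul_of_nonneg_left hv' hV.pos.le
    have h4 := norm_sub_norm_le x (phi v' s t x)
    rw [norm_sub_rev] at h4
    refine hx (mem_closedBall_zero_iff.2 ?_)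
    linarith
  have huc := hg.uniformContinuous_of_tendsto_cocompact hgc.is_zero_at_infty
  have hbound : ∀ η : NNReal, 0 < η → ∀ᶠ p : VelocityL2 V × ℝ × ℝ in 𝓝 (v, s, t),
      eLpNorm (g ∘ phi p.1 p.2.1 p.2.2 - g ∘ phi v s t) 2 (volume.restrict Ω)
        ≤ η * volume B ^ (1 / 2 : ℝ) := by
    intro η hη
    obtain ⟨δ, hδ, hgδ⟩ := Metric.uniformContinuous_iff.1 huc η hη
    filter_upwards [hnhds, (tendsto_phiDist (C := C) v s t).eventually (gt_mem_nhds hδ)]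
      with p hp hpd
    have h1 : ∀ x, ‖(g ∘ phi p.1 p.2.1 p.2.2 - g ∘ phi v s t) x‖ₑ
        ≤ ‖B.indicator (fun _ => (η : ℝ)) x‖ₑ := by
      intro x
      rw [enorm_le_iff_norm_le]
      by_cases hx : x ∈ B
      · rw [indicator_of_mem hx, Pi.sub_apply, Function.comp_apply, Function.comp_apply,
          ← dist_eq_norm, Real.norm_of_nonneg η.coe_nonneg]
        refine (hgδ ?_).le
        rw [dist_eq_norm]
        exact (hV.norm_phi_sub_le_phiDist v s t p x).trans_lt hpd
      · rw [Pi.sub_apply, Function.comp_apply, Function.comp_apply, hout p.1 hp _ _ x hx,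
          hout v (by simp) _ _ x hx]
        simp
    refine (eLpNorm_mono_enorm h1).trans ((eLpNorm_indicator_const_le _ _).trans ?_)
    rw [Real.enorm_of_nonneg η.coe_nonneg, ENNReal.ofReal_coe_nnreal]
    have h2 : (volume.restrict Ω) B ≤ volume B := Measure.restrict_apply_le _ _
    simp only [ENNReal.toReal_ofNat]
    gcongr
  rw [ENNReal.tendsto_nhds_zero]
  intro ε hε
  have hM : volume B ^ (1 / 2 : ℝ) ≠ ⊤ := ENNReal.rpow_ne_top_of_nonneg (by norm_num) hBm
  obtain ⟨η, hη, hle⟩ : ∃ η : NNReal, 0 < η ∧ (η : ENNReal) * volume B ^ (1 / 2 : ℝ) ≤ ε := by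
    rcases eq_or_ne ε ⊤ with rfl | hεt
    · exact ⟨1, one_pos, le_top⟩
    obtain ⟨η, hη, h⟩ := ENNReal.exists_nnreal_pos_mul_lt hM hε.ne'
    exact ⟨η, hη, h.le⟩
  filter_upwards [hbound η hη] with p hp
  exact hp.trans hle

include hΩ

/-- Change of variables with the inverse flow, whose Jacobian determinant is bounded in terms of
`stab C v` alone. Uniformity over `stab C v ≤ M` is what later allows `v` to vary. -/
lemma exists_map_phi_le (M : ℝ) : ∃ K : ℝ, 0 < K ∧ ∀ v : VelocityL2 V, stab C v ≤ M → ∀ s t,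
    Measure.map (phi v s t) (volume.restrict Ω) ≤ ENNReal.ofReal K • volume.restrict Ω := by
  obtain ⟨K, hK0, hK⟩ := exists_abs_det_le n M
  refine ⟨K, hK0, fun v hv s t => Measure.le_iff.2 fun S hS => ?_⟩
  have hm := (hV.continuous_phi_right v s t).measurable
  rw [Measure.map_apply hm hS, Measure.restrict_apply (hm hS), Measure.smul_apply,
    Measure.restrict_apply hS]
  have h1 : phi v s t ⁻¹' S ∩ Ω = phi v t s '' (S ∩ Ω) := by
    rw [hV.image_phi, preimage_inter]
    congr 1
    ext x
    exact (hV.phi_mem_iff v s t).symm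
  rw [h1, ← lintegral_abs_det_fderiv_eq_addHaar_image volume (hS.inter hΩ)
    (fun x _ => (hV.hasFDerivAt_phi v t s x).hasFDerivWithinAt) (hV.bijective_phi v t s).1.injOn]
  calc _ ≤ ∫⁻ _ in S ∩ Ω, ENNReal.ofReal K := by
        refine lintegral_mono fun x => ENNReal.ofReal_le_ofReal (hK _ ?_)
        exact (hV.norm_jac_le v t s x).trans hv
    _ = _ := by simp

lemma quasiMeasurePreserving_phi (v : VelocityL2 V) (s t : ℝ) :
    Measure.QuasiMeasurePreserving (phi v s t) (volume.restrict Ω) (volume.restrict Ω) := by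
  obtain ⟨K, _, hK⟩ := hV.exists_map_phi_le hΩ (stab C v)
  exact ⟨(hV.continuous_phi_right v s t).measurable,
    (Measure.absolutelyContinuous_of_le_smul (hK v le_rfl s t))⟩

lemma memLp_comp_phi {h : Space n → E} (hh : MemLp h 2 (volume.restrict Ω)) (v : VelocityL2 V)
    (s t : ℝ) : MemLp (h ∘ phi v s t) 2 (volume.restrict Ω) := by
  obtain ⟨K, _, hK⟩ := hV.exists_map_phi_le hΩ (stab C v)
  exact (hh.of_measure_le_smul ENNReal.ofReal_ne_top (hK v le_rfl s t)).comp_of_map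
    (hV.continuous_phi_right v s t).aemeasurable

lemma exists_eLpNorm_comp_phi_le (M : ℝ) : ∃ K : ℝ, 0 < K ∧ ∀ v : VelocityL2 V, stab C v ≤ M →
    ∀ s t, ∀ h : Space n → E, MemLp h 2 (volume.restrict Ω) →
      eLpNorm (h ∘ phi v s t) 2 (volume.restrict Ω)
        ≤ ENNReal.ofReal K * eLpNorm h 2 (volume.restrict Ω) := by
  obtain ⟨K, hK0, hK⟩ := hV.exists_map_phi_le hΩ M
  refine ⟨K ^ (1 / 2 : ℝ), by positivity, fun v hv s t h hh => ?_⟩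
  have hm := (hV.continuous_phi_right v s t).aemeasurable (μ := volume.restrict Ω)
  have h1 := (hh.of_measure_le_smul ENNReal.ofReal_ne_top (hK v hv s t)).aestronglyMeasurable
  rw [← eLpNorm_map_measure h1 hm]
  refine (eLpNorm_mono_measure h (hK v hv s t)).trans (le_of_eq ?_)
  rw [eLpNorm_smul_measure_of_ne_top ENNReal.ofNat_ne_top, smul_eq_mul,
    ENNReal.ofReal_rpow_of_pos hK0]
  norm_num

variable [NormedSpace ℝ E]

/-- Composition with the flow map `φ_{s,t}^v` on `L²(Ω)`. -/
def pull (v : VelocityL2 V) (s t : ℝ) :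
    Lp E 2 (volume.restrict Ω) →L[ℝ] Lp E 2 (volume.restrict Ω) :=
  LinearMap.mkContinuousOfExistsBound
    { toFun := fun F => (hV.memLp_comp_phi hΩ (Lp.memLp F) v s t).toLp (F ∘ phi v s t)
      map_add' := fun F G => by
        rw [← MemLp.toLp_add]
        refine MemLp.toLp_congr _ _ ?_
        exact (hV.quasiMeasurePreserving_phi hΩ v s t).ae_eq_comp (Lp.coeFn_add F G)
      map_smul' := fun c F => by
        rw [RingHom.id_apply, ← MemLp.toLp_const_smul]
        refine MemLp.toLp_congr _ _ ?_
        exact (hV.quasiMeasurePreserving_phi hΩ v s t).ae_eq_comp (Lp.coeFn_smul c F) }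
    (by
      obtain ⟨K, hK0, hK⟩ := hV.exists_eLpNorm_comp_phi_le hΩ (E := E) (stab C v)
      refine ⟨K, fun F => ?_⟩
      simp only [LinearMap.coe_mk, AddHom.coe_mk]
      rw [Lp.norm_toLp, Lp.norm_def, ← ENNReal.toReal_ofReal hK0.le, ← ENNReal.toReal_mul]
      exact ENNReal.toReal_mono (ENNReal.mul_ne_top ENNReal.ofReal_ne_top (Lp.eLpNorm_ne_top F))
        (hK v le_rfl s t F (Lp.memLp F)))

lemma pull_apply (v : VelocityL2 V) (s t : ℝ) (F : Lp E 2 (volume.restrict Ω)) :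
    hV.pull hΩ v s t F = (hV.memLp_comp_phi hΩ (Lp.memLp F) v s t).toLp (F ∘ phi v s t) := rfl

lemma pull_ae_eq (v : VelocityL2 V) (s t : ℝ) (F : Lp E 2 (volume.restrict Ω)) :
    hV.pull hΩ v s t F =ᵐ[volume.restrict Ω] F ∘ phi v s t :=
  (hV.memLp_comp_phi hΩ (Lp.memLp F) v s t).coeFn_toLp

lemma pull_toLp (v : VelocityL2 V) (s t : ℝ) {h : Space n → E}
    (hh : MemLp h 2 (volume.restrict Ω)) :
    hV.pull hΩ v s t (hh.toLp h) = (hV.memLp_comp_phi hΩ hh v s t).toLp (h ∘ phi v s t) := by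
  rw [pull_apply]
  exact MemLp.toLp_congr _ _ ((hV.quasiMeasurePreserving_phi hΩ v s t).ae_eq_comp hh.coeFn_toLp)

lemma exists_norm_pull_le (M : ℝ) : ∃ K : ℝ, 0 < K ∧ ∀ v : VelocityL2 V, stab C v ≤ M →
    ∀ s t, ∀ F : Lp E 2 (volume.restrict Ω), ‖hV.pull hΩ v s t F‖ ≤ K * ‖F‖ := by
  obtain ⟨K, hK0, hK⟩ := hV.exists_eLpNorm_comp_phi_le hΩ (E := E) M
  refine ⟨K, hK0, fun v hv s t F => ?_⟩
  rw [pull_apply, Lp.norm_toLp, Lp.norm_def, ← ENNReal.toReal_ofReal hK0.le, ← ENNReal.toReal_mul]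
  exact ENNReal.toReal_mono (ENNReal.mul_ne_top ENNReal.ofReal_ne_top (Lp.eLpNorm_ne_top F))
    (hK v hv s t F (Lp.memLp F))

/-- Strong continuity only, for a fixed image: approximate it by a compactly supported continuous
function and use the locally uniform operator bound. -/
lemma continuous_pull (F : Lp E 2 (volume.restrict Ω)) :
    Continuous fun p : VelocityL2 V × ℝ × ℝ => hV.pull hΩ p.1 p.2.1 p.2.2 F := by
  rw [continuous_iff_continuousAt]
  rintro ⟨v, s, t⟩
  rw [ContinuousAt, tendsto_iff_norm_sub_tendsto_zero]
  obtain ⟨K, hK0, hK⟩ := hV.exists_norm_pull_le hΩ (E := E) (stab C v + 1)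
  have hnhds : ∀ᶠ p : VelocityL2 V × ℝ × ℝ in 𝓝 (v, s, t), stab C p.1 ≤ stab C v + 1 := by
    have h := continuous_stab C (V := V)
    have : Continuous fun p : VelocityL2 V × ℝ × ℝ => stab C p.1 := by fun_prop
    exact (this.tendsto (v, s, t)).eventually (ge_mem_nhds (by simp))
  rw [Metric.tendsto_nhds]
  intro ε hε
  -- With tolerance `ε / (4 K)`, each of the three terms below costs `ε / 4`.
  obtain ⟨g, hgc, hgF, hg, hgm⟩ := (Lp.memLp F).exists_hasCompactSupport_eLpNorm_sub_le
    ENNReal.ofNat_ne_top (ε := ENNReal.ofReal (ε / (4 * K)))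
    (by rw [Ne, ENNReal.ofReal_eq_zero, not_le]; positivity)
  have hFg : ‖F - hgm.toLp g‖ ≤ ε / (4 * K) := by
    have h1 : F - hgm.toLp g = ((Lp.memLp F).sub hgm).toLp (⇑F - g) := by
      rw [MemLp.toLp_sub (Lp.memLp F) hgm, Lp.toLp_coeFn]
    rw [h1, Lp.norm_toLp]
    exact ENNReal.toReal_le_of_le_ofReal (by positivity) hgF
  have h2 := (hV.tendsto_eLpNorm_comp_phi_sub hg hgc v s t).eventually
    (gt_mem_nhds (ENNReal.ofReal_pos.2 (by positivity : 0 < ε / 4)))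
  filter_upwards [hnhds, h2] with p hp hp2
  rw [Real.dist_eq, sub_zero, abs_norm]
  have h3 : ‖hV.pull hΩ p.1 p.2.1 p.2.2 (hgm.toLp g) - hV.pull hΩ v s t (hgm.toLp g)‖ ≤ ε / 4 := by
    rw [pull_toLp, pull_toLp, ← MemLp.toLp_sub, Lp.norm_toLp]
    exact ENNReal.toReal_le_of_le_ofReal (by positivity) hp2.le
  have h4 := (hK p.1 hp p.2.1 p.2.2 (F - hgm.toLp g)).trans
    (mul_le_mul_of_nonneg_left hFg hK0.le)
  have h5 := (hK v (by simp) s t (F - hgm.toLp g)).trans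
    (mul_le_mul_of_nonneg_left hFg hK0.le)
  have h6 : K * (ε / (4 * K)) = ε / 4 := by field_simp
  rw [h6, map_sub] at h4 h5
  calc ‖hV.pull hΩ p.1 p.2.1 p.2.2 F - hV.pull hΩ v s t F‖
      = ‖(hV.pull hΩ p.1 p.2.1 p.2.2 F - hV.pull hΩ p.1 p.2.1 p.2.2 (hgm.toLp g))
        + (hV.pull hΩ p.1 p.2.1 p.2.2 (hgm.toLp g) - hV.pull hΩ v s t (hgm.toLp g))
        - (hV.pull hΩ v s t F - hV.pull hΩ v s t (hgm.toLp g))‖ := by congr 1; abel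
    _ ≤ ε / 4 + ε / 4 + ε / 4 :=
        (norm_sub_le _ _).trans (add_le_add ((norm_add_le _ _).trans (add_le_add h4 h3)) h5)
    _ < ε := by linarith

end IsAdmissibleWith

lemma toL2_of_memLp {u : Space n → ℝ} (hu : MemLp u 2 (volume.restrict Ω)) :
    toL2 Ω u = hu.toLp u := by
  rw [toL2, dif_pos hu]

namespace IsAdmissibleWith

include hV hΩ

lemma deformed_eq (v : VelocityL2 V) {t : ℝ} (ht : t ∈ Icc (0 : ℝ) 1) (F : ImageL2 Ω) :
    deformed v t F = hV.pull hΩ v t 0 F := by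
  rw [deformed, hV.geomAct_transition v ht,
    toL2_of_memLp (hV.memLp_comp_phi hΩ (Lp.memLp F) v t 0)]
  rfl

lemma memLp_jacComp (v : VelocityL2 V) (s t : ℝ) (F : ImageL2 Ω) :
    MemLp (jacComp (phi v s t) F) 2 (volume.restrict Ω) := by
  obtain ⟨K, hK0, hK⟩ := exists_abs_det_le n (stab C v)
  have h1 := hV.memLp_comp_phi hΩ (Lp.memLp F) v s t
  have hc : Continuous fun x => (fderiv ℝ (phi v s t) x).det := by
    simp_rw [hV.fderiv_phi]
    exact ContinuousLinearMap.continuous_det.comp (hV.continuous_jac_right v s t)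
  refine h1.of_le_mul (c := K) (hc.aestronglyMeasurable.mul h1.aestronglyMeasurable)
    (Eventually.of_forall fun x => ?_)
  rw [jacComp, norm_mul, Real.norm_eq_abs, hV.fderiv_phi]
  exact mul_le_mul_of_nonneg_right (hK _ (hV.norm_jac_le _ _ _ _)) (norm_nonneg _)

/-- `u ↦ |Dφ_{s,t}| (u ∘ φ_{s,t})` is adjoint to `h ↦ h ∘ φ_{t,s}`. -/
lemma toL2_jacComp (v : VelocityL2 V) (s t : ℝ) (G : ImageL2 Ω) :
    toL2 Ω (jacComp (phi v s t) G)
      = ContinuousLinearMap.adjoint (hV.pull hΩ v t s : ImageL2 Ω →L[ℝ] ImageL2 Ω) G := by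
  refine ext_inner_right ℝ fun h => ?_
  rw [ContinuousLinearMap.adjoint_inner_left, L2.inner_def, L2.inner_def,
    toL2_of_memLp (hV.memLp_jacComp hΩ v s t G)]
  have h1 : ∫ x in Ω, inner ℝ (G x) ((hV.pull hΩ v t s h : ImageL2 Ω) x)
      = ∫ x in phi v s t '' Ω, G x * h (phi v t s x) := by
    rw [(hV.bijOn_phi v s t).image_eq]
    refine integral_congr_ae ?_
    filter_upwards [hV.pull_ae_eq hΩ v t s h] with x hx
    rw [hx]
    simp [mul_comm]
  rw [h1, integral_image_eq_integral_abs_det_fderiv_smul volume hΩ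
    (fun x _ => (hV.hasFDerivAt_phi v s t x).hasFDerivWithinAt) (hV.bijective_phi v s t).1.injOn]
  refine integral_congr_ae ?_
  filter_upwards [(hV.memLp_jacComp hΩ v s t G).coeFn_toLp] with x hx
  rw [hx, hV.phi_phi_self, abs_of_pos (hV.det_jac_pos v s t x), jacComp, hV.fderiv_phi]
  simp only [RCLike.inner_apply, conj_trivial, smul_eq_mul]
  ring

end IsAdmissibleWith

end Composition

/-! ### Candidate derivative of the deformed image in `L²(Ω)`. -/

section Sensitivity

variable {n : ℕ} {Ω : Set (Space n)} {V : Type*} [NormedAddCommGroup V] [InnerProductSpace ℝ V]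
  [RKHS ℝ V (Space n) (Space n)] {C : ℝ}

lemma memLp_inner_of_bound {h z : Space n → Space n} {M : ℝ}
    (hh : MemLp h 2 (volume.restrict Ω)) (hz : AEStronglyMeasurable z (volume.restrict Ω))
    (hM : ∀ y, ‖z y‖ ≤ M) : MemLp (fun y => inner ℝ (h y) (z y)) 2 (volume.restrict Ω) := by
  refine hh.of_le_mul (c := M) (hh.aestronglyMeasurable.inner hz)
    (Eventually.of_forall fun y => ?_)
  rw [mul_comm]
  exact (norm_inner_le_norm _ _).trans (mul_le_mul_of_nonneg_left (hM y) (norm_nonneg _))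

lemma norm_toL2_inner_le {h z : Space n → Space n} {M : ℝ}
    (hh : MemLp h 2 (volume.restrict Ω)) (hz : AEStronglyMeasurable z (volume.restrict Ω))
    (hM : ∀ y, ‖z y‖ ≤ M) : ‖toL2 Ω (fun y => inner ℝ (h y) (z y))‖ ≤ M * ‖hh.toLp h‖ := by
  rw [toL2_of_memLp (memLp_inner_of_bound hh hz hM)]
  refine Lp.norm_le_mul_norm_of_ae_le_mul ?_
  filter_upwards [(memLp_inner_of_bound hh hz hM).coeFn_toLp, hh.coeFn_toLp] with y hy hy'
  rw [hy, hy', mul_comm]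
  exact (norm_inner_le_norm _ _).trans (mul_le_mul_of_nonneg_left (hM y) (norm_nonneg _))

lemma inner_toL2 {u : Space n → ℝ} (hu : MemLp u 2 (volume.restrict Ω)) (h : ImageL2 Ω) :
    inner ℝ h (toL2 Ω u) = ∫ y in Ω, h y * u y := by
  rw [toL2_of_memLp hu, L2.inner_def]
  refine integral_congr_ae ?_
  filter_upwards [hu.coeFn_toLp] with y hy
  rw [hy]
  simp [mul_comm]

/-- The derivative of the deformed image at time `τ` with respect to the velocity field, in the
direction `w`, where `g` is the gradient of the template. -/
def imageVariation (Ω : Set (Space n)) (g : Space n → Space n) (v w : VelocityL2 V) (τ : ℝ) :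
    ImageL2 Ω :=
  toL2 Ω fun y => inner ℝ (g (phi v τ 0 y)) (variation v w τ 0 y)

/-- The perturbation of the deformed image at time `τ` caused by a velocity `u` at time `q`. -/
def imageTransport (Ω : Set (Space n)) (g : Space n → Space n) (v : VelocityL2 V) (τ q : ℝ)
    (u : V) : ImageL2 Ω :=
  toL2 Ω fun y => inner ℝ (g (phi v τ 0 y)) (transport v τ 0 q y u)

variable (hV : IsAdmissibleWith Ω V C) (hΩ : MeasurableSet Ω)

namespace IsAdmissibleWith

include hV

/-- `transport` is jointly continuous in its parameters and in the velocity `u`; a merely measurable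
`u` is substituted afterwards. This joint measurability feeds the Fubini arguments. -/
lemma stronglyMeasurable_transport_prod {α : Type*} [TopologicalSpace α]
    [TopologicalSpace.PseudoMetrizableSpace α] [SecondCountableTopology α] [MeasurableSpace α]
    [OpensMeasurableSpace α]
    {v : α → VelocityL2 V} {s q : α → ℝ} {u : α → V} (t : ℝ)
    (hv : Continuous v) (hs : Continuous s) (hq : Continuous q) (hu : StronglyMeasurable u) :
    StronglyMeasurable fun p : α × Space n =>
      transport (v p.1) (s p.1) t (q p.1) p.2 (u p.1) := by
  have h : Continuous fun p : (α × Space n) × V =>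
      transport (v p.1.1) (s p.1.1) t (q p.1.1) p.1.2 p.2 :=
    hV.continuous_transport t (by fun_prop) (by fun_prop) (by fun_prop) (by fun_prop)
      (by fun_prop)
  have h2 : StronglyMeasurable fun p : α × Space n => (p, u p.1) :=
    stronglyMeasurable_id.prodMk (hu.comp_measurable measurable_fst)
  have h3 := h.comp_stronglyMeasurable h2
  exact h3

lemma stronglyMeasurable_variation {α : Type*} [TopologicalSpace α]
    [TopologicalSpace.PseudoMetrizableSpace α] [SecondCountableTopology α] [MeasurableSpace α]
    [OpensMeasurableSpace α]
    {v : α → VelocityL2 V} (w : VelocityL2 V) (s t : ℝ) (hv : Continuous v) :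
    StronglyMeasurable fun p : α × Space n => variation (v p.1) w s t p.2 := by
  have h1 := hV.stronglyMeasurable_transport_prod (α := α × ℝ) (v := fun a => v a.1)
    (s := fun _ => s) (q := fun a => a.2) (u := fun a => extend w a.2) t (by fun_prop) (by fun_prop)
    (by fun_prop) ((stronglyMeasurable_extend w).comp_measurable measurable_snd)
  have h2 : StronglyMeasurable (Function.uncurry fun (p : α × Space n) (q : ℝ) =>
      transport (v p.1) s t q p.2 (extend w q)) :=
    h1.comp_measurable (g := fun z : (α × Space n) × ℝ => ((z.1.1, z.2), z.1.2)) (by fun_prop)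
  unfold variation intervalIntegral
  exact h2.integral_prod_right.sub h2.integral_prod_right

lemma stronglyMeasurable_variation_right (v w : VelocityL2 V) (s t : ℝ) :
    StronglyMeasurable fun y => variation v w s t y :=
  (hV.stronglyMeasurable_variation (α := ℝ) w s t continuous_const).comp_measurable
    (g := fun y : Space n => ((0 : ℝ), y)) (by fun_prop)

lemma continuous_transport_right (v : VelocityL2 V) (s t q : ℝ) (u : V) :
    Continuous fun y => transport v s t q y u :=
  hV.continuous_transport t continuous_const continuous_const continuous_const continuous_id
    continuous_const

lemma transportDist_nonneg (v v' : VelocityL2 V) : 0 ≤ transportDist C v v' := by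
  have := hV.pos
  have := stab_pos C v
  have := stab_pos C v'
  unfold transportDist
  have := totalModulus_nonneg v (stab C v * (stab C v * (C * ‖v' - v‖) + C * ‖v' - v‖))
  positivity

lemma norm_variation_sub_le (v v' w : VelocityL2 V) (s t : ℝ) (x : Space n) :
    ‖variation v' w s t x - variation v w s t x‖ ≤ transportDist C v v' * ‖w‖ := by
  have hd := hV.transportDist_nonneg v v'
  have hi := (integrable_norm_extend w).const_mul (transportDist C v v')
  rw [variation, variation, ← intervalIntegral.integral_sub
    (hV.integrable_transport v' w s t x).intervalIntegrable
    (hV.integrable_transport v w s t x).intervalIntegrable]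
  refine (intervalIntegral.norm_integral_le_abs_of_norm_le
    (Eventually.of_forall fun q => hV.norm_transport_sub_le v v' s t q x (extend w q))
    hi.intervalIntegrable).trans ((abs_intervalIntegral_le_integral hi (fun r =>
      mul_nonneg hd (norm_nonneg _)) _ _).trans ?_)
  rw [integral_const_mul]
  exact mul_le_mul_of_nonneg_left (integral_norm_extend_le w) hd

lemma variation_add (v w w' : VelocityL2 V) (s t : ℝ) (x : Space n) :
    variation v (w + w') s t x = variation v w s t x + variation v w' s t x := by
  rw [variation, variation, variation, ← intervalIntegral.integral_add
    (hV.integrable_transport v w s t x).intervalIntegrable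
    (hV.integrable_transport v w' s t x).intervalIntegrable]
  refine intervalIntegral.integral_congr_ae ?_
  filter_upwards [extend_add w w'] with q hq _
  rw [hq, transport, transport, transport, RKHS.coe_add, Pi.add_apply, map_add]

variable {g : Space n → Space n} (hg : MemLp g 2 (volume.restrict Ω))

include hΩ

include hg in
lemma memLp_imageVariation (v w : VelocityL2 V) (τ : ℝ) :
    MemLp (fun y => inner ℝ (g (phi v τ 0 y)) (variation v w τ 0 y)) 2 (volume.restrict Ω) :=
  memLp_inner_of_bound (hV.memLp_comp_phi hΩ hg v τ 0)
    (hV.stronglyMeasurable_variation_right v w τ 0).aestronglyMeasurable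
    (hV.norm_variation_le v w τ 0)

include hg in
lemma memLp_imageTransport (v : VelocityL2 V) (τ q : ℝ) (u : V) :
    MemLp (fun y => inner ℝ (g (phi v τ 0 y)) (transport v τ 0 q y u)) 2 (volume.restrict Ω) :=
  memLp_inner_of_bound (hV.memLp_comp_phi hΩ hg v τ 0)
    (hV.continuous_transport_right v τ 0 q u).aestronglyMeasurable
    (fun y => hV.norm_transport_le v τ 0 q y u)

lemma norm_imageVariation_le (v w : VelocityL2 V) (τ : ℝ) :
    ‖imageVariation Ω g v w τ‖ ≤ stab C v * (C * ‖w‖) * ‖hV.pull hΩ v τ 0 (hg.toLp g)‖ := by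
  rw [pull_toLp]
  exact norm_toL2_inner_le (hV.memLp_comp_phi hΩ hg v τ 0)
    (hV.stronglyMeasurable_variation_right v w τ 0).aestronglyMeasurable
    (hV.norm_variation_le v w τ 0)

lemma norm_imageTransport_le (v : VelocityL2 V) (τ q : ℝ) (u : V) :
    ‖imageTransport Ω g v τ q u‖ ≤ stab C v * (C * ‖u‖) * ‖hV.pull hΩ v τ 0 (hg.toLp g)‖ := by
  rw [pull_toLp]
  exact norm_toL2_inner_le (hV.memLp_comp_phi hΩ hg v τ 0)
    (hV.continuous_transport_right v τ 0 q u).aestronglyMeasurable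
    (fun y => hV.norm_transport_le v τ 0 q y u)

include hg in
lemma imageVariation_add (v w w' : VelocityL2 V) (τ : ℝ) :
    imageVariation Ω g v (w + w') τ = imageVariation Ω g v w τ + imageVariation Ω g v w' τ := by
  rw [imageVariation, imageVariation, imageVariation,
    toL2_of_memLp (hV.memLp_imageVariation hΩ hg v (w + w') τ),
    toL2_of_memLp (hV.memLp_imageVariation hΩ hg v w τ),
    toL2_of_memLp (hV.memLp_imageVariation hΩ hg v w' τ), ← MemLp.toLp_add]
  congr 1
  funext y
  simp only [Pi.add_apply, hV.variation_add, inner_add_right]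

include hg in
lemma imageVariation_smul (v w : VelocityL2 V) (τ c : ℝ) :
    imageVariation Ω g v (c • w) τ = c • imageVariation Ω g v w τ := by
  rw [imageVariation, imageVariation,
    toL2_of_memLp (hV.memLp_imageVariation hΩ hg v (c • w) τ),
    toL2_of_memLp (hV.memLp_imageVariation hΩ hg v w τ), ← MemLp.toLp_const_smul]
  congr 1
  funext y
  simp only [Pi.smul_apply, variation_smul, inner_smul_right, smul_eq_mul]

lemma norm_imageVariation_sub_le (v v' w : VelocityL2 V) (τ : ℝ) :
    ‖imageVariation Ω g v' w τ - imageVariation Ω g v w τ‖ ≤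
      (stab C v' * C * ‖hV.pull hΩ v' τ 0 (hg.toLp g) - hV.pull hΩ v τ 0 (hg.toLp g)‖
        + transportDist C v v' * ‖hV.pull hΩ v τ 0 (hg.toLp g)‖) * ‖w‖ := by
  have hp := hV.memLp_comp_phi hΩ hg v τ 0
  have hp' := hV.memLp_comp_phi hΩ hg v' τ 0
  have hm := (hV.stronglyMeasurable_variation_right v w τ 0).aestronglyMeasurable
    (μ := volume.restrict Ω)
  have hm' := (hV.stronglyMeasurable_variation_right v' w τ 0).aestronglyMeasurable
    (μ := volume.restrict Ω)
  have h1 := norm_toL2_inner_le (M := stab C v' * (C * ‖w‖)) (hp'.sub hp) hm'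
    (hV.norm_variation_le v' w τ 0)
  have h2 := norm_toL2_inner_le (M := transportDist C v v' * ‖w‖)
    hp (hm'.sub hm)
    (hV.norm_variation_sub_le v v' w τ 0)
  have m1 := memLp_inner_of_bound (hp'.sub hp) hm' (hV.norm_variation_le v' w τ 0)
  have m2 := memLp_inner_of_bound hp (hm'.sub hm) (hV.norm_variation_sub_le v v' w τ 0)
  -- The expression is bilinear in the pulled back gradient and the variation. The variation is
  -- bounded and continuous in `v` uniformly in space, so only the gradient factor needs an `L²`
  -- limit.
  have h3 : imageVariation Ω g v' w τ - imageVariation Ω g v w τ =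
      toL2 Ω (fun y => inner ℝ ((g ∘ phi v' τ 0 - g ∘ phi v τ 0) y) (variation v' w τ 0 y))
      + toL2 Ω (fun y => inner ℝ ((g ∘ phi v τ 0) y)
        (variation v' w τ 0 y - variation v w τ 0 y)) := by
    rw [imageVariation, imageVariation, toL2_of_memLp (hV.memLp_imageVariation hΩ hg v' w τ),
      toL2_of_memLp (hV.memLp_imageVariation hΩ hg v w τ), toL2_of_memLp m1]
    erw [toL2_of_memLp m2]
    rw [← MemLp.toLp_sub, ← MemLp.toLp_add]
    congr 1
    funext y
    simp only [Pi.sub_apply, Pi.add_apply, Function.comp_apply, inner_sub_left, inner_sub_right]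
    ring
  rw [h3, pull_toLp, pull_toLp, ← MemLp.toLp_sub]
  refine (norm_add_le _ _).trans ((add_le_add h1 h2).trans (le_of_eq ?_))
  ring

end IsAdmissibleWith

end Sensitivity

/-! ### The deformed image along a segment of velocity fields. -/

section Template

variable {n : ℕ} {Ω : Set (Space n)} {V : Type*} [NormedAddCommGroup V] [InnerProductSpace ℝ V]
  [RKHS ℝ V (Space n) (Space n)] {C : ℝ}

lemma integral_norm_mul_le {u : Space n → ℝ} (hu : MemLp u 2 (volume.restrict Ω))
    (h : ImageL2 Ω) : ∫ y in Ω, ‖h y * u y‖ ≤ ‖h‖ * ‖toL2 Ω u‖ := by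
  have h1 := real_inner_le_norm ((Lp.memLp h).norm.toLp _) (hu.norm.toLp _)
  rw [Lp.norm_toLp, Lp.norm_toLp, eLpNorm_norm, eLpNorm_norm, L2.inner_def] at h1
  rw [toL2_of_memLp hu, Lp.norm_toLp, Lp.norm_def]
  refine le_trans (le_of_eq (integral_congr_ae ?_)) h1
  filter_upwards [(Lp.memLp h).norm.coeFn_toLp, hu.norm.coeFn_toLp] with y hy hy'
  rw [hy, hy', norm_mul]
  simp [mul_comm]

/-- An upper bound for `stab C v` on the ball `‖v‖ ≤ ρ`. -/
def stabBound (C ρ : ℝ) : ℝ := 2 * Real.exp (2 * (C ^ 2 * ρ ^ 2) + 1)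

lemma stab_le_stabBound {v : VelocityL2 V} {ρ : ℝ} (h : ‖v‖ ≤ ρ) : stab C v ≤ stabBound C ρ := by
  unfold stab growth stabBound
  gcongr

lemma norm_add_smul_le {v w : VelocityL2 V} {e : ℝ} (he : e ∈ Icc (0 : ℝ) 1) :
    ‖v + e • w‖ ≤ ‖v‖ + ‖w‖ := by
  refine (norm_add_le _ _).trans ?_
  rw [norm_smul, Real.norm_of_nonneg he.1]
  have := mul_le_of_le_one_left (norm_nonneg w) he.2
  linarith

variable (hV : IsAdmissibleWith Ω V C) {g : Space n → Space n}

namespace IsAdmissibleWith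

include hV

lemma stronglyMeasurable_line (hgm : StronglyMeasurable g) (v w : VelocityL2 V) (τ : ℝ) :
    StronglyMeasurable fun p : ℝ × Space n =>
      inner ℝ (g (phi (v + p.1 • w) τ 0 p.2)) (variation (v + p.1 • w) w τ 0 p.2) := by
  have h1 : Continuous fun p : ℝ × Space n => phi (v + p.1 • w) τ 0 p.2 :=
    hV.continuous_phi_comp (by fun_prop) continuous_const continuous_const continuous_snd
  have h2 := hV.stronglyMeasurable_variation (α := ℝ) (v := fun e => v + e • w) w τ 0 (by fun_prop)
  exact (hgm.comp_measurable h1.measurable).inner h2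

/-- Every flow map pulls null sets back to null sets, so Fubini turns "for every `e`, almost every
`y`" into "for almost every `y`, almost every `e`". Hence a measurable representative may replace
`∇f` along almost every curve `e ↦ φ^{v + e w}(y)`. -/
lemma ae_ae_eq_line (hΩ : MeasurableSet Ω) {g' : Space n → Space n}
    (h : g =ᵐ[volume.restrict Ω] g') (v w : VelocityL2 V) (τ : ℝ) :
    ∀ᵐ y ∂(volume.restrict Ω), ∀ᵐ e : ℝ,
      g (phi (v + e • w) τ 0 y) = g' (phi (v + e • w) τ 0 y) := by
  obtain ⟨S, hS, hSm, hS0⟩ := exists_measurable_superset_of_null h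
  have h1 : Continuous fun p : Space n × ℝ => phi (v + p.2 • w) τ 0 p.1 :=
    hV.continuous_phi_comp (by fun_prop) continuous_const continuous_const continuous_fst
  have h2 : ∀ᵐ e : ℝ, ∀ᵐ y ∂(volume.restrict Ω), phi (v + e • w) τ 0 y ∈ Sᶜ :=
    Eventually.of_forall fun e =>
      (hV.quasiMeasurePreserving_phi hΩ (v + e • w) τ 0).ae (compl_mem_ae_iff.2 hS0)
  have h3 := (Measure.ae_ae_comm (μ := volume.restrict Ω) (ν := (volume : Measure ℝ))
    (p := fun y e => phi (v + e • w) τ 0 y ∈ Sᶜ) (h1.measurable hSm.compl)).2 h2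
  filter_upwards [h3] with y hy
  filter_upwards [hy] with e he
  by_contra hne
  exact he (hS hne)

variable (hΩ : MeasurableSet Ω) (hg : MemLp g 2 (volume.restrict Ω))

include hΩ

lemma exists_norm_imageVariation_le (ρ : ℝ) : ∃ K : ℝ, 0 < K ∧ ∀ v w : VelocityL2 V, ‖v‖ ≤ ρ →
    ∀ τ, ‖imageVariation Ω g v w τ‖ ≤ K * ‖hg.toLp g‖ * ‖w‖ := by
  obtain ⟨K, hK0, hK⟩ := hV.exists_norm_pull_le hΩ (E := Space n) (stabBound C ρ)
  have hC := hV.pos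
  have hB : 0 < stabBound C ρ := by unfold stabBound; positivity
  refine ⟨stabBound C ρ * C * K, by positivity, fun v w hv τ => ?_⟩
  refine (hV.norm_imageVariation_le hΩ hg v w τ).trans ?_
  calc stab C v * (C * ‖w‖) * ‖hV.pull hΩ v τ 0 (hg.toLp g)‖
      ≤ stabBound C ρ * (C * ‖w‖) * (K * ‖hg.toLp g‖) := by
        have := hK v (stab_le_stabBound hv) τ 0 (hg.toLp g)
        have := stab_le_stabBound (C := C) hv
        gcongr
    _ = _ := by ring

include hg in
lemma integrable_line (hgm : StronglyMeasurable g) (v w : VelocityL2 V) (τ : ℝ) (h : ImageL2 Ω) :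
    Integrable (fun p : ℝ × Space n => h p.2 *
      inner ℝ (g (phi (v + p.1 • w) τ 0 p.2)) (variation (v + p.1 • w) w τ 0 p.2))
      ((volume.restrict (Ioc (0 : ℝ) 1)).prod (volume.restrict Ω)) := by
  have hm : StronglyMeasurable (fun p : ℝ × Space n => h p.2 *
      inner ℝ (g (phi (v + p.1 • w) τ 0 p.2)) (variation (v + p.1 • w) w τ 0 p.2)) :=
    ((Lp.stronglyMeasurable h).comp_measurable measurable_snd).mul
      (hV.stronglyMeasurable_line hgm v w τ)
  obtain ⟨K, hK0, hK⟩ := hV.exists_norm_imageVariation_le hΩ hg (‖v‖ + ‖w‖)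
  rw [integrable_prod_iff hm.aestronglyMeasurable]
  refine ⟨Eventually.of_forall fun e =>
    (Lp.memLp h).integrable_mul (hV.memLp_imageVariation hΩ hg (v + e • w) w τ), ?_⟩
  refine Integrable.mono' (g := fun _ => ‖h‖ * (K * ‖hg.toLp g‖ * ‖w‖)) (integrable_const _)
    hm.norm.integral_prod_right.aestronglyMeasurable ?_
  filter_upwards [ae_restrict_mem measurableSet_Ioc] with e he
  rw [Real.norm_of_nonneg (integral_nonneg fun _ => norm_nonneg _)]
  refine (integral_norm_mul_le (hV.memLp_imageVariation hΩ hg (v + e • w) w τ) h).trans ?_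
  exact mul_le_mul_of_nonneg_left (hK _ w (norm_add_smul_le ⟨he.1.le, he.2⟩) τ) (norm_nonneg _)

include hg in
/-- The fundamental theorem of calculus for the deformed image along a line of velocity fields. -/
lemma inner_pull_add_sub (hΩo : IsOpen Ω) (hgm : StronglyMeasurable g) {f₀ : Space n → ℝ}
    (hf₀ : DifferentiableOn ℝ f₀ Ω) (hgf : g =ᵐ[volume.restrict Ω] gradient f₀) {F : ImageL2 Ω}
    (hF : F =ᵐ[volume.restrict Ω] f₀) (v w : VelocityL2 V) {τ : ℝ} (hτ : τ ∈ Icc (0 : ℝ) 1)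
    (h : ImageL2 Ω) :
    inner ℝ h (hV.pull hΩ (v + w) τ 0 F - hV.pull hΩ v τ 0 F)
      = ∫ e in (0 : ℝ)..1, inner ℝ h (imageVariation Ω g (v + e • w) w τ) := by
  have hi := hV.integrable_line hΩ hg hgm v w τ h
  set k : ℝ → Space n → ℝ := fun e y =>
    inner ℝ (g (phi (v + e • w) τ 0 y)) (variation (v + e • w) w τ 0 y) with hk
  have hRHS : ∫ e in (0 : ℝ)..1, inner ℝ h (imageVariation Ω g (v + e • w) w τ)
      = ∫ y in Ω, ∫ e in Ioc (0 : ℝ) 1, h y * k e y := by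
    rw [intervalIntegral.integral_of_le zero_le_one, integral_integral_swap (f := fun y e => h y * k e y) hi.swap]
    refine integral_congr_ae (Eventually.of_forall fun e => ?_)
    exact inner_toL2 (hV.memLp_imageVariation hΩ hg (v + e • w) w τ) h
  rw [hRHS, L2.inner_def]
  refine integral_congr_ae ?_
  filter_upwards [Lp.coeFn_sub (hV.pull hΩ (v + w) τ 0 F) (hV.pull hΩ v τ 0 F),
    hV.pull_ae_eq hΩ (v + w) τ 0 F, hV.pull_ae_eq hΩ v τ 0 F,
    (hV.quasiMeasurePreserving_phi hΩ (v + w) τ 0).ae_eq_comp hF,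
    (hV.quasiMeasurePreserving_phi hΩ v τ 0).ae_eq_comp hF,
    hV.ae_ae_eq_line hΩ hgf v w τ, hi.prod_left_ae, ae_restrict_mem hΩ]
    with y h1 h2 h3 h4 h5 h6 h7 hy
  rw [h1, Pi.sub_apply, h2, h3, h4, h5]
  simp only [RCLike.inner_apply, conj_trivial, Function.comp_apply]
  rw [integral_const_mul, mul_comm]
  -- Fubini gives integrability in `e` only of the product with `h y`; where `h y = 0` both sides
  -- vanish, elsewhere the factor can be divided out.
  rcases eq_or_ne (h y) 0 with h0 | h0
  · rw [h0, zero_mul, zero_mul]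
  congr 1
  have hki : IntervalIntegrable (fun e => k e y) volume 0 1 := by
    rw [intervalIntegrable_iff_integrableOn_Ioc_of_le zero_le_one]
    exact (integrable_const_mul_iff (IsUnit.mk0 _ h0) _).1 h7
  have hae : (fun e => k e y) =ᵐ[volume] fun e : ℝ =>
      inner ℝ (gradient f₀ (phi (v + e • w) τ 0 y)) (variation (v + e • w) w τ 0 y) := by
    filter_upwards [h6] with e he
    rw [hk]
    simp only
    rw [he]
  have hderiv : ∀ e ∈ uIcc (0 : ℝ) 1, HasDerivAt (fun e : ℝ => f₀ (phi (v + e • w) τ 0 y))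
      (inner ℝ (gradient f₀ (phi (v + e • w) τ 0 y)) (variation (v + e • w) w τ 0 y)) e := by
    intro e _
    have hmem : phi (v + e • w) τ 0 y ∈ Ω := (hV.phi_mem_iff _ _ _).2 hy
    have hd : HasGradientAt f₀ (gradient f₀ (phi (v + e • w) τ 0 y)) (phi (v + e • w) τ 0 y) :=
      ((hf₀ _ hmem).differentiableAt (hΩo.mem_nhds hmem)).hasGradientAt
    have := hd.hasFDerivAt.comp_hasDerivAt e
      (hV.hasDerivAt_phi v w hτ (left_mem_Icc.2 zero_le_one) y e)
    simpa [Function.comp_def] using this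
  -- The derivative exists at every `e` and is integrable; this form of the fundamental theorem does
  -- not need it to be continuous.
  have key := intervalIntegral.integral_eq_sub_of_hasDerivAt hderiv
    (hki.congr_ae (ae_restrict_of_ae hae))
  rw [← intervalIntegral.integral_of_le zero_le_one,
    intervalIntegral.integral_congr_ae (hae.mono fun e he _ => he), key]
  simp

end IsAdmissibleWith

end Template

/-! ### Fréchet differentiability of the deformed image. -/

section TemplateDerivative

variable {n : ℕ} {Ω : Set (Space n)} {V : Type*} [NormedAddCommGroup V] [InnerProductSpace ℝ V]
  [RKHS ℝ V (Space n) (Space n)] {C : ℝ}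

/-- The weak identity is tested with `R` itself and divided by `‖R‖`. No measurability of `X` is
needed, so a Bochner integral of the candidate derivatives is avoided. -/
lemma norm_le_of_inner_eq_integral {H : Type*} [NormedAddCommGroup H] [InnerProductSpace ℝ H]
    {R : H} {X : ℝ → H} {B : ℝ} (hB : ∀ e ∈ Icc (0 : ℝ) 1, ‖X e‖ ≤ B)
    (h : inner ℝ R R = ∫ e in (0 : ℝ)..1, inner ℝ R (X e)) : ‖R‖ ≤ B := by
  have h1 : ‖∫ e in (0 : ℝ)..1, inner ℝ R (X e)‖ ≤ ‖R‖ * B * |(1 : ℝ) - 0| := by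
    refine intervalIntegral.norm_integral_le_of_norm_le_const fun e he => ?_
    rw [uIoc_of_le zero_le_one] at he
    exact (norm_inner_le_norm _ _).trans
      (mul_le_mul_of_nonneg_left (hB e ⟨he.1.le, he.2⟩) (norm_nonneg _))
  rw [← h, real_inner_self_eq_norm_sq, sub_zero, abs_one, mul_one, norm_pow, norm_norm, sq] at h1
  rcases (norm_nonneg R).eq_or_lt with h0 | h0
  · rw [← h0]
    exact (norm_nonneg _).trans (hB 0 (left_mem_Icc.2 zero_le_one))
  · exact le_of_mul_le_mul_left h1 h0

variable (hV : IsAdmissibleWith Ω V C) (hΩ : MeasurableSet Ω) {g : Space n → Space n}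
  (hg : MemLp g 2 (volume.restrict Ω))

namespace IsAdmissibleWith

include hV hΩ hg

/-- The derivative of `v ↦ φ_{0,τ}^v . F`, where `g` is the gradient of the image `F`. -/
def imageDeriv (v : VelocityL2 V) (τ : ℝ) : VelocityL2 V →L[ℝ] ImageL2 Ω :=
  LinearMap.mkContinuousOfExistsBound
    { toFun := fun w => imageVariation Ω g v w τ
      map_add' := fun w w' => hV.imageVariation_add hΩ hg v w w' τ
      map_smul' := fun c w => hV.imageVariation_smul hΩ hg v w τ c }
    (by
      obtain ⟨K, _, hK⟩ := hV.exists_norm_imageVariation_le hΩ hg ‖v‖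
      exact ⟨K * ‖hg.toLp g‖, fun w => hK v w le_rfl τ⟩)

lemma imageDeriv_apply (v w : VelocityL2 V) (τ : ℝ) :
    hV.imageDeriv hΩ hg v τ w = imageVariation Ω g v w τ := rfl

lemma intervalIntegrable_inner_imageVariation (hgm : StronglyMeasurable g) (v w : VelocityL2 V)
    (τ : ℝ) (h : ImageL2 Ω) : IntervalIntegrable
      (fun e : ℝ => inner ℝ h (imageVariation Ω g (v + e • w) w τ)) volume 0 1 := by
  rw [intervalIntegrable_iff_integrableOn_Ioc_of_le zero_le_one]
  refine (hV.integrable_line hΩ hg hgm v w τ h).integral_prod_left.congr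
    (Eventually.of_forall fun e => ?_)
  exact (inner_toL2 (hV.memLp_imageVariation hΩ hg (v + e • w) w τ) h).symm

variable (hΩo : IsOpen Ω) (hgm : StronglyMeasurable g) {f₀ : Space n → ℝ}
    (hf₀ : DifferentiableOn ℝ f₀ Ω) (hgf : g =ᵐ[volume.restrict Ω] gradient f₀) {F : ImageL2 Ω}
    (hF : F =ᵐ[volume.restrict Ω] f₀)

include hΩo hgm hf₀ hgf hF

/-- Local Lipschitz continuity with a constant independent of `τ`; it provides the majorant for
differentiating the data term under the time integral. -/
lemma exists_norm_pull_add_sub_le (v : VelocityL2 V) : ∃ K : ℝ, 0 < K ∧ ∀ w : VelocityL2 V,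
    ‖w‖ ≤ 1 → ∀ τ ∈ Icc (0 : ℝ) 1, ‖hV.pull hΩ (v + w) τ 0 F - hV.pull hΩ v τ 0 F‖ ≤ K * ‖w‖ := by
  obtain ⟨K, hK0, hK⟩ := hV.exists_norm_imageVariation_le hΩ hg (‖v‖ + 1)
  refine ⟨K * ‖hg.toLp g‖ + 1, by positivity, fun w hw τ hτ => ?_⟩
  have h1 : ‖hV.pull hΩ (v + w) τ 0 F - hV.pull hΩ v τ 0 F‖ ≤ K * ‖hg.toLp g‖ * ‖w‖ :=
    norm_le_of_inner_eq_integral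
      (fun e he => hK (v + e • w) w ((norm_add_smul_le he).trans (by linarith)) τ)
      (hV.inner_pull_add_sub hΩ hg hΩo hgm hf₀ hgf hF v w hτ _)
  have := norm_nonneg w
  linarith

/-- By the weak fundamental theorem, the remainder is the average over `e` of the candidate
derivative at `v + e w` minus that at `v`. Continuity of the candidate in `v` makes this `o(‖w‖)`.
-/
lemma hasFDerivAt_pull (v : VelocityL2 V) {τ : ℝ} (hτ : τ ∈ Icc (0 : ℝ) 1) :
    HasFDerivAt (fun v => hV.pull hΩ v τ 0 F) (hV.imageDeriv hΩ hg v τ) v := by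
  rw [hasFDerivAt_iff_isLittleO_nhds_zero, Asymptotics.isLittleO_iff]
  intro c hc
  let G := hg.toLp g
  have h1 : Tendsto (fun v' => stab C v' * C * ‖hV.pull hΩ v' τ 0 G - hV.pull hΩ v τ 0 G‖
      + transportDist C v v' * ‖hV.pull hΩ v τ 0 G‖) (𝓝 v) (𝓝 0) := by
    have h2 : Continuous fun v' : VelocityL2 V => hV.pull hΩ v' τ 0 G :=
      (hV.continuous_pull hΩ G).comp (f := fun v' : VelocityL2 V => (v', τ, (0 : ℝ)))
        (by fun_prop)
    have h3 : Tendsto (fun v' => ‖hV.pull hΩ v' τ 0 G - hV.pull hΩ v τ 0 G‖) (𝓝 v) (𝓝 0) := by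
      have h2' := (tendsto_sub_nhds_zero_iff.2 (h2.tendsto v)).norm
      rwa [norm_zero] at h2'
    have h4 := (((continuous_stab C (V := V)).tendsto v).mul_const C).mul h3
    simpa using h4.add ((hV.tendsto_transportDist v).mul_const ‖hV.pull hΩ v τ 0 G‖)
  obtain ⟨δ, hδ, hball⟩ := Metric.eventually_nhds_iff.1 (h1.eventually (gt_mem_nhds hc))
  filter_upwards [Metric.ball_mem_nhds (0 : VelocityL2 V) hδ] with w hw
  rw [mem_ball_zero_iff] at hw
  rw [imageDeriv_apply]
  refine norm_le_of_inner_eq_integral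
    (X := fun e => imageVariation Ω g (v + e • w) w τ - imageVariation Ω g v w τ)
    (fun e he => ?_) ?_
  · refine (hV.norm_imageVariation_sub_le hΩ hg v (v + e • w) w τ).trans
      (mul_le_mul_of_nonneg_right (hball ?_).le (norm_nonneg _))
    rw [dist_eq_norm, add_sub_cancel_left, norm_smul, Real.norm_of_nonneg he.1]
    exact (mul_le_of_le_one_left (norm_nonneg _) he.2).trans_lt hw
  · simp_rw [inner_sub_right _ _ (imageVariation Ω g v w τ)]
    rw [intervalIntegral.integral_sub
      (hV.intervalIntegrable_inner_imageVariation hΩ hg hgm v w τ _) intervalIntegrable_const,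
      hV.inner_pull_add_sub hΩ hg hΩo hgm hf₀ hgf hF v w hτ]
    simp

end IsAdmissibleWith

end TemplateDerivative

/-! ### Weak measurability and separability of `V`. -/

section WeakMeasurability

/-- Pettis' theorem in separable Hilbert spaces: weakly measurable functions are measurable. -/
lemma aestronglyMeasurable_of_inner {α H : Type*} {m : MeasurableSpace α} {μ : Measure α}
    [NormedAddCommGroup H] [InnerProductSpace ℝ H] [SecondCountableTopology H] {G : α → H}
    (h : ∀ u, AEStronglyMeasurable (fun a => inner ℝ (G a) u) μ) : AEStronglyMeasurable G μ := by
  let d := TopologicalSpace.denseSeq H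
  let U : ℕ → Submodule ℝ H := fun k => Submodule.span ℝ (d '' Iic k)
  have : ∀ k, FiniteDimensional ℝ (U k) := fun k =>
    FiniteDimensional.span_of_finite ℝ ((finite_Iic k).image d)
  have hU : Monotone U := fun i j hij => Submodule.span_mono (image_mono (Iic_subset_Iic.2 hij))
  have hd : ⊤ ≤ (⨆ k, U k).topologicalClosure := by
    intro x _
    refine closure_mono ?_ (TopologicalSpace.denseRange_denseSeq H x)
    rintro _ ⟨k, rfl⟩
    exact (le_iSup U k) (Submodule.subset_span ⟨k, mem_Iic.2 le_rfl, rfl⟩)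
  refine aestronglyMeasurable_of_tendsto_ae atTop (f := fun k a => (U k).starProjection (G a))
    (fun k => ?_) (Eventually.of_forall fun a => Submodule.starProjection_tendsto_self U hU _ hd)
  have h1 : (fun a => (U k).starProjection (G a)) = fun a =>
      ∑ i, inner ℝ (G a) (stdOrthonormalBasis ℝ (U k) i : H) •
        (stdOrthonormalBasis ℝ (U k) i : H) := by
    ext1 a
    rw [(stdOrthonormalBasis ℝ (U k)).starProjection_eq_sum_rankOne]
    simp [real_inner_comm]
  rw [h1]
  fun_prop (disch := exact h _)

instance {n : ℕ} (Ω : Set (Space n)) : SecondCountableTopology (ImageL2 Ω) := by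
  have : Fact ((2 : ENNReal) ≠ ⊤) := ⟨ENNReal.ofNat_ne_top⟩
  infer_instance

namespace IsAdmissibleWith

variable {n : ℕ} {Ω : Set (Space n)} {V : Type*} [NormedAddCommGroup V] [InnerProductSpace ℝ V]
  [CompleteSpace V] [RKHS ℝ V (Space n) (Space n)] {C : ℝ} (hV : IsAdmissibleWith Ω V C)

include hV

lemma norm_kerFun_le (x : Space n) : ‖RKHS.kerFun (𝕜 := ℝ) V x‖ ≤ C := by
  rw [← ContinuousLinearMap.adjoint.norm_map]
  refine ContinuousLinearMap.opNorm_le_bound _ hV.pos.le fun u => ?_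
  rw [RKHS.adjoint_kerFun]
  exact hV.norm_le u x

lemma continuous_kerFun : Continuous (RKHS.kerFun (𝕜 := ℝ) V : Space n → Space n →L[ℝ] V) := by
  refine (LipschitzWith.of_dist_le_mul (K := ⟨C, hV.pos.le⟩) fun x y => ?_).continuous
  rw [dist_eq_norm, dist_eq_norm, ← ContinuousLinearMap.adjoint.norm_map, map_sub]
  refine ContinuousLinearMap.opNorm_le_bound _ (mul_nonneg hV.pos.le (norm_nonneg _)) fun u => ?_
  rw [sub_apply, RKHS.adjoint_kerFun, RKHS.adjoint_kerFun]
  refine (hV.lipschitz u x y).trans (le_of_eq ?_)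
  change _ = C * ‖x - y‖ * ‖u‖
  ring

/-- The kernel sections span a dense subspace and form the continuous image of the separable space
`ℝⁿ × ℝⁿ`. This makes Pettis' theorem available for `V`-valued functions. -/
lemma secondCountableTopology : SecondCountableTopology V := by
  have h1 : Continuous fun p : Space n × Space n => RKHS.kerFun (𝕜 := ℝ) V p.1 p.2 :=
    (hV.continuous_kerFun.comp continuous_fst).clm_apply continuous_snd
  have h2 : TopologicalSpace.IsSeparable (univ : Set V) := by
    convert ((TopologicalSpace.isSeparable_range h1).span (R := ℝ)).closure
    have h4 := congrArg (fun S : Submodule ℝ V => (S : Set V))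
      (RKHS.kerFun_dense (𝕜 := ℝ) (X := Space n) (V := Space n) V)
    simp only [Submodule.topologicalClosure_coe, Submodule.top_coe] at h4
    rw [← h4]
    congr 3
    ext
    simp
  have : TopologicalSpace.SeparableSpace V := TopologicalSpace.isSeparable_univ_iff.1 h2
  exact UniformSpace.secondCountable_of_separable V

end IsAdmissibleWith

end WeakMeasurability

/-! ### Differentiation under the integral sign. -/

section ParametricIntegral

/-- Differentiation under the integral sign, where the derivative of the integrand is not assumed to
be measurable. -/
lemma hasFDerivAt_integral_of_weak {α H : Type*} {m : MeasurableSpace α} {μ : Measure α}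
    [NormedAddCommGroup H] [NormedSpace ℝ H] {φ : H → α → ℝ} {φ' : α → H →L[ℝ] ℝ} {L : H →L[ℝ] ℝ}
    {x₀ : H} {bound : α → ℝ} {δ : ℝ} (hδ : 0 < δ)
    (hφ : ∀ x, Integrable (φ x) μ) (hL : ∀ h, L h = ∫ a, φ' a h ∂μ)
    (hb : Integrable bound μ)
    (hlip : ∀ᵐ a ∂μ, ∀ x ∈ Metric.ball x₀ δ, ‖φ x a - φ x₀ a‖ ≤ bound a * ‖x - x₀‖)
    (hd : ∀ᵐ a ∂μ, HasFDerivAt (fun x => φ x a) (φ' a) x₀) :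
    HasFDerivAt (fun x => ∫ a, φ x a ∂μ) L x₀ := by
  have hball := Metric.ball_mem_nhds x₀ hδ
  have hn : ∀ᵐ a ∂μ, ‖φ' a‖ ≤ |bound a| := by
    filter_upwards [hlip, hd] with a h1 h2
    refine h2.le_of_lip' (abs_nonneg _) ?_
    filter_upwards [hball] with x hx
    exact (h1 x hx).trans (mul_le_mul_of_nonneg_right (le_abs_self _) (norm_nonneg _))
  -- Each directional derivative is a limit of difference quotients, so weak measurability of `φ'`
  -- comes for free.
  have hφ' : ∀ h, AEStronglyMeasurable (fun a => φ' a h) μ := fun h => by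
    refine aestronglyMeasurable_of_tendsto_ae atTop
      (f := fun (k : ℕ) a => (k : ℝ) * (φ (x₀ + (k : ℝ)⁻¹ • h) a - φ x₀ a))
      (fun k => ((hφ _).sub (hφ x₀)).aestronglyMeasurable.const_mul _) (hd.mono fun a ha => ?_)
    have h1 := ha.lim h (c := fun k : ℕ => (k : ℝ)) (l := atTop)
      (by simpa using tendsto_natCast_atTop_atTop)
    exact h1
  have hφ'i : ∀ h, Integrable (fun a => φ' a h) μ := fun h =>
    (hb.abs.mul_const ‖h‖).mono' (hφ' h) (hn.mono fun a ha =>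
      ((φ' a).le_opNorm h).trans (mul_le_mul_of_nonneg_right ha (norm_nonneg _)))
  rw [hasFDerivAt_iff_tendsto]
  -- Dominated convergence for the normalised remainder, with majorant `2 |bound a|`: one part from
  -- the Lipschitz condition and one from the bound on `φ' a`.
  have h1 : Tendsto (fun x => ∫ a, ‖x - x₀‖⁻¹ * ‖φ x a - φ x₀ a - φ' a (x - x₀)‖ ∂μ) (𝓝 x₀)
      (𝓝 (∫ _, (0 : ℝ) ∂μ)) := by
    refine tendsto_integral_filter_of_dominated_convergence (fun a => 2 * |bound a|) ?_ ?_
      (hb.abs.const_mul 2) ?_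
    · refine Eventually.of_forall fun x => ?_
      exact ((((hφ x).sub (hφ x₀)).sub
        (hφ'i (x - x₀))).norm.const_mul _).aestronglyMeasurable
    · filter_upwards [hball] with x hx
      filter_upwards [hlip, hn] with a h1 h2
      rw [norm_mul, norm_inv, norm_norm, norm_norm]
      rcases (norm_nonneg (x - x₀)).eq_or_lt with h0 | h0
      · rw [← h0, inv_zero, zero_mul]
        positivity
      · rw [inv_mul_le_iff₀ h0]
        have h3 := h1 x hx
        have h4 := ((φ' a).le_opNorm (x - x₀)).trans (mul_le_mul_of_nonneg_right h2 h0.le)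
        have h5 := norm_sub_le (φ x a - φ x₀ a) (φ' a (x - x₀))
        have h6 := mul_le_mul_of_nonneg_right (le_abs_self (bound a)) h0.le
        linarith
    · exact hd.mono fun a ha => hasFDerivAt_iff_tendsto.1 ha
  rw [integral_zero] at h1
  refine squeeze_zero' (Eventually.of_forall fun x => by positivity) ?_ h1
  refine Eventually.of_forall fun x => ?_
  have h2 : Integrable (fun a => φ x a - φ x₀ a) μ :=
    (hφ x).sub (hφ x₀)
  rw [integral_const_mul, hL, ← integral_sub (hφ x) (hφ x₀),
    ← integral_sub h2 (hφ'i _)]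
  exact mul_le_mul_of_nonneg_left (norm_integral_le_integral_norm _) (by positivity)

end ParametricIntegral

/-! ### Data terms along continuous curves of images. -/

section DataTerm

variable {n : ℕ} {Ω : Set (Space n)} {M : ℝ → ImageL2 Ω → ℝ}

namespace IsDifferentiableDataTerm

variable (hM : IsDifferentiableDataTerm M)

include hM

lemma hasFDerivAt {t : ℝ} (ht : t ∈ Icc (0 : ℝ) 1) (F : ImageL2 Ω) :
    HasFDerivAt (M t) (innerSL ℝ (gradient (M t) F)) F :=
  (hM.differentiable t ht F).hasGradientAt.hasFDerivAt

/-- The local majorants of the gradients are patched over finitely many balls by compactness; it is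
applied to the curve `t ↦ φ_{0,t}.f`. The local Lipschitz bounds come from the mean value inequality
on balls. -/
lemma exists_bound {K : Set (ImageL2 Ω)} (hK : IsCompact K) : ∃ r > 0, ∃ L : ℝ → ℝ,
    IntegrableOn L (Icc 0 1) ∧ ∀ F ∈ K, ∀ t ∈ Icc (0 : ℝ) 1, |M t F| ≤ L t ∧
      ‖gradient (M t) F‖ ≤ L t ∧
      ∀ F' ∈ Metric.ball F r, |M t F' - M t F| ≤ L t * ‖F' - F‖ := by
  refine hK.induction_on (p := fun s => ∃ r > 0, ∃ L : ℝ → ℝ,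
    IntegrableOn L (Icc 0 1) ∧ ∀ F ∈ s, ∀ t ∈ Icc (0 : ℝ) 1, |M t F| ≤ L t ∧
      ‖gradient (M t) F‖ ≤ L t ∧
      ∀ F' ∈ Metric.ball F r, |M t F' - M t F| ≤ L t * ‖F' - F‖) ?_ ?_ ?_ ?_
  · exact ⟨1, one_pos, 0, integrableOn_zero, fun F hF => hF.elim⟩
  · rintro s s' hs ⟨r, hr, L, hL, h⟩
    exact ⟨r, hr, L, hL, fun F hF => h F (hs hF)⟩
  · rintro s s' ⟨r, hr, L, hL, h⟩ ⟨r', hr', L', hL', h'⟩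
    refine ⟨min r r', lt_min hr hr', fun t => max (L t) (L' t), hL.sup hL', ?_⟩
    rintro F (hF | hF) t ht
    · obtain ⟨h1, h2, h3⟩ := h F hF t ht
      refine ⟨h1.trans (le_max_left _ _), h2.trans (le_max_left _ _), fun F' hF' => ?_⟩
      exact (h3 F' (Metric.ball_subset_ball (min_le_left _ _) hF')).trans
        (mul_le_mul_of_nonneg_right (le_max_left _ _) (norm_nonneg _))
    · obtain ⟨h1, h2, h3⟩ := h' F hF t ht
      refine ⟨h1.trans (le_max_right _ _), h2.trans (le_max_right _ _), fun F' hF' => ?_⟩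
      exact (h3 F' (Metric.ball_subset_ball (min_le_right _ _) hF')).trans
        (mul_le_mul_of_nonneg_right (le_max_right _ _) (norm_nonneg _))
  · intro F₀ _
    obtain ⟨r, hr, L, hL, h⟩ := hM.dominated F₀
    have hlip : ∀ t ∈ Icc (0 : ℝ) 1, ∀ F ∈ Metric.ball F₀ r, ∀ F' ∈ Metric.ball F₀ r,
        |M t F' - M t F| ≤ L t * ‖F' - F‖ := fun t ht F hF F' hF' =>
      (convex_ball F₀ r).norm_image_sub_le_of_norm_hasFDerivWithin_le
        (fun G _ => (hM.hasFDerivAt ht G).hasFDerivWithinAt)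
        (fun G hG => (innerSL_apply_norm ℝ _).le.trans (h t ht G hG)) hF hF'
    -- With half the radius, every ball of radius `r / 2` about a point of the smaller ball stays
    -- where `L` controls the gradient. The factor `r + 1` makes one function dominate the value of
    -- `M t`, its gradient and its Lipschitz constant.
    refine ⟨Metric.ball F₀ (r / 2), mem_nhdsWithin_of_mem_nhds (Metric.ball_mem_nhds _ (half_pos hr)),
      r / 2, half_pos hr, fun t => |M t F₀| + L t * (r + 1),
      (hM.integrable F₀).abs.add (hL.mul_const _), fun F hF t ht => ?_⟩
    have hF' : F ∈ Metric.ball F₀ r := Metric.ball_subset_ball (half_le_self hr.le) hF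
    have hL0 : 0 ≤ L t := (norm_nonneg _).trans (h t ht F hF')
    have h0 := abs_nonneg (M t F₀)
    refine ⟨?_, ?_, fun F' hFF' => ?_⟩
    · have h1 := hlip t ht F₀ (Metric.mem_ball_self hr) F hF'
      have h2 : L t * ‖F - F₀‖ ≤ L t * (r + 1) := by
        rw [mem_ball_iff_norm] at hF'
        exact mul_le_mul_of_nonneg_left (by linarith) hL0
      have h3 := abs_sub_abs_le_abs_sub (M t F) (M t F₀)
      linarith
    · have := h t ht F hF'
      nlinarith
    · refine (hlip t ht F hF' F' ?_).trans (mul_le_mul_of_nonneg_right ?_ (norm_nonneg _))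
      · rw [Metric.mem_ball] at *
        linarith [dist_triangle F' F F₀]
      · nlinarith

/-- `M` is measurable in `t` for a fixed image and continuous in the image. Replacing `c t` by `c
(⌊t k⌋ / k)` leaves countably many fixed images, and continuity gives the limit `k → ∞`. -/
lemma aestronglyMeasurable {c : ℝ → ImageL2 Ω} (hc : Continuous c) :
    AEStronglyMeasurable (fun t => M t (c t)) (volume.restrict (Icc 0 1)) := by
  refine aestronglyMeasurable_of_tendsto_ae atTop
    (f := fun (k : ℕ) t => M t (c ((⌊t * k⌋₊ : ℝ) / k))) (fun k => ?_) ?_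
  · have h1 : Measurable fun t : ℝ => ⌊t * k⌋₊ := Nat.measurable_floor.comp (measurable_mul_const _)
    have h2 : (⋃ i, (fun t : ℝ => ⌊t * k⌋₊) ⁻¹' {i}) = univ := by
      ext; simp
    rw [← Measure.restrict_univ (μ := volume.restrict (Icc (0 : ℝ) 1)), ← h2,
      aestronglyMeasurable_iUnion_iff]
    intro i
    refine ((hM.integrable (c ((i : ℝ) / k))).aestronglyMeasurable.restrict).congr ?_
    filter_upwards [ae_restrict_mem (h1 (measurableSet_singleton i))] with t ht
    rw [mem_preimage, mem_singleton_iff] at ht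
    rw [ht]
  · filter_upwards [ae_restrict_mem measurableSet_Icc] with t ht
    refine ((hM.differentiable t ht).continuous.tendsto _).comp ((hc.tendsto t).comp ?_)
    exact (tendsto_nat_floor_mul_div_atTop ht.1).comp tendsto_natCast_atTop_atTop

lemma integrableOn_comp {c : ℝ → ImageL2 Ω} (hc : Continuous c) :
    IntegrableOn (fun t => M t (c t)) (Icc 0 1) := by
  obtain ⟨r, hr, L, hL, h⟩ := hM.exists_bound ((isCompact_Icc (a := (0 : ℝ)) (b := 1)).image hc)
  refine hL.mono' (hM.aestronglyMeasurable hc) ?_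
  filter_upwards [ae_restrict_mem measurableSet_Icc] with t ht
  exact (h _ (mem_image_of_mem _ ht) t ht).1

/-- Pairings of the gradient with a fixed image are limits of measurable difference quotients;
Pettis' theorem upgrades this to strong measurability. -/
lemma integrableOn_gradient {c : ℝ → ImageL2 Ω} (hc : Continuous c) :
    IntegrableOn (fun t => gradient (M t) (c t)) (Icc 0 1) := by
  obtain ⟨r, hr, L, hL, h⟩ := hM.exists_bound ((isCompact_Icc (a := (0 : ℝ)) (b := 1)).image hc)
  refine hL.mono' (aestronglyMeasurable_of_inner fun u => ?_) ?_
  · refine aestronglyMeasurable_of_tendsto_ae atTop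
      (f := fun (k : ℕ) t => ((k : ℝ)) * (M t (c t + (k : ℝ)⁻¹ • u) - M t (c t)))
      (fun k => ((hM.aestronglyMeasurable (by fun_prop)).sub
        (hM.aestronglyMeasurable hc)).const_mul _) ?_
    filter_upwards [ae_restrict_mem measurableSet_Icc] with t ht
    have h1 := (hM.hasFDerivAt ht (c t)).lim u (c := fun k : ℕ => (k : ℝ))
      (l := atTop) (by simpa using tendsto_natCast_atTop_atTop)
    exact h1
  · filter_upwards [ae_restrict_mem measurableSet_Icc] with t ht
    exact (h _ (mem_image_of_mem _ ht) t ht).2.1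

end IsDifferentiableDataTerm

end DataTerm

/-! ### Well-definedness, and the gradient with respect to the template. -/

section TemplateGradient

lemma integrableOn_norm_sq {V : Type*} [NormedAddCommGroup V] (v : VelocityL2 V) : IntegrableOn (fun t => ‖(v t : V)‖ ^ 2) (Icc 0 1) :=
  (Lp.memLp v).integrable_norm_pow two_ne_zero

/-- The kinetic energy `∫₀¹ ∫₀ᵗ ‖v(τ)‖² dτ dt`. -/
def energy {V : Type*} [NormedAddCommGroup V] (v : VelocityL2 V) : ℝ := ∫ t in Icc (0 : ℝ) 1, (1 - t) * ‖(v t : V)‖ ^ 2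

lemma integral_integral_norm_sq {V : Type*} [NormedAddCommGroup V] (v : VelocityL2 V) :
    ∫ t in (0 : ℝ)..1, ∫ τ in (0 : ℝ)..t, ‖(v τ : V)‖ ^ 2 = energy v := by
  have h0 : Icc (0 : ℝ) 1 =ᵐ[volume] uIoc (0 : ℝ) 1 := by
    rw [uIoc_of_le zero_le_one]
    exact Ioc_ae_eq_Icc.symm
  have h1 : IntegrableOn (fun t => ‖(v t : V)‖ ^ 2) (uIoc 0 1) := by
    rw [IntegrableOn, ← Measure.restrict_congr_set h0]
    exact integrableOn_norm_sq v
  have : IsFiniteMeasure ((volume : Measure ℝ).restrict (uIoc 0 1)) := by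
    rw [uIoc_of_le zero_le_one]
    infer_instance
  have h2 : IntegrableOn (Function.uncurry fun _ τ : ℝ => ‖(v τ : V)‖ ^ 2)
      (uIoc 0 1 ×ˢ uIoc 0 1) := by
    rw [IntegrableOn, Measure.volume_eq_prod, ← Measure.prod_restrict]
    exact Integrable.comp_snd h1 _
  rw [integral_integral_triangle h2, energy, integral_Icc_eq_integral_Ioc,
    intervalIntegral.integral_of_le zero_le_one]
  simp

variable {n : ℕ} {Ω : Set (Space n)} {V : Type*} [NormedAddCommGroup V] [InnerProductSpace ℝ V]
  [RKHS ℝ V (Space n) (Space n)] {C : ℝ}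

variable (hV : IsAdmissibleWith Ω V C) (hΩ : MeasurableSet Ω) {M : ℝ → ImageL2 Ω → ℝ}

namespace IsAdmissibleWith

include hV hΩ

lemma continuous_pull_snd (v : VelocityL2 V) (t : ℝ) (F : ImageL2 Ω) :
    Continuous fun τ => hV.pull hΩ v τ t F :=
  (hV.continuous_pull hΩ F).comp (f := fun τ : ℝ => (v, τ, t)) (by fun_prop)

lemma pulledGradient_eq (v : VelocityL2 V) (F : ImageL2 Ω) {t τ : ℝ} (ht : t ∈ Icc (0 : ℝ) 1)
    (hτ : τ ∈ Icc (0 : ℝ) 1) : pulledGradient M v F t τ =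
      ContinuousLinearMap.adjoint (hV.pull hΩ v τ t : ImageL2 Ω →L[ℝ] ImageL2 Ω)
        (gradient (M τ) (hV.pull hΩ v τ 0 F)) := by
  have h1 := hV.deformed_eq hΩ v hτ F
  have h2 := hV.toL2_jacComp hΩ v t τ (gradient (M τ) (hV.pull hΩ v τ 0 F))
  rw [← h2, ← h1, ← hV.transition_eq_phi v ht hτ]
  rfl

/-- `pull` is strongly continuous in time; in the pairing with a fixed image the adjoint moves to
that image, so weak measurability together with Pettis' theorem suffices. -/
lemma integrableOn_adjoint_pull (v : VelocityL2 V) {G : ℝ → ImageL2 Ω}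
    (hG : IntegrableOn G (Icc 0 1)) (t : ℝ) : IntegrableOn (fun τ =>
      ContinuousLinearMap.adjoint (hV.pull hΩ v τ t : ImageL2 Ω →L[ℝ] ImageL2 Ω) (G τ))
      (Icc 0 1) := by
  obtain ⟨K, _, hK⟩ := hV.exists_norm_pull_le hΩ (E := ℝ) (stab C v)
  refine (hG.norm.const_mul K).mono' (aestronglyMeasurable_of_inner fun u => ?_)
    (Eventually.of_forall fun τ => ?_)
  · simp_rw [ContinuousLinearMap.adjoint_inner_left]
    exact hG.aestronglyMeasurable.inner
      (hV.continuous_pull_snd hΩ v t u).stronglyMeasurable.aestronglyMeasurable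
  · refine (ContinuousLinearMap.le_opNorm _ _).trans
      (mul_le_mul_of_nonneg_right ?_ (norm_nonneg _))
    rw [ContinuousLinearMap.adjoint.norm_map]
    exact ContinuousLinearMap.opNorm_le_bound _ (by positivity) fun F => hK v le_rfl τ t F

lemma integrableOn_pulledGradient (hM : IsDifferentiableDataTerm M) (v : VelocityL2 V)
    (F : ImageL2 Ω) {t : ℝ} (ht : t ∈ Icc (0 : ℝ) 1) :
    IntegrableOn (pulledGradient M v F t) (Icc 0 1) :=
  (hV.integrableOn_adjoint_pull hΩ v
    (hM.integrableOn_gradient (hV.continuous_pull_snd hΩ v 0 F)) t).congr_fun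
    (fun _ hτ => (hV.pulledGradient_eq hΩ v F ht hτ).symm) measurableSet_Icc

/-- The adjoint representation of the time integral in the force field. -/
lemma inner_integral_pulledGradient (hM : IsDifferentiableDataTerm M) (v : VelocityL2 V)
    (F : ImageL2 Ω) {t a : ℝ} (ht : t ∈ Icc (0 : ℝ) 1) (ha : a ∈ Icc (0 : ℝ) 1) (h : ImageL2 Ω) :
    inner ℝ (∫ τ in a..1, pulledGradient M v F t τ) h =
      ∫ τ in a..1, inner ℝ (gradient (M τ) (hV.pull hΩ v τ 0 F)) (hV.pull hΩ v τ t h) := by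
  have hi := (hV.integrableOn_pulledGradient hΩ hM v F ht).mono_set (Icc_subset_Icc_left ha.1)
  have hi' : IntervalIntegrable (pulledGradient M v F t) volume a 1 :=
    (intervalIntegrable_iff_integrableOn_Icc_of_le ha.2).2 hi
  rw [real_inner_comm, ← innerSL_apply_apply ℝ,
    ← ContinuousLinearMap.intervalIntegral_comp_comm _ hi']
  refine intervalIntegral.integral_congr fun τ hτ => ?_
  rw [uIcc_of_le ha.2] at hτ
  simp only [innerSL_apply_apply]
  rw [hV.pulledGradient_eq hΩ v F ht ⟨ha.1.trans hτ.1, hτ.2⟩,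
    ContinuousLinearMap.adjoint_inner_right, real_inner_comm]

lemma isWellDefined (hM : IsDifferentiableDataTerm M) : IsWellDefined Ω V M where
  flow_isFlowLine := hV.isFlowLine_flow
  flow_bijective v t ht := by
    rw [hV.flow_eq_phi v ht]
    exact ⟨hV.bijective_phi v 0 t, hV.bijOn_phi v 0 t⟩
  memLp_geomAct v t ht F := by
    rw [hV.geomAct_transition v ht]
    exact hV.memLp_comp_phi hΩ (Lp.memLp F) v t 0
  memLp_jacComp v s hs t ht F := by
    rw [hV.transition_eq_phi v hs ht]
    exact hV.memLp_jacComp hΩ v s t F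
  integrable_data v F :=
    (hM.integrableOn_comp (hV.continuous_pull_snd hΩ v 0 F)).congr_fun
      (fun t ht => by rw [hV.deformed_eq hΩ v ht]) measurableSet_Icc
  integrable_pulledGradient v F _ ht :=
    (hV.integrableOn_pulledGradient hΩ hM v F ht).mono_set (Icc_subset_Icc_left ht.1)

variable {X : Type*} [NormedAddCommGroup X] [NormedSpace ℝ X] (ι : X →L[ℝ] ImageL2 Ω)

lemma objective_eq (hM : IsDifferentiableDataTerm M) (R₁ : X → ℝ) (μ₁ μ₂ : ℝ) (f : X)
    (v : VelocityL2 V) : objective ι M R₁ μ₁ μ₂ f v =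
      (∫ t in Icc (0 : ℝ) 1, M t (hV.pull hΩ v t 0 (ι f))) + μ₂ * energy v + μ₁ * R₁ f := by
  have h1 : IntervalIntegrable (fun t => M t (hV.pull hΩ v t 0 (ι f))) volume 0 1 :=
    (intervalIntegrable_iff_integrableOn_Icc_of_le zero_le_one).2
      (hM.integrableOn_comp (hV.continuous_pull_snd hΩ v 0 (ι f)))
  have h2 : IntervalIntegrable (fun t => μ₂ * ∫ τ in (0 : ℝ)..t, ‖(v τ : V)‖ ^ 2) volume 0 1 := by
    refine ContinuousOn.intervalIntegrable (continuousOn_const.mul ?_)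
    refine intervalIntegral.continuousOn_primitive_interval ?_
    rw [uIcc_of_le zero_le_one]
    exact integrableOn_norm_sq v
  rw [objective, ← integral_integral_norm_sq, integral_Icc_eq_integral_Ioc,
    ← intervalIntegral.integral_of_le zero_le_one, ← intervalIntegral.integral_const_mul,
    ← intervalIntegral.integral_add h1 h2]
  congr 1
  refine intervalIntegral.integral_congr fun t ht => ?_
  rw [uIcc_of_le zero_le_one] at ht
  simp only [hV.deformed_eq hΩ v ht]

/-- For fixed `v` the deformation is linear in the template, so the chain rule is immediate. The
adjoint of `pull` then produces the Jacobian factor in the gradient. -/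
lemma hasFDerivAt_data_template (hM : IsDifferentiableDataTerm M) (v : VelocityL2 V) (f : X) :
    HasL2GradientAt ι (fun h => ∫ t in Icc (0 : ℝ) 1, M t (hV.pull hΩ v t 0 (ι h)))
      (∫ t in (0 : ℝ)..1, pulledGradient M v (ι f) 0 t) f := by
  have h0 := left_mem_Icc.2 (zero_le_one (α := ℝ))
  have hc := fun F => hV.continuous_pull_snd hΩ v 0 F
  obtain ⟨K, hK0, hK⟩ := hV.exists_norm_pull_le hΩ (E := ℝ) (stab C v)
  obtain ⟨r, hr, L, hL, h⟩ :=
    hM.exists_bound ((isCompact_Icc (a := (0 : ℝ)) (b := 1)).image (hc (ι f)))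
  have hdist : ∀ t x, ‖hV.pull hΩ v t 0 (ι x) - hV.pull hΩ v t 0 (ι f)‖
      ≤ K * ‖ι‖ * ‖x - f‖ := fun t x => by
    rw [← map_sub, ← map_sub, mul_assoc]
    exact (hK v le_rfl t 0 _).trans (mul_le_mul_of_nonneg_left (ι.le_opNorm _) hK0.le)
  have hK1 : 0 < K * ‖ι‖ + 1 := by positivity
  refine hasFDerivAt_integral_of_weak (δ := r / (K * ‖ι‖ + 1)) (bound := fun t => L t * (K * ‖ι‖))
    (φ' := fun t => (innerSL ℝ (gradient (M t) (hV.pull hΩ v t 0 (ι f)))).comp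
      ((hV.pull hΩ v t 0).comp ι)) (div_pos hr hK1) (fun x => hM.integrableOn_comp (hc (ι x)))
    (fun x => ?_) (hL.mul_const _) ?_ ?_
  · simp only [ContinuousLinearMap.comp_apply, innerSL_apply_apply]
    rw [hV.inner_integral_pulledGradient hΩ hM v (ι f) h0 h0, integral_Icc_eq_integral_Ioc,
      intervalIntegral.integral_of_le zero_le_one]
  · filter_upwards [ae_restrict_mem measurableSet_Icc] with t ht x hx
    obtain ⟨h1, h2, h3⟩ := h _ (mem_image_of_mem _ ht) t ht
    rw [mul_assoc]
    refine (h3 _ ?_).trans (mul_le_mul_of_nonneg_left (hdist t x) ((norm_nonneg _).trans h2))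
    rw [mem_ball_iff_norm]
    rw [mem_ball_iff_norm, lt_div_iff₀ hK1] at hx
    refine (hdist t x).trans_lt ?_
    nlinarith [norm_nonneg (x - f)]
  · filter_upwards [ae_restrict_mem measurableSet_Icc] with t ht
    exact (hM.hasFDerivAt ht _).comp f
      (((hV.pull hΩ v t 0 : ImageL2 Ω →L[ℝ] ImageL2 Ω).comp ι).hasFDerivAt)

lemma hasL2GradientAt_objective (hM : IsDifferentiableDataTerm M) {R₁ : X → ℝ} (μ₁ μ₂ : ℝ) {f : X}
    {gradR : ImageL2 Ω} (hR : HasL2GradientAt ι R₁ gradR f) (v : VelocityL2 V) :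
    HasL2GradientAt ι (fun h => objective ι M R₁ μ₁ μ₂ h v)
      ((∫ t in (0 : ℝ)..1, pulledGradient M v (ι f) 0 t) + μ₁ • gradR) f := by
  simp_rw [hV.objective_eq hΩ ι hM]
  have h := ((hV.hasFDerivAt_data_template hΩ ι hM v f).add_const (μ₂ * energy v)).add
    (HasFDerivAt.const_mul hR μ₁)
  refine h.congr_fderiv ?_
  ext x
  simp

end IsAdmissibleWith

end TemplateGradient

/-! ### Kinetic energy, and the data derivative as an integral over perturbation times. -/

section VelocityDerivative

/-- `energy` is a quadratic form bounded by `‖w‖²`, so the first-order remainder at `v` is exactly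
`energy w`. -/
lemma hasFDerivAt_energy {V : Type*} [NormedAddCommGroup V] [InnerProductSpace ℝ V]
    {v : VelocityL2 V} {L : VelocityL2 V →L[ℝ] ℝ}
    (hL : ∀ w, L w = ∫ t in Icc (0 : ℝ) 1, 2 * (1 - t) * inner ℝ (v t : V) (w t)) :
    HasFDerivAt energy L v := by
  have hc : ∀ c : ℝ, AEStronglyMeasurable (fun t : ℝ => c * (1 - t))
    (volume.restrict (Icc (0 : ℝ) 1)) := fun c => by fun_prop
  have hb : ∀ c : ℝ, 0 ≤ c → ∀ᵐ t : ℝ ∂(volume.restrict (Icc (0 : ℝ) 1)), ‖c * (1 - t)‖ ≤ c :=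
    fun c hc => by
      filter_upwards [ae_restrict_mem measurableSet_Icc] with t ht
      rw [norm_mul, Real.norm_of_nonneg hc, Real.norm_of_nonneg (by linarith [ht.2])]
      exact mul_le_of_le_one_right hc (by linarith [ht.1])
  have h1 : ∀ w : VelocityL2 V, IntegrableOn (fun t => (1 - t) * ‖(w t : V)‖ ^ 2) (Icc 0 1) :=
    fun w => by
      have := (integrableOn_norm_sq w).bdd_mul (hc 1) (hb 1 zero_le_one)
      rw [IntegrableOn]
      simpa using this
  have h2 : ∀ w : VelocityL2 V,
      IntegrableOn (fun t => 2 * (1 - t) * inner ℝ (v t : V) (w t)) (Icc 0 1) := fun w =>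
    (L2.integrable_inner v w).bdd_mul (hc 2) (hb 2 zero_le_two)
  have h3 : ∀ w : VelocityL2 V, energy (v + w) - energy v - L w = energy w := fun w => by
    rw [hL, energy, energy, energy, ← integral_sub, ← integral_sub]
    · refine integral_congr_ae ?_
      filter_upwards [Lp.coeFn_add v w] with t ht
      rw [ht, Pi.add_apply, norm_add_sq_real]
      ring
    · exact (h1 (v + w)).sub (h1 v)
    · exact h2 w
    · exact h1 (v + w)
    · exact h1 v
  have h4 : ∀ w : VelocityL2 V, ‖energy w‖ ≤ 1 * ‖‖w‖ ^ 2‖ := fun w => by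
    rw [one_mul, norm_pow, norm_norm, ← real_inner_self_eq_norm_sq, L2.inner_def, energy]
    refine norm_integral_le_of_norm_le (L2.integrable_inner w w) ?_
    filter_upwards [hb 1 zero_le_one] with t ht
    rw [one_mul] at ht
    rw [norm_mul, real_inner_self_eq_norm_sq, norm_pow, norm_norm]
    exact mul_le_of_le_one_left (sq_nonneg _) ht
  rw [hasFDerivAt_iff_isLittleO_nhds_zero]
  simp_rw [h3]
  exact (Asymptotics.IsBigO.of_bound 1 (Eventually.of_forall h4)).trans_isLittleO
    (Asymptotics.isLittleO_norm_pow_id one_lt_two)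

variable {n : ℕ} {Ω : Set (Space n)} {V : Type*} [NormedAddCommGroup V] [InnerProductSpace ℝ V]
  [RKHS ℝ V (Space n) (Space n)] {C : ℝ}

variable (hV : IsAdmissibleWith Ω V C) (hΩ : MeasurableSet Ω) {g : Space n → Space n}
  (hg : MemLp g 2 (volume.restrict Ω)) (hgm : StronglyMeasurable g)

namespace IsAdmissibleWith

include hV

include hgm in
lemma stronglyMeasurable_imageTransport_prod (v : VelocityL2 V) {u : ℝ → V}
    (hu : StronglyMeasurable u) : StronglyMeasurable fun p : (ℝ × ℝ) × Space n =>
      inner ℝ (g (phi v p.1.1 0 p.2)) (transport v p.1.1 0 p.1.2 p.2 (u p.1.2)) := by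
  have h1 : Continuous fun p : (ℝ × ℝ) × Space n => phi v p.1.1 0 p.2 :=
    hV.continuous_phi_comp (by fun_prop) (by fun_prop) continuous_const continuous_snd
  exact (hgm.comp_measurable h1.measurable).inner
    (hV.stronglyMeasurable_transport_prod (α := ℝ × ℝ) (v := fun _ => v) (s := fun a => a.1)
      (q := fun a => a.2) (u := fun a => u a.2) 0 (by fun_prop) (by fun_prop) (by fun_prop)
      (hu.comp_measurable measurable_snd))

include hΩ hg

/-- The effect `u ↦ imageTransport Ω g v τ q u` of a velocity at time `q` on the image at time `τ`
as a continuous linear map. -/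
def imageTransportL (v : VelocityL2 V) (τ q : ℝ) : V →L[ℝ] ImageL2 Ω :=
  LinearMap.mkContinuous
    { toFun := imageTransport Ω g v τ q
      map_add' := fun u u' => by
        rw [imageTransport, imageTransport, imageTransport,
          toL2_of_memLp (hV.memLp_imageTransport hΩ hg v τ q (u + u')),
          toL2_of_memLp (hV.memLp_imageTransport hΩ hg v τ q u),
          toL2_of_memLp (hV.memLp_imageTransport hΩ hg v τ q u'), ← MemLp.toLp_add]
        congr 1
        funext y
        simp [transport, inner_add_right]
      map_smul' := fun c u => by
        rw [imageTransport, imageTransport,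
          toL2_of_memLp (hV.memLp_imageTransport hΩ hg v τ q (c • u)),
          toL2_of_memLp (hV.memLp_imageTransport hΩ hg v τ q u), RingHom.id_apply,
          ← MemLp.toLp_const_smul]
        congr 1
        funext y
        simp [transport, inner_smul_right] }
    (stab C v * C * ‖hV.pull hΩ v τ 0 (hg.toLp g)‖)
    (fun u => (hV.norm_imageTransport_le hΩ hg v τ q u).trans_eq (by ring))

lemma imageTransportL_apply (v : VelocityL2 V) (τ q : ℝ) (u : V) :
    hV.imageTransportL hΩ hg v τ q u = imageTransport Ω g v τ q u := rfl

lemma exists_norm_imageTransport_le (v : VelocityL2 V) : ∃ B : ℝ, 0 ≤ B ∧ ∀ τ q (u : V),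
    ‖imageTransport Ω g v τ q u‖ ≤ B * ‖u‖ := by
  obtain ⟨K, hK0, hK⟩ := hV.exists_norm_pull_le hΩ (E := Space n) (stab C v)
  have hs := stab_pos C v
  have hC := hV.pos
  refine ⟨stab C v * C * (K * ‖hg.toLp g‖), by positivity, fun τ q u => ?_⟩
  refine (hV.norm_imageTransport_le hΩ hg v τ q u).trans ?_
  calc stab C v * (C * ‖u‖) * ‖hV.pull hΩ v τ 0 (hg.toLp g)‖
      ≤ stab C v * (C * ‖u‖) * (K * ‖hg.toLp g‖) :=
        mul_le_mul_of_nonneg_left (hK v le_rfl τ 0 _) (by positivity)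
    _ = _ := by ring

/-- By the group law, the effect at time `τ` of a perturbation at time `q` is its effect at time `q`
transported by the flow. This separates the dependence on `τ`, so that the adjoint of `pull` can be
applied to the data gradient. -/
lemma pull_imageTransport (v : VelocityL2 V) (τ q : ℝ) (u : V) :
    hV.pull hΩ v τ q (imageTransport Ω g v q q u) = imageTransport Ω g v τ q u := by
  rw [imageTransport, imageTransport, toL2_of_memLp (hV.memLp_imageTransport hΩ hg v q q u),
    toL2_of_memLp (hV.memLp_imageTransport hΩ hg v τ q u), pull_toLp]
  congr 1
  funext y
  simp only [Function.comp_apply, transport, hV.phi_phi, hV.phi_self]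

include hgm

lemma aestronglyMeasurable_imageTransport (v : VelocityL2 V) {u : ℝ → V}
    (hu : StronglyMeasurable u) (μ : Measure (ℝ × ℝ)) :
    AEStronglyMeasurable (fun p : ℝ × ℝ => imageTransport Ω g v p.1 p.2 (u p.2)) μ := by
  refine aestronglyMeasurable_of_inner fun h => ?_
  have h1 : StronglyMeasurable (Function.uncurry fun (p : ℝ × ℝ) (y : Space n) => h y *
      inner ℝ (g (phi v p.1 0 y)) (transport v p.1 0 p.2 y (u p.2))) :=
    ((Lp.stronglyMeasurable h).comp_measurable measurable_snd).mul
      (hV.stronglyMeasurable_imageTransport_prod hgm v hu)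
  refine (h1.integral_prod_right (ν := volume.restrict Ω)).aestronglyMeasurable.congr
    (Eventually.of_forall fun p => ?_)
  simp only
  rw [real_inner_comm]
  exact (inner_toL2 (hV.memLp_imageTransport hΩ hg v p.1 p.2 (u p.2)) h).symm

lemma integrable_inner_imageTransport (v : VelocityL2 V) {u : ℝ → V}
    (hu : StronglyMeasurable u) (hui : IntegrableOn u (Icc 0 1)) {G : ℝ → ImageL2 Ω}
    (hG : IntegrableOn G (Icc 0 1)) :
    Integrable (fun p : ℝ × ℝ => inner ℝ (G p.1) (imageTransport Ω g v p.1 p.2 (u p.2)))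
      ((volume.restrict (Icc 0 1)).prod (volume.restrict (Icc 0 1))) := by
  obtain ⟨B, hB0, hB⟩ := hV.exists_norm_imageTransport_le hΩ hg v
  refine ((hG.norm.mul_prod hui.norm).const_mul B).mono'
    (hG.aestronglyMeasurable.comp_fst.inner
      (hV.aestronglyMeasurable_imageTransport hΩ hg hgm v hu _))
    (Eventually.of_forall fun p => ?_)
  refine (norm_inner_le_norm _ _).trans
    ((mul_le_mul_of_nonneg_left (hB _ _ _) (norm_nonneg _)).trans_eq (by ring))

/-- Fubini in space and perturbation time. The minus sign arises because the backward flow `φ_{τ,0}`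
integrates from `τ` down to `0`; it is the sign in front of the force field. -/
lemma inner_imageVariation (v w : VelocityL2 V) {τ : ℝ} (hτ : τ ∈ Icc (0 : ℝ) 1)
    (h : ImageL2 Ω) : inner ℝ h (imageVariation Ω g v w τ) =
      -∫ q in (0 : ℝ)..τ, inner ℝ h (imageTransport Ω g v τ q (extend w q)) := by
  obtain ⟨B, hB0, hB⟩ := hV.exists_norm_imageTransport_le hΩ hg v
  let k : ℝ → Space n → ℝ := fun q y =>
    h y * inner ℝ (g (phi v τ 0 y)) (transport v τ 0 q y (extend w q))
  have hm : StronglyMeasurable (Function.uncurry k) :=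
    ((Lp.stronglyMeasurable h).comp_measurable measurable_snd).mul
      ((hV.stronglyMeasurable_imageTransport_prod hgm v
        (stronglyMeasurable_extend w)).comp_measurable
        (g := fun p : ℝ × Space n => ((τ, p.1), p.2)) (by fun_prop))
  have hi : Integrable (Function.uncurry k)
      ((volume.restrict (Ioc 0 τ)).prod (volume.restrict Ω)) := by
    rw [integrable_prod_iff hm.aestronglyMeasurable]
    refine ⟨Eventually.of_forall fun q =>
      (Lp.memLp h).integrable_mul (hV.memLp_imageTransport hΩ hg v τ q (extend w q)), ?_⟩
    refine (((integrable_norm_extend w).restrict (s := Ioc 0 τ)).const_mul (‖h‖ * B)).mono'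
      hm.norm.integral_prod_right.aestronglyMeasurable (Eventually.of_forall fun q => ?_)
    rw [Real.norm_of_nonneg (integral_nonneg fun _ => norm_nonneg _), mul_assoc]
    exact (integral_norm_mul_le (hV.memLp_imageTransport hΩ hg v τ q (extend w q)) h).trans
      (mul_le_mul_of_nonneg_left (hB τ q _) (norm_nonneg _))
  have h1 : ∀ q, inner ℝ h (imageTransport Ω g v τ q (extend w q)) = ∫ y in Ω, k q y := fun q =>
    inner_toL2 (hV.memLp_imageTransport hΩ hg v τ q (extend w q)) h
  simp_rw [h1]
  rw [intervalIntegral.integral_of_le hτ.1, integral_integral_swap hi, ← integral_neg]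
  refine (inner_toL2 (hV.memLp_imageVariation hΩ hg v w τ) h).trans ?_
  refine integral_congr_ae (Eventually.of_forall fun y => ?_)
  simp only [k]
  rw [integral_const_mul, ← intervalIntegral.integral_of_le hτ.1, variation,
    intervalIntegral.integral_symm, inner_neg_right, mul_neg, ← innerSL_apply_apply ℝ,
    ← ContinuousLinearMap.intervalIntegral_comp_comm _
      (hV.integrable_transport v w τ 0 y).intervalIntegrable]
  rfl

/-- The derivative of the data term with respect to the velocity, written as an integral over the
time at which the velocity is perturbed. -/
lemma integral_inner_imageVariation (v w : VelocityL2 V) {G : ℝ → ImageL2 Ω}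
    (hG : IntegrableOn G (Icc 0 1)) :
    ∫ τ in Icc (0 : ℝ) 1, inner ℝ (G τ) (imageVariation Ω g v w τ) =
      -∫ q in Icc (0 : ℝ) 1, ∫ τ in q..1, inner ℝ (G τ) (imageTransport Ω g v τ q (w q)) := by
  have h0 : (volume : Measure ℝ).restrict (uIoc 0 1) = volume.restrict (Icc 0 1) := by
    rw [uIoc_of_le zero_le_one]
    exact Measure.restrict_congr_set Ioc_ae_eq_Icc
  have hZ : IntegrableOn (Function.uncurry fun τ q : ℝ =>
      inner ℝ (G τ) (imageTransport Ω g v τ q (extend w q))) (uIoc 0 1 ×ˢ uIoc 0 1) := by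
    rw [IntegrableOn, Measure.volume_eq_prod, ← Measure.prod_restrict, h0]
    exact hV.integrable_inner_imageTransport hΩ hg hgm v (stronglyMeasurable_extend w)
      (integrable_extend w).integrableOn hG
  have h1 := integral_integral_triangle hZ
  rw [intervalIntegral.integral_of_le zero_le_one, ← integral_Icc_eq_integral_Ioc,
    intervalIntegral.integral_of_le zero_le_one, ← integral_Icc_eq_integral_Ioc] at h1
  have h2 : ∫ q in Icc (0 : ℝ) 1, ∫ τ in q..1, inner ℝ (G τ) (imageTransport Ω g v τ q (w q)) =
      ∫ q in Icc (0 : ℝ) 1, ∫ τ in q..1,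
        inner ℝ (G τ) (imageTransport Ω g v τ q (extend w q)) :=
    setIntegral_congr_fun measurableSet_Icc fun q hq => by
      simp only [extend_of_mem w hq]
  rw [h2, ← h1, ← integral_neg]
  exact setIntegral_congr_fun measurableSet_Icc fun τ hτ =>
    hV.inner_imageVariation hΩ hg hgm v w hτ (G τ)

end IsAdmissibleWith

end VelocityDerivative

/-! ### The force field, its potential in `V`, and the gradient with respect to the velocity. -/

section VelocityGradient

variable {n : ℕ} {Ω : Set (Space n)} {V : Type*} [NormedAddCommGroup V] [InnerProductSpace ℝ V]
  [RKHS ℝ V (Space n) (Space n)] {C : ℝ}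

variable (hV : IsAdmissibleWith Ω V C) (hΩ : MeasurableSet Ω) {g : Space n → Space n}
  (hg : MemLp g 2 (volume.restrict Ω)) (hgm : StronglyMeasurable g) {M : ℝ → ImageL2 Ω → ℝ}
  (hM : IsDifferentiableDataTerm M)

namespace IsAdmissibleWith

include hV hΩ hg

include hM hgm in
-- The functional `L` is left abstract: its Riesz representative is built later, and only its values
-- are needed here.
lemma hasFDerivAt_data_velocity (hΩo : IsOpen Ω) {f₀ : Space n → ℝ}
    (hf₀ : DifferentiableOn ℝ f₀ Ω) (hgf : g =ᵐ[volume.restrict Ω] gradient f₀) {F : ImageL2 Ω}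
    (hF : F =ᵐ[volume.restrict Ω] f₀) (v : VelocityL2 V) {L : VelocityL2 V →L[ℝ] ℝ}
    (hL : ∀ w, L w = ∫ τ in Icc (0 : ℝ) 1,
      inner ℝ (gradient (M τ) (hV.pull hΩ v τ 0 F)) (imageVariation Ω g v w τ)) :
    HasFDerivAt (fun v => ∫ t in Icc (0 : ℝ) 1, M t (hV.pull hΩ v t 0 F)) L v := by
  have hc := fun v => hV.continuous_pull_snd hΩ v 0 F
  obtain ⟨K, hK0, hK⟩ := hV.exists_norm_pull_add_sub_le hΩ hg hΩo hgm hf₀ hgf hF v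
  obtain ⟨r, hr, B, hB, h⟩ :=
    hM.exists_bound ((isCompact_Icc (a := (0 : ℝ)) (b := 1)).image (hc v))
  refine hasFDerivAt_integral_of_weak (δ := min 1 (r / K)) (bound := fun t => B t * K)
    (φ' := fun t => (innerSL ℝ (gradient (M t) (hV.pull hΩ v t 0 F))).comp
      (hV.imageDeriv hΩ hg v t)) (lt_min one_pos (div_pos hr hK0))
    (fun v' => hM.integrableOn_comp (hc v')) hL (hB.mul_const _) ?_ ?_
  · filter_upwards [ae_restrict_mem measurableSet_Icc] with t ht v' hv'
    obtain ⟨h1, h2, h3⟩ := h _ (mem_image_of_mem _ ht) t ht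
    rw [mem_ball_iff_norm, lt_min_iff, lt_div_iff₀ hK0] at hv'
    have h4 := hK (v' - v) hv'.1.le t ht
    rw [add_sub_cancel] at h4
    rw [mul_assoc]
    refine (h3 _ ?_).trans (mul_le_mul_of_nonneg_left h4 ((norm_nonneg _).trans h2))
    rw [mem_ball_iff_norm]
    exact h4.trans_lt (by linarith [hv'.2])
  · filter_upwards [ae_restrict_mem measurableSet_Icc] with t ht
    exact (hM.hasFDerivAt ht _).comp v (hV.hasFDerivAt_pull hΩ hg hΩo hgm hf₀ hgf hF v ht)

end IsAdmissibleWith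

namespace IsAdmissibleWith

variable (hΩo : IsOpen Ω) {f₀ : Space n → ℝ} (hf₀ : DifferentiableOn ℝ f₀ Ω)
  (hgf : g =ᵐ[volume.restrict Ω] gradient f₀)

include hV

include hΩo hf₀ in
-- The chain rule puts the transposed Jacobian of `φ_{q,0}` on `∇f`; that transpose later moves onto
-- the velocity in the inner product.
lemma gradient_geomAct (v : VelocityL2 V) {q : ℝ} (hq : q ∈ Icc (0 : ℝ) 1) {y : Space n}
    (hy : y ∈ Ω) : gradient (geomAct (transition v 0 q) f₀) y =
      ContinuousLinearMap.adjoint (jac v q 0 y) (gradient f₀ (phi v q 0 y)) := by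
  rw [hV.geomAct_transition v hq]
  have hmem : phi v q 0 y ∈ Ω := (hV.phi_mem_iff v q 0).2 hy
  have h1 := ((hf₀ _ hmem).differentiableAt (hΩo.mem_nhds hmem)).hasGradientAt.hasFDerivAt.comp y
    (hV.hasFDerivAt_phi v q 0 y)
  refine HasGradientAt.gradient (hasGradientAt_iff_hasFDerivAt.2 (h1.congr_fderiv ?_))
  ext a
  simp [ContinuousLinearMap.adjoint_inner_left]

include hΩ

include hΩo hf₀ hgf in
lemma forceField_ae_eq (v : VelocityL2 V) (F : ImageL2 Ω) {q : ℝ} (hq : q ∈ Icc (0 : ℝ) 1) :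
    forceField M v F f₀ q =ᵐ[volume.restrict Ω] fun y =>
      -((∫ τ in q..1, pulledGradient M v F q τ : ImageL2 Ω) y •
        ContinuousLinearMap.adjoint (jac v q 0 y) (g (phi v q 0 y))) := by
  filter_upwards [ae_restrict_mem hΩ, (hV.quasiMeasurePreserving_phi hΩ v q 0).ae_eq_comp hgf]
    with y hy hgy
  rw [forceField, hV.gradient_geomAct hΩo hf₀ v hq hy]
  simp only [Function.comp_apply] at hgy
  rw [hgy]

include hg

include hΩo hf₀ hgf in
-- A product of two square integrable factors: the accumulated data gradient and the gradient of the
-- deformed image.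
lemma integrable_forceField (v : VelocityL2 V) (F : ImageL2 Ω) {q : ℝ} (hq : q ∈ Icc (0 : ℝ) 1) :
    IntegrableOn (forceField M v F f₀ q) Ω := by
  have hp := hV.memLp_comp_phi hΩ hg v q 0
  have hJ : Continuous fun y => ContinuousLinearMap.adjoint (jac v q 0 y) :=
    ContinuousLinearMap.adjoint.continuous.comp (hV.continuous_jac_right v q 0)
  have h1 : MemLp (fun y => ContinuousLinearMap.adjoint (jac v q 0 y) (g (phi v q 0 y))) 2
      (volume.restrict Ω) := by
    refine hp.of_le_mul (c := stab C v) ?_ (Eventually.of_forall fun y => ?_)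
    · have h2 := isBoundedBilinearMap_apply.continuous.comp_aestronglyMeasurable
        (hJ.aestronglyMeasurable.prodMk hp.aestronglyMeasurable)
      exact h2
    · refine (ContinuousLinearMap.le_opNorm _ _).trans
        (mul_le_mul_of_nonneg_right ?_ (norm_nonneg _))
      rw [ContinuousLinearMap.adjoint.norm_map]
      exact hV.norm_jac_le v q 0 y
  have h3 := memLp_one_iff_integrable.1 (h1.smul (r := 1)
    (Lp.memLp (∫ τ in q..1, pulledGradient M v F q τ : ImageL2 Ω)))
  exact h3.neg.congr (hV.forceField_ae_eq hΩ hΩo hf₀ hgf v F hq).symm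

variable [CompleteSpace V]

/-- The Riesz representative in `V` of the force density at time `q`. -/
def forcePotential (M : ℝ → ImageL2 Ω → ℝ) (v : VelocityL2 V) (F : ImageL2 Ω) (q : ℝ) : V :=
  -ContinuousLinearMap.adjoint (hV.imageTransportL hΩ hg v q q)
    (∫ τ in q..1, pulledGradient M v F q τ)

include hΩo hf₀ hgf in
lemma integrable_kernel_forceField (v : VelocityL2 V) (F : ImageL2 Ω) {q : ℝ}
    (hq : q ∈ Icc (0 : ℝ) 1) (x : Space n) :
    IntegrableOn (fun y => RKHS.kernel V x y (forceField M v F f₀ q y)) Ω := by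
  have hi := hV.integrable_forceField hΩ hg hΩo hf₀ hgf v F (M := M) hq
  have h1 : Integrable (fun y => RKHS.kerFun (𝕜 := ℝ) V y (forceField M v F f₀ q y))
      (volume.restrict Ω) := by
    refine (hi.norm.const_mul C).mono' ?_ (Eventually.of_forall fun y => ?_)
    · have : SecondCountableTopologyEither (Space n) (Space n →L[ℝ] V) :=
        secondCountableTopologyEither_of_left _ _
      have h2 := isBoundedBilinearMap_apply.continuous.comp_aestronglyMeasurable
        (hV.continuous_kerFun.aestronglyMeasurable.prodMk hi.aestronglyMeasurable)
      exact h2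
    · exact (ContinuousLinearMap.le_opNorm _ _).trans
        (mul_le_mul_of_nonneg_right (hV.norm_kerFun_le y) (norm_nonneg _))
  have h2 := (ContinuousLinearMap.adjoint (RKHS.kerFun (𝕜 := ℝ) V x)).integrable_comp h1
  simp_rw [RKHS.kernel_apply]
  exact h2

include hΩo hf₀ hgf in
-- Pairing with `a` is the reproducing property: `⟨k(x), a⟩` is the defining functional of the
-- potential evaluated at the kernel section `K(·, x) a`. Symmetry of the kernel turns that pairing
-- into the integral operator applied to the force field.
lemma forcePotential_apply (v : VelocityL2 V) (F : ImageL2 Ω) {q : ℝ}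
    (hq : q ∈ Icc (0 : ℝ) 1) (x : Space n) :
    hV.forcePotential hΩ hg M v F q x = kernelOp Ω V (forceField M v F f₀ q) x := by
  refine ext_inner_right ℝ fun a => ?_
  rw [← RKHS.inner_kerFun, forcePotential, inner_neg_left, ContinuousLinearMap.adjoint_inner_left,
    imageTransportL_apply]
  have h2 : inner ℝ (kernelOp Ω V (forceField M v F f₀ q) x) a =
      ∫ y in Ω, inner ℝ a (RKHS.kernel V x y (forceField M v F f₀ q y)) := by
    rw [real_inner_comm]
    exact (integral_inner (hV.integrable_kernel_forceField hΩ hg hΩo hf₀ hgf v F hq x) a).symm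
  have h1 := inner_toL2 (hV.memLp_imageTransport hΩ hg v q q (RKHS.kerFun V x a))
    (∫ τ in q..1, pulledGradient M v F q τ)
  rw [imageTransport, h1, h2, ← integral_neg]
  refine integral_congr_ae ?_
  filter_upwards [hV.forceField_ae_eq hΩ hΩo hf₀ hgf v F (M := M) hq] with y hy
  rw [← real_inner_comm a, RKHS.kernel_inner, RKHS.kerFun_inner, hy, inner_neg_left, inner_smul_left,
    ContinuousLinearMap.adjoint_inner_left, transport, hV.phi_self]
  rfl

include hM

lemma inner_forcePotential (v : VelocityL2 V) (F : ImageL2 Ω) {q : ℝ} (hq : q ∈ Icc (0 : ℝ) 1)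
    (u : V) : inner ℝ (hV.forcePotential hΩ hg M v F q) u =
      -∫ τ in q..1, inner ℝ (gradient (M τ) (hV.pull hΩ v τ 0 F))
        (imageTransport Ω g v τ q u) := by
  rw [forcePotential, inner_neg_left, ContinuousLinearMap.adjoint_inner_left,
    imageTransportL_apply, hV.inner_integral_pulledGradient hΩ hM v F hq hq]
  simp only [hV.pull_imageTransport hΩ hg]

/-- Duality: the representative is paired with itself and one factor of its norm is cancelled. -/
lemma exists_norm_forcePotential_le (v : VelocityL2 V) (F : ImageL2 Ω) : ∃ B : ℝ,
    ∀ q ∈ Icc (0 : ℝ) 1, ‖hV.forcePotential hΩ hg M v F q‖ ≤ B := by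
  obtain ⟨B, hB0, hB⟩ := hV.exists_norm_imageTransport_le hΩ hg v
  have hG := hM.integrableOn_gradient (hV.continuous_pull_snd hΩ v 0 F)
  set G := fun t => gradient (M t) (hV.pull hΩ v t 0 F)
  refine ⟨(∫ τ in Icc (0 : ℝ) 1, ‖G τ‖) * B, fun q hq => ?_⟩
  set k := hV.forcePotential hΩ hg M v F q with hk
  have h1 : ‖k‖ * ‖k‖ ≤ (∫ τ in Icc (0 : ℝ) 1, ‖G τ‖) * B * ‖k‖ := by
    rw [← real_inner_self_eq_norm_mul_norm, hk, hV.inner_forcePotential hΩ hg hM v F hq, ← hk,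
      ← integral_mul_const, ← integral_mul_const, intervalIntegral.integral_of_le hq.2]
    refine (neg_le_abs _).trans ?_
    rw [← Real.norm_eq_abs]
    refine (norm_integral_le_of_norm_le (g := fun τ => ‖G τ‖ * B * ‖k‖) ?_
      (Eventually.of_forall fun τ => ?_)).trans ?_
    · exact (((hG.mono_set (Ioc_subset_Icc_self.trans (Icc_subset_Icc_left hq.1))).norm).mul_const
        _).mul_const _
    · rw [mul_assoc]
      exact (norm_inner_le_norm _ _).trans (mul_le_mul_of_nonneg_left (hB _ _ _) (norm_nonneg _))
    · exact setIntegral_mono_set ((hG.norm.mul_const _).mul_const _)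
        (Eventually.of_forall fun τ => by positivity)
        (Ioc_subset_Icc_self.trans (Icc_subset_Icc_left hq.1)).eventuallyLE
  rcases (norm_nonneg k).eq_or_lt with h0 | h0
  · rw [← h0]
    exact mul_nonneg (integral_nonneg fun _ => norm_nonneg _) hB0
  · exact le_of_mul_le_mul_right h1 h0

include hgm in
-- Pairings with a fixed `u ∈ V` are partial integrals over the triangle `q < τ`, measurable in `q`
-- by Fubini; `V` is separable, so Pettis' theorem applies, and boundedness gives square
-- integrability.
lemma memLp_forcePotential (v : VelocityL2 V) (F : ImageL2 Ω) :
    MemLp (hV.forcePotential hΩ hg M v F) 2 (volume.restrict (Icc 0 1)) := by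
  have := hV.secondCountableTopology
  obtain ⟨B, hB⟩ := hV.exists_norm_forcePotential_le hΩ hg hM v F
  refine MemLp.of_bound (aestronglyMeasurable_of_inner fun u => ?_) B
    ((ae_restrict_mem measurableSet_Icc).mono hB)
  have hG := hM.integrableOn_gradient (hV.continuous_pull_snd hΩ v 0 F)
  have h1 := (hV.integrable_inner_imageTransport hΩ hg hgm v (u := fun _ => u)
    stronglyMeasurable_const (integrable_const u) hG).indicator
    (s := {p : ℝ × ℝ | p.2 < p.1}) (measurableSet_lt measurable_snd measurable_fst)
  refine h1.integral_prod_right.neg.aestronglyMeasurable.congr ?_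
  filter_upwards [ae_restrict_mem measurableSet_Icc] with q hq
  rw [hV.inner_forcePotential hΩ hg hM v F hq, Pi.neg_apply, neg_inj,
    intervalIntegral.integral_of_le hq.2]
  have h2 : Icc (0 : ℝ) 1 ∩ Ioi q = Ioc q 1 := by
    ext τ
    exact ⟨fun h => ⟨h.2, h.1.2⟩, fun h => ⟨⟨hq.1.trans h.1.le, h.2⟩, h.1⟩⟩
  rw [← h2, ← setIntegral_indicator measurableSet_Ioi]
  rfl

end IsAdmissibleWith

lemma memLp_scale {V : Type*} [NormedAddCommGroup V] [NormedSpace ℝ V] (v : VelocityL2 V) :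
    MemLp (fun t => (2 * (1 - t)) • (v t : V)) 2 (volume.restrict (Icc 0 1)) := by
  refine (Lp.memLp v).of_le_mul (c := 2) ?_ ?_
  · exact AEStronglyMeasurable.smul (by fun_prop) (Lp.aestronglyMeasurable v)
  · filter_upwards [ae_restrict_mem measurableSet_Icc] with t ht
    rw [norm_smul, Real.norm_of_nonneg (by linarith [ht.2])]
    exact mul_le_mul_of_nonneg_right (by linarith [ht.1]) (norm_nonneg _)

namespace IsAdmissibleWith

variable [CompleteSpace V] {X : Type*} [NormedAddCommGroup X] [NormedSpace ℝ X]
  (ι : X →L[ℝ] ImageL2 Ω)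

include hgm hM in
/-- The gradient of the objective with respect to the velocity field. -/
lemma hasGradientAt_objective (hΩo : IsOpen Ω) {f₀ : Space n → ℝ}
    (hf₀ : DifferentiableOn ℝ f₀ Ω) (hgf : g =ᵐ[volume.restrict Ω] gradient f₀) {f : X}
    (hf : ι f =ᵐ[volume.restrict Ω] f₀) (R₁ : X → ℝ) (μ₁ μ₂ : ℝ) (v : VelocityL2 V) :
    HasGradientAt (objective ι M R₁ μ₁ μ₂ f)
      ((hV.memLp_forcePotential hΩ hg hgm hM v (ι f)).toLp _
        + μ₂ • (memLp_scale v).toLp _) v := by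
  have h1 : objective ι M R₁ μ₁ μ₂ f = fun v : VelocityL2 V =>
      (∫ t in Icc (0 : ℝ) 1, M t (hV.pull hΩ v t 0 (ι f))) + μ₂ * energy v + μ₁ * R₁ f :=
    funext fun v => hV.objective_eq hΩ ι hM R₁ μ₁ μ₂ f v
  have hk := hV.memLp_forcePotential hΩ hg hgm hM v (ι f)
  have h2 := hV.hasFDerivAt_data_velocity hΩ hg hgm hM hΩo hf₀ hgf hf v
    (L := innerSL ℝ (hk.toLp _)) (fun w => by
      rw [hV.integral_inner_imageVariation hΩ hg hgm v w
        (hM.integrableOn_gradient (hV.continuous_pull_snd hΩ v 0 (ι f))), ← integral_neg,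
        innerSL_apply_apply, L2.inner_def]
      refine integral_congr_ae ?_
      filter_upwards [hk.coeFn_toLp, ae_restrict_mem measurableSet_Icc] with q hq hq'
      rw [hq, hV.inner_forcePotential hΩ hg hM v (ι f) hq'])
  have h3 := hasFDerivAt_energy (v := v) (L := innerSL ℝ ((memLp_scale v).toLp _)) (fun w => by
    rw [innerSL_apply_apply, L2.inner_def]
    refine integral_congr_ae ?_
    filter_upwards [(memLp_scale v).coeFn_toLp] with q hq
    rw [hq, inner_smul_left]
    rfl)
  rw [hasGradientAt_iff_hasFDerivAt, h1]
  refine ((h2.add (h3.const_mul μ₂)).add_const (μ₁ * R₁ f)).congr_fderiv ?_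
  ext w
  simp

end IsAdmissibleWith

end VelocityGradient

end LDDMM

end

/-! ### Assembly of the theorem. -/

theorem mainTheorem2 {n : ℕ} (Ω : Set (LDDMM.Space n)) (hΩ : IsOpen Ω)
    -- an admissible reproducing kernel Hilbert space of vector fields on `Ω`
    {V : Type*} [NormedAddCommGroup V] [InnerProductSpace ℝ V] [CompleteSpace V]
    [RKHS ℝ V (LDDMM.Space n) (LDDMM.Space n)] (hV : LDDMM.IsAdmissible Ω V)
    -- the space of templates
    {X : Type*} [NormedAddCommGroup X] [NormedSpace ℝ X]
    (ι : X →L[ℝ] LDDMM.ImageL2 Ω) (hι : DenseRange ι)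
    -- data discrepancy, forward operators and data
    {Y : Type*} (D : Y → Y → ℝ) (A : ℝ → LDDMM.ImageL2 Ω → Y) (g : ℝ → Y)
    (hD : LDDMM.IsDifferentiableDataTerm (LDDMM.dataTerm D A g))
    (R₁ : X → ℝ) (μ₁ μ₂ : ℝ)
    -- a differentiable template `f`, with pointwise representative `f₀`, and a velocity field
    (f : X) (f₀ : LDDMM.Space n → ℝ) (hff₀ : ι f =ᵐ[volume.restrict Ω] f₀)
    (hf₀ : DifferentiableOn ℝ f₀ Ω) (hgf₀ : MemLp (gradient f₀) 2 (volume.restrict Ω))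
    (gradR : LDDMM.ImageL2 Ω) (hR : LDDMM.HasL2GradientAt ι R₁ gradR f)
    (v : LDDMM.VelocityL2 V) :
    LDDMM.IsWellDefined Ω V (LDDMM.dataTerm D A g) ∧
    (∀ t ∈ Icc (0 : ℝ) 1, ∀ x, IntegrableOn (fun y =>
      RKHS.kernel V x y (LDDMM.forceField (LDDMM.dataTerm D A g) v (ι f) f₀ t y)) Ω) ∧
    ∃ (k : ℝ → V) (gradV : LDDMM.VelocityL2 V) (gradF : LDDMM.ImageL2 Ω),
      -- the gradient with respect to the velocity field
      (∀ t ∈ Icc (0 : ℝ) 1, ∀ x, k t x =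
        LDDMM.kernelOp Ω V (LDDMM.forceField (LDDMM.dataTerm D A g) v (ι f) f₀ t) x) ∧
      (∀ᵐ t ∂(volume.restrict (Icc (0 : ℝ) 1)), gradV t = k t + (2 * μ₂ * (1 - t)) • v t) ∧
      HasGradientAt (LDDMM.objective ι (LDDMM.dataTerm D A g) R₁ μ₁ μ₂ f) gradV v ∧
      -- the gradient with respect to the template
      gradF = (∫ t in (0 : ℝ)..1, LDDMM.pulledGradient (LDDMM.dataTerm D A g) v (ι f) 0 t)
        + μ₁ • gradR ∧
      LDDMM.HasL2GradientAt ι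
        (fun h => LDDMM.objective ι (LDDMM.dataTerm D A g) R₁ μ₁ μ₂ h v) gradF f ∧
      -- the first-order optimality conditions
      (IsLocalMin (fun p : X × LDDMM.VelocityL2 V =>
          LDDMM.objective ι (LDDMM.dataTerm D A g) R₁ μ₁ μ₂ p.1 p.2) (f, v) →
        gradV = 0 ∧ gradF = 0) := by
  obtain ⟨C, hC⟩ := hV.exists_with
  have hm := hΩ.measurableSet
  -- `gradient f₀` is only almost everywhere measurable on `Ω`; the Fubini arguments use a strongly
  -- measurable representative instead.
  have hgm := hgf₀.aestronglyMeasurable.stronglyMeasurable_mk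
  have hgf := hgf₀.aestronglyMeasurable.ae_eq_mk.symm
  have hg := (memLp_congr_ae hgf).2 hgf₀
  have hgradV := hC.hasGradientAt_objective hm hg hgm hD ι hΩ hf₀ hgf hff₀ R₁ μ₁ μ₂ v
  have hgradF := hC.hasL2GradientAt_objective hm ι hD μ₁ μ₂ hR v
  refine ⟨hC.isWellDefined hm hD,
    fun t ht x => hC.integrable_kernel_forceField hm hg hΩ hf₀ hgf v (ι f) ht x,
    hC.forcePotential hm hg (LDDMM.dataTerm D A g) v (ι f), _, _,
    fun t ht x => hC.forcePotential_apply hm hg hΩ hf₀ hgf v (ι f) ht x, ?_, hgradV, rfl, hgradF,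
    fun hmin => ⟨?_, ?_⟩⟩
  · have hk := hC.memLp_forcePotential hm hg hgm hD v (ι f)
    have hs := LDDMM.memLp_scale v
    filter_upwards [Lp.coeFn_add (hk.toLp _) (μ₂ • hs.toLp _), hk.coeFn_toLp,
      Lp.coeFn_smul μ₂ (hs.toLp _), hs.coeFn_toLp] with t h1 h2 h3 h4
    rw [h1, Pi.add_apply, h2, h3, Pi.smul_apply, h4, smul_smul]
    congr 2
    ring
  -- A joint local minimiser minimises locally in each variable with the other frozen, and Fermat's
  -- rule applies to each partial functional.
  · have h1 : IsLocalMin (LDDMM.objective ι (LDDMM.dataTerm D A g) R₁ μ₁ μ₂ f) v :=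
      hmin.comp_continuous (g := fun w => (f, w)) (by fun_prop)
    have h2 := h1.hasFDerivAt_eq_zero hgradV.hasFDerivAt
    exact (InnerProductSpace.toDual ℝ (LDDMM.VelocityL2 V)).map_eq_zero_iff.1 h2
  · have h1 : IsLocalMin
        (fun h => LDDMM.objective ι (LDDMM.dataTerm D A g) R₁ μ₁ μ₂ h v) f :=
      hmin.comp_continuous (g := fun h => (h, v)) (by fun_prop)
    have h2 := h1.hasFDerivAt_eq_zero hgradF
    -- The derivative vanishes only on images `ι h`; density of these forces the gradient in `L²(Ω)`
    -- to be zero.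
    refine hι.eq_zero_of_inner_left ℝ fun h => ?_
    exact DFunLike.congr_fun h2 h
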